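/- Let $n$ be a natural number and let $\Omega\subset\mathbb R^n$ be a rectangular polyhedral domain, i.e. a connected open set that is the interior of its closure and whose closure is a finite union of nondegenerate closed boxes with edges parallel to the coordinate axes. Let $\mathcal T_h$ be a rectangular grid of $\Omega$: a finite set of nondegenerate closed boxes $K$ with edges parallel to the axes, with pairwise disjoint interiors, with union $\overline\Omega$, any two of which are disjoint or meet in a common face (of any dimension). Its grid size $h$ is the largest edge length of its elements. Let $\mathbb S$ be the space of symmetric real $n\times n$ matrices, let $\mathrm{div}$ act row by row, and let $H(\mathrm{div},\Omega,\mathbb S)$ be the space of $\tau\in L^2(\Omega,\mathbb S)$ with weak divergence in $L^2(\Omega,\mathbb R^n)$. Put $$\Sigma(K)=\{\sigma=(\sigma_{ij})\ \text{symmetric}:\ \sigma_{ii}\in\mathrm{span}\{1,x_i,x_i^2\},\ \ \sigma_{ij}\in\mathrm{span}\{1,x_i,x_j,x_ix_j\}\ (i\neq j)\},$$ $$\Sigma_h=\{\tau\in H(\mathrm{div},\Omega,\mathbb S):\ \tau|_K\in\Sigma(K)\ \text{for all }K\in\mathcal T_h\}.$$ For $\sigma\in H^2(\Omega,\mathbb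 S)$ the interpolation $\Pi_h\sigma\in\Sigma_h$, $(\Pi_h\sigma)_{ij}=\Pi_{ij}\sigma_{ij}$, is defined as follows on every $K\in\mathcal T_h$ (integrals over faces are those of the traces): * for every $i$, $\Pi_{ii}\sigma_{ii}$ and $\sigma_{ii}$ have the same integral over $K$ and over each of the two $(n-1)$-dimensional faces of $K$ perpendicular to the $x_i$-axis; * for $i\ne j$, $\Pi_{ij}\sigma_{ij}$ is the function bilinear in $(x_i,x_j)$ (and independent of the other variables) whose value on each of the four $(n-2)$-dimensional faces $F$ of $K$ perpendicular to the $x_i$- and $x_j$-axes is the average $\frac1{|F|}\int_F\sigma_{ij}\,dF$ (if $n=2$, the value of $\sigma_{ij}$ at the vertex $F$). Then there is a constant $C>0$, depending only on $n$ and $\Omega$ and not on the grid or on $\sigma$, such that for every rectangular grid $\mathcal T_h$ of $\Omega$ and every $\sigma\in H^2(\Omega,\mathbb S)$ these conditions determine exactly one $\Pi_h\sigma\in\Sigma_h$ (up to equality almost everywhere), and $$\|\sigma-\Pi_h\sigma\|_0\le Ch\|\sigma\|_2,\qquad \|\mathrm{div}(\sigma-\Pi_h\sigma)\|_0\le Ch\|\sigma\|_2,$$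 where $\|\cdot\|_0$ is the $L^2(\Omega)$ norm and $\|\cdot\|_2$ the $H^2(\Omega)$ norm. -/

import Mathlib

open MeasureTheory Filter Topology
open scoped ContDiff

/-! ### Weak derivatives and Sobolev spaces

Points of `ℝⁿ` are functions `Fin n → ℝ`; `volume` is Lebesgue measure. -/

/-- The classical partial derivative `∂φ/∂x_i`. -/
noncomputable def partialDeriv {n : ℕ} (i : Fin n) (φ : (Fin n → ℝ) → ℝ) (x : Fin n → ℝ) : ℝ :=
  fderiv ℝ φ x (Pi.single i 1)

/-- Test functions: smooth, with compact support contained in `Ω`. -/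
def IsTest {n : ℕ} (Ω : Set (Fin n → ℝ)) (φ : (Fin n → ℝ) → ℝ) : Prop :=
  ContDiff ℝ ∞ φ ∧ HasCompactSupport φ ∧ tsupport φ ⊆ Ω

/-- `g` is the weak partial derivative `∂u/∂x_i` on the open set `Ω`. -/
def HasWeakPartial {n : ℕ} (Ω : Set (Fin n → ℝ)) (i : Fin n) (u g : (Fin n → ℝ) → ℝ) : Prop :=
  LocallyIntegrableOn u Ω ∧ LocallyIntegrableOn g Ω ∧
    ∀ φ, IsTest Ω φ → ∫ x in Ω, u x * partialDeriv i φ x = -∫ x in Ω, g x * φ x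

open Classical in
/-- The weak partial derivative (unique almost everywhere; `0` if there is none). -/
noncomputable def weakPartial {n : ℕ} (Ω : Set (Fin n → ℝ)) (i : Fin n)
    (u : (Fin n → ℝ) → ℝ) : (Fin n → ℝ) → ℝ :=
  if h : ∃ g, HasWeakPartial Ω i u g then h.choose else 0

/-- `u ∈ H^k(Ω)`: all weak derivatives of order at most `k` exist and are square-integrable. -/
def MemSobolev {n : ℕ} (Ω : Set (Fin n → ℝ)) : ℕ → ((Fin n → ℝ) → ℝ) → Prop
  | 0, u => MemLp u 2 (volume.restrict Ω)
  | k + 1, u => MemLp u 2 (volume.restrict Ω) ∧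
      ∀ i : Fin n, ∃ g, HasWeakPartial Ω i u g ∧ MemSobolev Ω k g

/-- `‖u‖²_{k,Ω}`: the sum of the squared `L²(Ω)` norms of the weak derivatives
`∂_{i₁} ⋯ ∂_{i_m} u`, over all `0 ≤ m ≤ k` and all index sequences `i₁, …, i_m`. -/
noncomputable def sobolevNormSq {n : ℕ} (Ω : Set (Fin n → ℝ)) : ℕ → ((Fin n → ℝ) → ℝ) → ℝ
  | 0, u => ∫ x in Ω, u x ^ 2
  | k + 1, u => (∫ x in Ω, u x ^ 2) + ∑ i : Fin n, sobolevNormSq Ω k (weakPartial Ω i u)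

/-- `σ ∈ H^k(Ω, 𝕊)`, with values in the symmetric `n × n` matrices. -/
def MemSobolevSym {n : ℕ} (Ω : Set (Fin n → ℝ)) (k : ℕ)
    (σ : (Fin n → ℝ) → Matrix (Fin n) (Fin n) ℝ) : Prop :=
  (∀ᵐ x ∂volume.restrict Ω, (σ x).IsSymm) ∧ ∀ i j, MemSobolev Ω k (fun x => σ x i j)

/-- `‖σ‖_{k,Ω}` of a matrix field; for `k = 0` this is the `L²(Ω)` norm. -/
noncomputable def matSobolevNorm {n : ℕ} (Ω : Set (Fin n → ℝ)) (k : ℕ)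
    (σ : (Fin n → ℝ) → Matrix (Fin n) (Fin n) ℝ) : ℝ :=
  Real.sqrt (∑ i, ∑ j, sobolevNormSq Ω k (fun x => σ x i j))

/-! ### The row-wise weak divergence and `H(div, Ω, 𝕊)` -/

/-- `d` is the weak divergence of the vector field `w` on the open set `Ω`. -/
def HasWeakDiv {n : ℕ} (Ω : Set (Fin n → ℝ)) (w : (Fin n → ℝ) → Fin n → ℝ)
    (d : (Fin n → ℝ) → ℝ) : Prop :=
  (∀ j, LocallyIntegrableOn (fun x => w x j) Ω) ∧ LocallyIntegrableOn d Ω ∧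
    ∀ φ, IsTest Ω φ →
      ∫ x in Ω, ∑ j, w x j * partialDeriv j φ x = -∫ x in Ω, d x * φ x

open Classical in
/-- The weak divergence (unique almost everywhere; `0` if there is none). -/
noncomputable def weakDiv {n : ℕ} (Ω : Set (Fin n → ℝ)) (w : (Fin n → ℝ) → Fin n → ℝ) :
    (Fin n → ℝ) → ℝ :=
  if h : ∃ d, HasWeakDiv Ω w d then h.choose else 0

/-- `τ ∈ H(div, Ω, 𝕊)`. -/
def MemHdivSym {n : ℕ} (Ω : Set (Fin n → ℝ))
    (τ : (Fin n → ℝ) → Matrix (Fin n) (Fin n) ℝ) : Prop :=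
  (∀ᵐ x ∂volume.restrict Ω, (τ x).IsSymm) ∧
  (∀ i j, MemLp (fun x => τ x i j) 2 (volume.restrict Ω)) ∧
  ∀ i, ∃ d, HasWeakDiv Ω (fun x => τ x i) d ∧ MemLp d 2 (volume.restrict Ω)

/-- `‖div τ‖_{0,Ω}`, the divergence being taken row by row. -/
noncomputable def divNorm {n : ℕ} (Ω : Set (Fin n → ℝ))
    (τ : (Fin n → ℝ) → Matrix (Fin n) (Fin n) ℝ) : ℝ :=
  Real.sqrt (∑ i, ∫ x in Ω, weakDiv Ω (fun x => τ x i) x ^ 2)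

/-! ### Boxes, faces and rectangular grids

An element is a nondegenerate box `K`, with closed box `K.Icc` and open box `K.Ioo`.
A face is given by a set `S` of coordinates that are frozen and, for `i ∈ S`, by the end `c i` of
the edge in direction `i` (`true`: upper, `false`: lower) at which `x_i` is frozen.
The values of `c` outside `S` play no role. -/

/-- The lower or upper end of `K` in direction `i`. -/
def boxEnd {n : ℕ} (K : BoxIntegral.Box (Fin n)) (i : Fin n) (b : Bool) : ℝ :=
  if b then K.upper i else K.lower i

/-- The face of `K` of dimension `n - |S|` given by `S` and `c`. -/
def boxFace {n : ℕ} (K : BoxIntegral.Box (Fin n)) (S : Finset (Fin n)) (c : Fin n → Bool) :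
    Set (Fin n → ℝ) :=
  {x | x ∈ BoxIntegral.Box.Icc K ∧ ∀ i ∈ S, x i = boxEnd K i (c i)}

/-- The `(n - |S|)`-dimensional Lebesgue measure on a face of `K`; if all coordinates are frozen,
this is the unit mass at the vertex. -/
noncomputable def faceMeasure {n : ℕ} (K : BoxIntegral.Box (Fin n)) (S : Finset (Fin n))
    (c : Fin n → Bool) : Measure (Fin n → ℝ) :=
  Measure.pi fun k => if k ∈ S then Measure.dirac (boxEnd K k (c k))
    else volume.restrict (Set.Icc (K.lower k) (K.upper k))

/-- A rectangular polyhedral domain: a connected open set, equal to the interior of its closure,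
whose closure is a finite union of closed boxes with edges parallel to the axes. -/
def IsRectPolyhedron {n : ℕ} (Ω : Set (Fin n → ℝ)) : Prop :=
  IsOpen Ω ∧ IsConnected Ω ∧ interior (closure Ω) = Ω ∧
    ∃ s : Finset (BoxIntegral.Box (Fin n)), closure Ω = ⋃ K ∈ s, BoxIntegral.Box.Icc K

/-- A rectangular grid: a finite set of non-overlapping boxes, any two of which meet in a common
face (of any dimension) or not at all. -/
structure RectGrid (n : ℕ) where
  cells : Finset (BoxIntegral.Box (Fin n))
  disjoint : ∀ K ∈ cells, ∀ K' ∈ cells, K ≠ K' →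
    Disjoint (BoxIntegral.Box.Ioo K) (BoxIntegral.Box.Ioo K')
  conforming : ∀ K ∈ cells, ∀ K' ∈ cells,
    BoxIntegral.Box.Icc K ∩ BoxIntegral.Box.Icc K' = ∅ ∨
    ∃ S c S' c', BoxIntegral.Box.Icc K ∩ BoxIntegral.Box.Icc K' = boxFace K S c ∧
      BoxIntegral.Box.Icc K ∩ BoxIntegral.Box.Icc K' = boxFace K' S' c'

/-- The grid subdivides the domain `Ω`. -/
def RectGrid.Subdivides {n : ℕ} (T : RectGrid n) (Ω : Set (Fin n → ℝ)) : Prop :=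
  closure Ω = ⋃ K ∈ T.cells, BoxIntegral.Box.Icc K

/-- The grid size `h`: the largest edge length of an element. -/
noncomputable def RectGrid.size {n : ℕ} (T : RectGrid n) : ℝ :=
  ⨆ p : {K // K ∈ T.cells} × Fin n, (p.1.1.upper p.2 - p.1.1.lower p.2)

/-! ### Traces -/

/-- `g` is the trace of `u ∈ H²(K)` on a face of `K`: the `L²` limit on the face of the restrictions
of smooth functions that converge to `u` in `H²(K)`. -/
def HasTrace {n : ℕ} (K : BoxIntegral.Box (Fin n)) (S : Finset (Fin n)) (c : Fin n → Bool)
    (u g : (Fin n → ℝ) → ℝ) : Prop :=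
  MemSobolev (BoxIntegral.Box.Ioo K) 2 u ∧ MemLp g 2 (faceMeasure K S c) ∧
  ∃ φ : ℕ → (Fin n → ℝ) → ℝ, (∀ m, ContDiff ℝ ∞ (φ m)) ∧
    Tendsto (fun m => sobolevNormSq (BoxIntegral.Box.Ioo K) 2 (fun x => u x - φ m x))
      atTop (𝓝 0) ∧
    Tendsto (fun m => ∫ x, (g x - φ m x) ^ 2 ∂(faceMeasure K S c)) atTop (𝓝 0)

/-! ### The finite element space and the interpolation -/

/-- `Σ(K)`: symmetric fields with `σ_ii ∈ span {1, x_i, x_i²}` and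
`σ_ij ∈ span {1, x_i, x_j, x_i x_j}` for `i ≠ j`. -/
def MemLocalStress {n : ℕ} (p : (Fin n → ℝ) → Matrix (Fin n) (Fin n) ℝ) : Prop :=
  (∀ x, (p x).IsSymm) ∧
  (∀ i, ∃ a₀ a₁ a₂ : ℝ, ∀ x, p x i i = a₀ + a₁ * x i + a₂ * x i ^ 2) ∧
  ∀ i j, i ≠ j → ∃ a₀ a₁ a₂ a₃ : ℝ, ∀ x,
    p x i j = a₀ + a₁ * x i + a₂ * x j + a₃ * (x i * x j)

/-- `Σ_h`: fields in `H(div, Ω, 𝕊)` that are in `Σ(K)` on every element `K`. -/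
def MemStressSpace {n : ℕ} (Ω : Set (Fin n → ℝ)) (T : RectGrid n)
    (τ : (Fin n → ℝ) → Matrix (Fin n) (Fin n) ℝ) : Prop :=
  MemHdivSym Ω τ ∧ ∀ K ∈ T.cells, ∃ p, MemLocalStress p ∧
    ∀ᵐ x ∂volume.restrict (BoxIntegral.Box.Icc K), τ x = p x

/-- The affine nodal functions `1 - t` and `t` on `[0, 1]`; the products of two of them are the four
bilinear nodal functions of the unit square. -/
def nodalFun (b : Bool) (t : ℝ) : ℝ := if b then t else 1 - t

/-- The affine coordinate on `K` in direction `i`, running over `[0, 1]`. -/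
noncomputable def refCoord {n : ℕ} (K : BoxIntegral.Box (Fin n)) (i : Fin n) (x : Fin n → ℝ) : ℝ :=
  (x i - K.lower i) / (K.upper i - K.lower i)

/-- `q = Π_ii u` on `K`: `q` and `u` have equal integrals over the two faces of `K` perpendicular to
the `x_i` axis, and over `K`. -/
def IsNormalInterp {n : ℕ} (K : BoxIntegral.Box (Fin n)) (i : Fin n)
    (u q : (Fin n → ℝ) → ℝ) : Prop :=
  (∀ b : Bool, ∃ g, HasTrace K {i} (fun _ => b) u g ∧
    ∫ x, q x ∂(faceMeasure K {i} fun _ => b) = ∫ x, g x ∂(faceMeasure K {i} fun _ => b)) ∧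
  ∫ x in BoxIntegral.Box.Icc K, q x = ∫ x in BoxIntegral.Box.Icc K, u x

/-- `q = Π_ij u` on `K`, for `i ≠ j`: the combination of the four bilinear nodal functions in
`(x_i, x_j)` whose coefficients are the averages of `u` over the corresponding faces of `K` of
codimension two, perpendicular to the `x_i` and `x_j` axes. -/
def IsShearInterp {n : ℕ} (K : BoxIntegral.Box (Fin n)) (i j : Fin n)
    (u q : (Fin n → ℝ) → ℝ) : Prop :=
  ∃ g : Bool → Bool → (Fin n → ℝ) → ℝ,
    (∀ s t, HasTrace K {i, j} (fun k => if k = i then s else t) u (g s t)) ∧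
    ∀ x, q x = ∑ s : Bool, ∑ t : Bool,
      (⨍ y, g s t y ∂(faceMeasure K {i, j} fun k => if k = i then s else t)) *
        (nodalFun s (refCoord K i x) * nodalFun t (refCoord K j x))

/-- `τ = Π_h σ`. -/
def IsInterpolant {n : ℕ} (Ω : Set (Fin n → ℝ)) (T : RectGrid n)
    (σ τ : (Fin n → ℝ) → Matrix (Fin n) (Fin n) ℝ) : Prop :=
  MemStressSpace Ω T τ ∧ ∀ K ∈ T.cells, ∃ p, MemLocalStress p ∧
    (∀ᵐ x ∂volume.restrict (BoxIntegral.Box.Icc K), τ x = p x) ∧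
    (∀ i, IsNormalInterp K i (fun x => σ x i i) (fun x => p x i i)) ∧
    ∀ i j, i ≠ j → IsShearInterp K i j (fun x => σ x i j) (fun x => p x i j)

/-! ### Calculus of weak derivatives -/

section WeakDerivatives

variable {n : ℕ} {Ω : Set (Fin n → ℝ)}

/-! On a single box `K`, equipped with its uniform probability measure, every entry of the
interpolant is an average, over the coordinates that its polynomial does not involve, of an ordinary
interpolation in the remaining one or two coordinates: affine in `x_i` and in `x_j` for a shear
entry, quadratic in `x_i` for a diagonal entry. Averaging over coordinates contracts `L²`. Along a
chord of `K`, interpolation misses a smooth function by at most a multiple of the integral of the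
absolute derivative over that chord (`abs_sub_le_chordIntegral`), and the `L²` norm of this chord
integral is at most the edge length times the norm of the derivative (`ltwo_chordIntegral_le`). Each
estimate thus gains an edge length per derivative, and no ratio of edge lengths appears, so
anisotropic grids are harmless. A mixed second derivative comes with a product of two edge lengths;
bounding one of them by the diameter of the domain is the only way in which the domain enters the
constant.

The divergence is controlled because interpolation nearly commutes with differentiation. The
derivative in `x_j` of the shear interpolant is the affine interpolation in `x_i` of means of `∂_j
σ_ij` over faces (`shearPolyDeriv_edgeAvg`), and the derivative of quadratic interpolation differs
from the true derivative by at most a multiple of the oscillation of the latter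
(`abs_deriv_sub_quadratic_le`). So the derivative error is of first order in terms of second
derivatives.

Functions in `H²` are reached by density: contraction of the box towards its centre followed by
mollification (`HTwo.exists_tendstoHTwo`). Trace inequalities on faces of codimension one and two
make the face means of any smooth approximation converge, so that traces exist, their means are
unambiguous, and the local estimates pass to the limit.

Conformity asks for little: the entry `(i, j)` needs a weak derivative only in direction `j`. Where
two cells share a face perpendicular to the axis `j`, this entry is determined on the face by means
of traces over the face or over faces of codimension two inside it. The two cells form a box
contained in the domain, one smooth sequence approximates `σ_ij` on it, and so both cells see the
same means (`IsBelow.traceMean_eq`). The entry is therefore continuous along almost every line in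
direction `j`, and the fundamental theorem of calculus with Fubini yields the weak derivative
(`RectGrid.Subdivides.hasWeakPartial_glue`). Summing squared cell errors gives the global bounds. -/

theorem MeasureTheory.MemLp.locallyIntegrableOn_two {u : (Fin n → ℝ) → ℝ}
    (h : MemLp u 2 (volume.restrict Ω)) : LocallyIntegrableOn u Ω :=
  locallyIntegrableOn_of_locallyIntegrable_restrict (h.locallyIntegrable (by norm_num))

theorem LocallyIntegrableOn.congr_ae_of_isOpen {u v : (Fin n → ℝ) → ℝ} (hΩ : IsOpen Ω)
    (hu : LocallyIntegrableOn u Ω) (huv : u =ᵐ[volume.restrict Ω] v) :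
    LocallyIntegrableOn v Ω := by
  rw [locallyIntegrableOn_iff hΩ.isLocallyClosed] at hu ⊢
  intro k hk hkc
  exact (hu k hk hkc).congr (ae_restrict_of_ae_restrict_of_subset hk huv)

theorem contDiff_partialDeriv {φ : (Fin n → ℝ) → ℝ} (hφ : ContDiff ℝ ∞ φ) (i : Fin n) :
    ContDiff ℝ ∞ (partialDeriv i φ) :=
  (hφ.fderiv_right (m := ∞) (by simp)).clm_apply contDiff_const

theorem IsTest.mono {Ω' : Set (Fin n → ℝ)} {φ : (Fin n → ℝ) → ℝ} (h : Ω' ⊆ Ω)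
    (hφ : IsTest Ω' φ) : IsTest Ω φ := ⟨hφ.1, hφ.2.1, hφ.2.2.trans h⟩

theorem IsTest.eq_zero {φ : (Fin n → ℝ) → ℝ} (hφ : IsTest Ω φ) {x : Fin n → ℝ} (hx : x ∉ Ω) :
    φ x = 0 :=
  image_eq_zero_of_notMem_tsupport fun h => hx (hφ.2.2 h)

theorem tsupport_partialDeriv_subset (φ : (Fin n → ℝ) → ℝ) (i : Fin n) :
    tsupport (partialDeriv i φ) ⊆ tsupport φ :=
  tsupport_fderiv_apply_subset ℝ _

theorem IsTest.partialDeriv {φ : (Fin n → ℝ) → ℝ} (hφ : IsTest Ω φ) (i : Fin n) :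
    IsTest Ω (partialDeriv i φ) :=
  ⟨contDiff_partialDeriv hφ.1 i, hφ.2.1.mono' (subset_closure.trans
    (tsupport_partialDeriv_subset φ i)), (tsupport_partialDeriv_subset φ i).trans hφ.2.2⟩

theorem LocallyIntegrableOn.integrable_mul_test {u φ : (Fin n → ℝ) → ℝ}
    (hu : LocallyIntegrableOn u Ω) (hφ : IsTest Ω φ) : Integrable (fun x => u x * φ x) := by
  have h1 : IntegrableOn u (tsupport φ) := hu.integrableOn_compact_subset hφ.2.2 hφ.2.1
  have h2 : IntegrableOn (fun x => φ x * u x) (tsupport φ) :=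
    h1.continuousOn_mul hφ.1.continuous.continuousOn hφ.2.1
  rw [integrableOn_iff_integrable_of_support_subset] at h2
  · simpa only [mul_comm] using h2
  · intro x hx
    exact subset_tsupport φ (left_ne_zero_of_mul hx)

theorem IsTest.setIntegral_mul_eq {φ : (Fin n → ℝ) → ℝ} (hφ : IsTest Ω φ)
    (u : (Fin n → ℝ) → ℝ) : ∫ x in Ω, u x * φ x = ∫ x, u x * φ x :=
  setIntegral_eq_integral_of_forall_compl_eq_zero fun x hx => by rw [hφ.eq_zero hx, mul_zero]

theorem HasWeakPartial.congr {i : Fin n} {u v g k : (Fin n → ℝ) → ℝ} (hΩ : IsOpen Ω)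
    (h : HasWeakPartial Ω i u g) (huv : u =ᵐ[volume.restrict Ω] v)
    (hgk : g =ᵐ[volume.restrict Ω] k) : HasWeakPartial Ω i v k := by
  refine ⟨LocallyIntegrableOn.congr_ae_of_isOpen hΩ h.1 huv,
    LocallyIntegrableOn.congr_ae_of_isOpen hΩ h.2.1 hgk, fun φ hφ => ?_⟩
  have h1 : ∫ x in Ω, v x * partialDeriv i φ x = ∫ x in Ω, u x * partialDeriv i φ x :=
    integral_congr_ae (huv.mono fun x hx => by simp only [hx])
  have h2 : ∫ x in Ω, k x * φ x = ∫ x in Ω, g x * φ x :=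
    integral_congr_ae (hgk.mono fun x hx => by simp only [hx])
  rw [h1, h2, h.2.2 φ hφ]

/-- The fundamental lemma of the calculus of variations. Since `weakPartial` and `weakDiv` are
defined by choice, it is what identifies them almost everywhere with explicit derivatives. -/
theorem ae_eq_of_integral_mul_test_eq {g k : (Fin n → ℝ) → ℝ} (hΩ : IsOpen Ω)
    (hg : LocallyIntegrableOn g Ω) (hk : LocallyIntegrableOn k Ω)
    (h : ∀ φ, IsTest Ω φ → ∫ x in Ω, g x * φ x = ∫ x in Ω, k x * φ x) :
    g =ᵐ[volume.restrict Ω] k := by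
  have := hΩ.ae_eq_zero_of_integral_contDiff_smul_eq_zero (f := g - k) (μ := volume)
    (hg.sub hk) fun φ h1 h2 h3 => by
      have hφ : IsTest Ω φ := ⟨h1, h2, h3⟩
      have := h φ hφ
      rw [hφ.setIntegral_mul_eq, hφ.setIntegral_mul_eq] at this
      have e : ∀ x, φ x • (g - k) x = g x * φ x - k x * φ x := fun x => by
        simp only [Pi.sub_apply, smul_eq_mul]; ring
      simp only [e]
      rw [integral_sub (LocallyIntegrableOn.integrable_mul_test hg hφ)
        (LocallyIntegrableOn.integrable_mul_test hk hφ), this, sub_self]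
  rw [EventuallyEq, ae_restrict_iff' hΩ.measurableSet]
  exact this.mono fun x hx hxΩ => sub_eq_zero.1 (hx hxΩ)

theorem HasWeakPartial.ae_eq {i : Fin n} {u g k : (Fin n → ℝ) → ℝ} (hΩ : IsOpen Ω)
    (hg : HasWeakPartial Ω i u g) (hk : HasWeakPartial Ω i u k) : g =ᵐ[volume.restrict Ω] k :=
  ae_eq_of_integral_mul_test_eq hΩ hg.2.1 hk.2.1 fun φ hφ => by
    rw [← neg_inj, ← hg.2.2 φ hφ, hk.2.2 φ hφ]

theorem HasWeakPartial.weakPartial_ae_eq {i : Fin n} {u g : (Fin n → ℝ) → ℝ} (hΩ : IsOpen Ω)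
    (hg : HasWeakPartial Ω i u g) : weakPartial Ω i u =ᵐ[volume.restrict Ω] g := by
  have h : ∃ g, HasWeakPartial Ω i u g := ⟨g, hg⟩
  rw [weakPartial, dif_pos h]
  exact h.choose_spec.ae_eq hΩ hg

theorem HasWeakDiv.weakDiv_ae_eq {w : (Fin n → ℝ) → Fin n → ℝ} {d : (Fin n → ℝ) → ℝ}
    (hΩ : IsOpen Ω) (hd : HasWeakDiv Ω w d) : weakDiv Ω w =ᵐ[volume.restrict Ω] d := by
  have h : ∃ d, HasWeakDiv Ω w d := ⟨d, hd⟩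
  rw [weakDiv, dif_pos h]
  refine ae_eq_of_integral_mul_test_eq hΩ h.choose_spec.2.1 hd.2.1 fun φ hφ => ?_
  rw [← neg_inj, ← h.choose_spec.2.2 φ hφ, hd.2.2 φ hφ]

theorem HasWeakPartial.mono {Ω' : Set (Fin n → ℝ)} {i : Fin n} {u g : (Fin n → ℝ) → ℝ}
    (h : Ω' ⊆ Ω) (hg : HasWeakPartial Ω i u g) : HasWeakPartial Ω' i u g := by
  refine ⟨hg.1.mono_set h, hg.2.1.mono_set h, fun φ hφ => ?_⟩
  have := hg.2.2 φ (hφ.mono h)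
  rwa [(hφ.mono h).setIntegral_mul_eq, ((hφ.mono h).partialDeriv i).setIntegral_mul_eq,
    ← hφ.setIntegral_mul_eq, ← (hφ.partialDeriv i).setIntegral_mul_eq] at this

theorem HasWeakPartial.sub {i : Fin n} {u v g k : (Fin n → ℝ) → ℝ}
    (hg : HasWeakPartial Ω i u g) (hk : HasWeakPartial Ω i v k) :
    HasWeakPartial Ω i (fun x => u x - v x) (fun x => g x - k x) := by
  refine ⟨hg.1.sub hk.1, hg.2.1.sub hk.2.1, fun φ hφ => ?_⟩
  have hφ' := hφ.partialDeriv i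
  simp only [sub_mul]
  rw [integral_sub (LocallyIntegrableOn.integrable_mul_test hg.1 hφ').integrableOn
    (LocallyIntegrableOn.integrable_mul_test hk.1 hφ').integrableOn,
    integral_sub (LocallyIntegrableOn.integrable_mul_test hg.2.1 hφ).integrableOn
    (LocallyIntegrableOn.integrable_mul_test hk.2.1 hφ).integrableOn,
    hg.2.2 φ hφ, hk.2.2 φ hφ]
  ring

/-- Only the derivative of the component `j` in direction `j` enters. This is the regularity that
the interpolant has: its other weak derivatives need not exist, because an entry may jump across the
remaining faces. -/
theorem hasWeakDiv_of_hasWeakPartial {w : (Fin n → ℝ) → Fin n → ℝ} {d : Fin n → (Fin n → ℝ) → ℝ}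
    (hΩ : IsOpen Ω) (h : ∀ j, HasWeakPartial Ω j (fun x => w x j) (d j)) :
    HasWeakDiv Ω w (fun x => ∑ j, d j x) := by
  refine ⟨fun j => (h j).1, ?_, fun φ hφ => ?_⟩
  · rw [locallyIntegrableOn_iff hΩ.isLocallyClosed]
    intro k hk hkc
    exact integrable_finsetSum _ fun j _ => (h j).2.1.integrableOn_compact_subset hk hkc
  · simp only [Finset.sum_mul]
    rw [integral_finsetSum, integral_finsetSum, ← Finset.sum_neg_distrib]
    · exact Finset.sum_congr rfl fun j _ => (h j).2.2 φ hφ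
    · exact fun j _ => (LocallyIntegrableOn.integrable_mul_test (h j).2.1 hφ).integrableOn
    · exact fun j _ =>
        (LocallyIntegrableOn.integrable_mul_test (h j).1 (hφ.partialDeriv j)).integrableOn

theorem HasWeakPartial.of_contDiff {f : (Fin n → ℝ) → ℝ} (hf : ContDiff ℝ ∞ f) (i : Fin n) :
    HasWeakPartial Ω i f (partialDeriv i f) := by
  have l1 : LocallyIntegrableOn f Ω := hf.continuous.locallyIntegrable.locallyIntegrableOn _
  have l2 : LocallyIntegrableOn (partialDeriv i f) Ω :=
    (contDiff_partialDeriv hf i).continuous.locallyIntegrable.locallyIntegrableOn _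
  refine ⟨l1, l2, fun φ hφ => ?_⟩
  rw [hφ.setIntegral_mul_eq, (hφ.partialDeriv i).setIntegral_mul_eq]
  exact integral_mul_fderiv_eq_neg_fderiv_mul_of_integrable
    (LocallyIntegrableOn.integrable_mul_test l2 hφ)
    (LocallyIntegrableOn.integrable_mul_test l1 (hφ.partialDeriv i))
    (LocallyIntegrableOn.integrable_mul_test l1 hφ)
    (fun x _ => (hf.differentiable (by simp)).differentiableAt)
    (fun x _ => (hφ.1.differentiable (by simp)).differentiableAt)

/-- `u` has the weak first derivatives `g i` and the weak second derivatives `H i j`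
(first in direction `i`, then in direction `j`), all square-integrable. -/
structure HTwo (Ω : Set (Fin n → ℝ)) (u : (Fin n → ℝ) → ℝ) (g : Fin n → (Fin n → ℝ) → ℝ)
    (H : Fin n → Fin n → (Fin n → ℝ) → ℝ) : Prop where
  memLp : MemLp u 2 (volume.restrict Ω)
  memLp_fst : ∀ i, MemLp (g i) 2 (volume.restrict Ω)
  memLp_snd : ∀ i j, MemLp (H i j) 2 (volume.restrict Ω)
  weak_fst : ∀ i, HasWeakPartial Ω i u (g i)
  weak_snd : ∀ i j, HasWeakPartial Ω j (g i) (H i j)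

/-- The squared `H²` norm, written with given derivatives. -/
noncomputable def hTwoNormSq (Ω : Set (Fin n → ℝ)) (u : (Fin n → ℝ) → ℝ)
    (g : Fin n → (Fin n → ℝ) → ℝ) (H : Fin n → Fin n → (Fin n → ℝ) → ℝ) : ℝ :=
  (∫ x in Ω, u x ^ 2) + ∑ i, ((∫ x in Ω, g i x ^ 2) + ∑ j, ∫ x in Ω, H i j x ^ 2)

theorem memSobolev_two_iff {u : (Fin n → ℝ) → ℝ} :
    MemSobolev Ω 2 u ↔ ∃ g H, HTwo Ω u g H := by
  constructor
  · rintro ⟨h0, h1⟩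
    choose g hg hg' using h1
    choose H hH hH' using fun i => (hg' i).2
    exact ⟨g, H, h0, fun i => (hg' i).1, hH', hg, hH⟩
  · rintro ⟨g, H, h⟩
    exact ⟨h.memLp, fun i => ⟨g i, h.weak_fst i, h.memLp_fst i, fun j =>
      ⟨H i j, h.weak_snd i j, h.memLp_snd i j⟩⟩⟩

theorem HTwo.sobolevNormSq_eq {u : (Fin n → ℝ) → ℝ} {g : Fin n → (Fin n → ℝ) → ℝ}
    {H : Fin n → Fin n → (Fin n → ℝ) → ℝ} (hΩ : IsOpen Ω) (h : HTwo Ω u g H) :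
    sobolevNormSq Ω 2 u = hTwoNormSq Ω u g H := by
  simp only [sobolevNormSq, hTwoNormSq]
  congr 1
  refine Finset.sum_congr rfl fun i _ => ?_
  have e1 := (h.weak_fst i).weakPartial_ae_eq hΩ
  congr 1
  · exact integral_congr_ae (e1.mono fun x hx => by simp only [hx])
  · refine Finset.sum_congr rfl fun j _ => ?_
    -- In `sobolevNormSq` the second derivative is taken of the chosen `weakPartial`, which is `g i`
    -- only almost everywhere.
    have e2 := ((h.weak_snd i j).congr hΩ e1.symm (EventuallyEq.refl _ _)).weakPartial_ae_eq hΩ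
    exact integral_congr_ae (e2.mono fun x hx => by simp only [hx])

theorem HTwo.mono {Ω' : Set (Fin n → ℝ)} {u : (Fin n → ℝ) → ℝ} {g : Fin n → (Fin n → ℝ) → ℝ}
    {H : Fin n → Fin n → (Fin n → ℝ) → ℝ} (hs : Ω' ⊆ Ω) (h : HTwo Ω u g H) :
    HTwo Ω' u g H where
  memLp := h.memLp.mono_measure (Measure.restrict_mono hs le_rfl)
  memLp_fst i := (h.memLp_fst i).mono_measure (Measure.restrict_mono hs le_rfl)
  memLp_snd i j := (h.memLp_snd i j).mono_measure (Measure.restrict_mono hs le_rfl)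
  weak_fst i := (h.weak_fst i).mono hs
  weak_snd i j := (h.weak_snd i j).mono hs

theorem Continuous.memLp_two_of_subset_compact {f : (Fin n → ℝ) → ℝ} (hf : Continuous f)
    {k : Set (Fin n → ℝ)} (hk : IsCompact k) (hs : Ω ⊆ k) : MemLp f 2 (volume.restrict Ω) := by
  refine MemLp.mono_measure (Measure.restrict_mono hs le_rfl) ?_
  rw [memLp_two_iff_integrable_sq hf.aestronglyMeasurable]
  exact (hf.pow 2).continuousOn.integrableOn_compact hk

theorem HTwo.sub_contDiff {u : (Fin n → ℝ) → ℝ} {g : Fin n → (Fin n → ℝ) → ℝ}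
    {H : Fin n → Fin n → (Fin n → ℝ) → ℝ} (h : HTwo Ω u g H) {k : Set (Fin n → ℝ)}
    (hk : IsCompact k) (hs : Ω ⊆ k) {φ : (Fin n → ℝ) → ℝ} (hφ : ContDiff ℝ ∞ φ) :
    HTwo Ω (fun x => u x - φ x) (fun i x => g i x - partialDeriv i φ x)
      (fun i j x => H i j x - partialDeriv j (partialDeriv i φ) x) where
  memLp := h.memLp.sub (hφ.continuous.memLp_two_of_subset_compact hk hs)
  memLp_fst i := (h.memLp_fst i).sub
    ((contDiff_partialDeriv hφ i).continuous.memLp_two_of_subset_compact hk hs)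
  memLp_snd i j := (h.memLp_snd i j).sub
    ((contDiff_partialDeriv (contDiff_partialDeriv hφ i) j).continuous.memLp_two_of_subset_compact
      hk hs)
  weak_fst i := (h.weak_fst i).sub (HasWeakPartial.of_contDiff hφ i)
  weak_snd i j := (h.weak_snd i j).sub (HasWeakPartial.of_contDiff (contDiff_partialDeriv hφ i) j)

end WeakDerivatives

/-! ### The `L²` norm as a real number -/

section LTwo

variable {X Y : Type*} [MeasurableSpace X] [MeasurableSpace Y] {μ : Measure X} {f g : X → ℝ}

/-- The `L²` norm of a real function, as a real number. -/
noncomputable def ltwo (μ : Measure X) (f : X → ℝ) : ℝ := (eLpNorm f 2 μ).toReal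

theorem ltwo_nonneg (μ : Measure X) (f : X → ℝ) : 0 ≤ ltwo μ f := ENNReal.toReal_nonneg

theorem eLpNorm_two_sq (f : X → ℝ) (μ : Measure X) :
    eLpNorm f 2 μ ^ 2 = ∫⁻ x, ‖f x‖ₑ ^ 2 ∂μ := by
  have := eLpNorm_nnreal_pow_eq_lintegral (f := f) (μ := μ) (p := 2) (by norm_num)
  have e : ((2 : NNReal) : ℝ) = ((2 : ℕ) : ℝ) := by norm_num
  simp only [e, ENNReal.rpow_natCast] at this
  exact this

theorem ltwo_sq (hf : MemLp f 2 μ) : ltwo μ f ^ 2 = ∫ x, f x ^ 2 ∂μ := by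
  rw [ltwo, ← ENNReal.toReal_pow, eLpNorm_two_sq, integral_eq_lintegral_of_nonneg_ae]
  · congr 1
    refine lintegral_congr fun x => ?_
    rw [← sq_abs, ENNReal.ofReal_pow (abs_nonneg _), ← Real.norm_eq_abs, ofReal_norm]
  · exact Eventually.of_forall fun x => sq_nonneg _
  · exact hf.1.pow 2

theorem ltwo_le_of_ae_abs_le (hg : MemLp g 2 μ) (h : ∀ᵐ x ∂μ, |f x| ≤ |g x|) :
    ltwo μ f ≤ ltwo μ g :=
  ENNReal.toReal_mono hg.2.ne (eLpNorm_mono_ae (h.mono fun x hx => by simpa using hx))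

theorem ltwo_congr_ae (h : f =ᵐ[μ] g) : ltwo μ f = ltwo μ g := by
  rw [ltwo, ltwo, eLpNorm_congr_ae h]

theorem ltwo_add_le (hf : MemLp f 2 μ) (hg : MemLp g 2 μ) :
    ltwo μ (fun x => f x + g x) ≤ ltwo μ f + ltwo μ g := by
  rw [ltwo, ltwo, ltwo, ← ENNReal.toReal_add hf.2.ne hg.2.ne]
  exact ENNReal.toReal_mono (ENNReal.add_ne_top.2 ⟨hf.2.ne, hg.2.ne⟩)
    (eLpNorm_add_le hf.1 hg.1 (by norm_num))

theorem ltwo_sub_le (hf : MemLp f 2 μ) (hg : MemLp g 2 μ) :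
    ltwo μ (fun x => f x - g x) ≤ ltwo μ f + ltwo μ g := by
  rw [ltwo, ltwo, ltwo, ← ENNReal.toReal_add hf.2.ne hg.2.ne]
  exact ENNReal.toReal_mono (ENNReal.add_ne_top.2 ⟨hf.2.ne, hg.2.ne⟩)
    (eLpNorm_sub_le hf.1 hg.1 (by norm_num))

theorem ltwo_const_mul (c : ℝ) (f : X → ℝ) : ltwo μ (fun x => c * f x) = |c| * ltwo μ f := by
  have := eLpNorm_const_smul c f 2 μ
  rw [ltwo, ltwo]
  change eLpNorm (fun x => c * f x) 2 μ = _ at this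
  rw [this, ENNReal.toReal_mul, toReal_enorm, Real.norm_eq_abs]

theorem ltwo_sub_comm (f g : X → ℝ) : ltwo μ (fun x => f x - g x) = ltwo μ (fun x => g x - f x) := by
  rw [ltwo, ltwo]
  exact congrArg _ (eLpNorm_sub_comm f g 2 μ)

theorem tendsto_ltwo_iff {F : ℕ → X → ℝ} (hF : ∀ m, MemLp (F m) 2 μ) :
    Tendsto (fun m => ltwo μ (F m)) atTop (𝓝 0) ↔
      Tendsto (fun m => ∫ x, F m x ^ 2 ∂μ) atTop (𝓝 0) := by
  simp only [← fun m => ltwo_sq (hF m)]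
  constructor
  · intro h
    simpa using h.pow 2
  · intro h
    have := h.sqrt
    simpa [Real.sqrt_sq (ltwo_nonneg _ _)] using this

/-- Jensen's inequality for the square. -/
theorem enorm_integral_sq_le {P : Measure Y} [IsProbabilityMeasure P] {f : Y → ℝ}
    (hf : AEStronglyMeasurable f P) : ‖∫ y, f y ∂P‖ₑ ^ 2 ≤ ∫⁻ y, ‖f y‖ₑ ^ 2 ∂P := by
  rw [← eLpNorm_two_sq]
  gcongr
  refine (enorm_integral_le_lintegral_enorm f).trans ?_
  rw [← eLpNorm_one_eq_lintegral_enorm]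
  exact eLpNorm_le_eLpNorm_of_exponent_le (by norm_num) hf

/-- Averaging over a parameter is a contraction of `L²`, up to the Jacobian `c` of the
parametrisation. -/
theorem eLpNorm_integral_comp_le {Z : Type*} [MeasurableSpace Z] {P : Measure Y}
    [IsProbabilityMeasure P] [SFinite μ] {ν : Measure Z} {π : X × Y → Z} (hπ : Measurable π)
    {c : ENNReal} (hc : (μ.prod P).map π ≤ c • ν) {f : Z → ℝ} (hf : Measurable f) :
    eLpNorm (fun x => ∫ y, f (π (x, y)) ∂P) 2 μ ^ 2 ≤ c * eLpNorm f 2 ν ^ 2 := by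
  rw [eLpNorm_two_sq, eLpNorm_two_sq]
  calc ∫⁻ x, ‖∫ y, f (π (x, y)) ∂P‖ₑ ^ 2 ∂μ
      ≤ ∫⁻ x, ∫⁻ y, ‖f (π (x, y))‖ₑ ^ 2 ∂P ∂μ := lintegral_mono fun x => enorm_integral_sq_le
        (hf.comp (hπ.comp (measurable_const.prodMk measurable_id))).aestronglyMeasurable
    _ = ∫⁻ z, ‖f z‖ₑ ^ 2 ∂((μ.prod P).map π) := by
        rw [lintegral_map (hf.enorm.pow_const 2) hπ]
        exact (lintegral_prod _ ((hf.enorm.pow_const 2).comp hπ).aemeasurable).symm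
    _ ≤ ∫⁻ z, ‖f z‖ₑ ^ 2 ∂(c • ν) := lintegral_mono' hc le_rfl
    _ = c * ∫⁻ z, ‖f z‖ₑ ^ 2 ∂ν := by rw [lintegral_smul_measure, smul_eq_mul]

end LTwo

/-! ### Mollification after a dilation -/

section Mollify

variable {n : ℕ}

/-- The mollification of `f` by `ρ`, evaluated at the image of `x` under the dilation
`x ↦ a + s x`. -/
noncomputable def dilatedMollify (ρ : (Fin n → ℝ) → ℝ) (a : Fin n → ℝ) (s : ℝ)
    (f : (Fin n → ℝ) → ℝ) (x : Fin n → ℝ) : ℝ :=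
  convolution f ρ (ContinuousLinearMap.lsmul ℝ ℝ) volume (a + s • x)

variable {ρ : (Fin n → ℝ) → ℝ} {a : Fin n → ℝ} {s : ℝ} {f g : (Fin n → ℝ) → ℝ}

/-- Mollification is an average of translates against a probability measure once `ρ` has integral
one; in this form Jensen's inequality bounds it in `L²`. -/
theorem convolution_eq_integral_withDensity (hρ : Continuous ρ) (hρ0 : ∀ x, 0 ≤ ρ x)
    (f : (Fin n → ℝ) → ℝ) (z : Fin n → ℝ) :
    convolution f ρ (ContinuousLinearMap.lsmul ℝ ℝ) volume z =
      ∫ y, f (z - y) ∂(volume.withDensity fun y => ENNReal.ofReal (ρ y)) := by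
  rw [convolution_lsmul_swap, integral_withDensity_eq_integral_toReal_smul
    (by fun_prop) (by simp)]
  refine integral_congr_ae (Eventually.of_forall fun y => ?_)
  simp only [ENNReal.toReal_ofReal (hρ0 y), smul_eq_mul, mul_comm]

theorem contDiff_dilatedMollify (hρ : ContDiff ℝ ∞ ρ) (hc : HasCompactSupport ρ)
    (hf : LocallyIntegrable f) : ContDiff ℝ ∞ (dilatedMollify ρ a s f) :=
  (hc.contDiff_convolution_right (n := ⊤) _ hf hρ).comp
    (contDiff_const.add (contDiff_id.const_smul s))

theorem partialDeriv_comp_dilation {F : (Fin n → ℝ) → ℝ} {x : Fin n → ℝ}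
    (hF : DifferentiableAt ℝ F (a + s • x)) (i : Fin n) :
    partialDeriv i (fun x => F (a + s • x)) x = s * partialDeriv i F (a + s • x) := by
  have h1 : HasFDerivAt (fun x : Fin n → ℝ => a + s • x)
      (s • ContinuousLinearMap.id ℝ (Fin n → ℝ)) x :=
    ((hasFDerivAt_id x).const_smul s).const_add a
  have h2 := (hF.hasFDerivAt.comp x h1).fderiv
  rw [Function.comp_def] at h2
  rw [partialDeriv, h2]
  simp [partialDeriv]

/-- The derivative falls on `ρ`. By `hz`, the reflected kernel `t ↦ ρ (z - t)` is a test function on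
`Ω`, so the weak derivative moves it onto `u`; the sign of the integration by parts cancels that of
the reflection. Outside `Ω` the extension by zero is never seen. -/
theorem partialDeriv_convolution {Ω : Set (Fin n → ℝ)} {u g : (Fin n → ℝ) → ℝ} {i : Fin n}
    (hΩ : IsOpen Ω)
    (hg : HasWeakPartial Ω i u g) (hu : LocallyIntegrable (Ω.indicator u)) (hρ : ContDiff ℝ ∞ ρ)
    (hc : HasCompactSupport ρ) {z : Fin n → ℝ} (hz : ∀ y ∈ tsupport ρ, z - y ∈ Ω) :
    partialDeriv i (convolution (Ω.indicator u) ρ (ContinuousLinearMap.lsmul ℝ ℝ) volume) z =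
      convolution (Ω.indicator g) ρ (ContinuousLinearMap.lsmul ℝ ℝ) volume z := by
  have h1 := hc.hasFDerivAt_convolution_right (ContinuousLinearMap.lsmul ℝ ℝ) hu
    (hρ.of_le (by norm_cast)) z
  rw [partialDeriv, h1.fderiv, convolution_precompR_apply _ hu (hc.fderiv ℝ)
    (hρ.continuous_fderiv (by simp))]
  simp only [convolution_lsmul]
  set ψ : (Fin n → ℝ) → ℝ := fun t => ρ (z - t) with hψ
  have hψs : tsupport ψ ⊆ Ω := by
    have : tsupport ψ ⊆ (fun t => z - t) ⁻¹' tsupport ρ := by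
      refine closure_minimal (fun t ht => subset_tsupport ρ ht) ?_
      exact (isClosed_tsupport ρ).preimage (by fun_prop)
    intro t ht
    simpa using hz _ (this ht)
  have hψt : IsTest Ω ψ := by
    refine ⟨hρ.comp (contDiff_const.sub contDiff_id), ?_, hψs⟩
    exact hc.comp_homeomorph (Homeomorph.subLeft z)
  have hd : ∀ t, partialDeriv i ψ t = -partialDeriv i ρ (z - t) := by
    intro t
    have h2 : HasFDerivAt (fun t : Fin n → ℝ => z - t)
      (-ContinuousLinearMap.id ℝ (Fin n → ℝ)) t := (hasFDerivAt_id t).const_sub z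
    have h3 := (((hρ.differentiable (by simp)) (z - t)).hasFDerivAt.comp t h2).fderiv
    rw [Function.comp_def] at h3
    rw [partialDeriv, h3]
    simp [partialDeriv]
  have := hg.2.2 ψ hψt
  simp only [hd, mul_neg, integral_neg, neg_inj] at this
  have e : ∀ v w : (Fin n → ℝ) → ℝ, ∫ t, Ω.indicator v t • w (z - t) =
      ∫ t in Ω, v t * w (z - t) := by
    intro v w
    rw [← integral_indicator hΩ.measurableSet]
    refine integral_congr_ae (Eventually.of_forall fun t => ?_)
    by_cases ht : t ∈ Ω <;> simp [ht]
  rw [e _ (fun y => fderiv ℝ ρ y (Pi.single i 1)), e]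
  exact this

theorem partialDeriv_dilatedMollify {Ω : Set (Fin n → ℝ)} {u g : (Fin n → ℝ) → ℝ} {i : Fin n}
    (hΩ : IsOpen Ω)
    (hg : HasWeakPartial Ω i u g) (hu : LocallyIntegrable (Ω.indicator u)) (hρ : ContDiff ℝ ∞ ρ)
    (hc : HasCompactSupport ρ) {x : Fin n → ℝ} (hx : ∀ y ∈ tsupport ρ, a + s • x - y ∈ Ω) :
    partialDeriv i (dilatedMollify ρ a s (Ω.indicator u)) x =
      s * dilatedMollify ρ a s (Ω.indicator g) x := by
  unfold dilatedMollify
  rw [partialDeriv_comp_dilation, partialDeriv_convolution hΩ hg hu hρ hc hx]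
  exact ((hc.contDiff_convolution_right (n := ⊤) _ hu hρ).differentiable (by simp)).differentiableAt

/-- For each fixed shift `y` the map `x ↦ a + s x - y` pulls Lebesgue measure back with the factor
`s⁻ⁿ`, which is at most `2ⁿ`. -/
theorem map_dilation_prod_le {P : Measure (Fin n → ℝ)} [IsProbabilityMeasure P]
    (hs : 1 / 2 ≤ s) :
    ((volume : Measure (Fin n → ℝ)).prod P).map (fun p => a + s • p.1 - p.2) ≤
      (ENNReal.ofReal (2 ^ n)) • (volume : Measure (Fin n → ℝ)) := by
  have hm : Measurable fun p : (Fin n → ℝ) × (Fin n → ℝ) => a + s • p.1 - p.2 := by fun_prop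
  refine Measure.le_iff.2 fun t ht => ?_
  rw [Measure.map_apply hm ht, Measure.prod_apply_symm (hm ht), Measure.smul_apply, smul_eq_mul]
  have h1 : ∀ y, volume ((fun x => (x, y)) ⁻¹'
      ((fun p : (Fin n → ℝ) × (Fin n → ℝ) => a + s • p.1 - p.2) ⁻¹' t)) ≤
      ENNReal.ofReal (2 ^ n) * volume t := by
    intro y
    have : (fun x => (x, y)) ⁻¹'
      ((fun p : (Fin n → ℝ) × (Fin n → ℝ) => a + s • p.1 - p.2) ⁻¹' t) =
      (fun x : Fin n → ℝ => s • x) ⁻¹' ((fun x => (a - y) + x) ⁻¹' t) := by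
      ext x
      simp only [Set.mem_preimage]
      rw [show a + s • x - y = a - y + s • x by abel]
    rw [this, Measure.addHaar_preimage_smul _ (by linarith), measure_preimage_add]
    gcongr
    rw [Module.finrank_fin_fun, abs_of_pos (by positivity), ← inv_pow]
    exact pow_le_pow_left₀ (by positivity) (by rw [inv_le_comm₀ (by positivity) (by norm_num)]; linarith) _
  calc _ ≤ ∫⁻ _, ENNReal.ofReal (2 ^ n) * volume t ∂P := lintegral_mono h1
    _ = _ := by simp

theorem dilatedMollify_congr (h : f =ᵐ[volume] g) : dilatedMollify ρ a s f = dilatedMollify ρ a s g := by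
  ext x
  simp only [dilatedMollify, convolution_lsmul]
  exact integral_congr_ae (h.mono fun t ht => by simp only [ht])

theorem eLpNorm_dilatedMollify_le (hρ : Continuous ρ) (hρ0 : ∀ x, 0 ≤ ρ x) (hρ1 : ∫ x, ρ x = 1)
    (hs : 1 / 2 ≤ s) (hf : AEStronglyMeasurable f) :
    eLpNorm (dilatedMollify ρ a s f) 2 volume ≤
      ENNReal.ofReal (2 ^ n) * eLpNorm f 2 volume := by
  have hP : IsProbabilityMeasure (volume.withDensity fun y => ENNReal.ofReal (ρ y)) := by
    constructor
    rw [withDensity_apply _ MeasurableSet.univ, setLIntegral_univ,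
      ← ofReal_integral_eq_lintegral_ofReal, hρ1, ENNReal.ofReal_one]
    -- Integrability of `ρ` is implicit in `hρ1`: the integral of a non-integrable function is `0`
    -- by convention.
    · by_contra h
      rw [integral_undef h] at hρ1
      norm_num at hρ1
    · exact Eventually.of_forall hρ0
  rw [dilatedMollify_congr hf.ae_eq_mk, eLpNorm_congr_ae hf.ae_eq_mk]
  rw [← ENNReal.pow_le_pow_left_iff two_ne_zero, mul_pow]
  -- Jensen bounds the squared norm with the factor `2ⁿ`; weakening it to `(2ⁿ)²` makes the factor a
  -- square that can be removed.
  have h1 : ENNReal.ofReal (2 ^ n) ≤ ENNReal.ofReal (2 ^ n) ^ 2 := by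
    rw [← ENNReal.ofReal_pow (by positivity)]
    exact ENNReal.ofReal_le_ofReal (le_self_pow₀ (one_le_pow₀ (by norm_num)) two_ne_zero)
  refine le_trans ?_ (mul_le_mul_left h1 _)
  refine le_trans (le_of_eq ?_) (eLpNorm_integral_comp_le
    (P := volume.withDensity fun y => ENNReal.ofReal (ρ y)) (μ := volume)
    (π := fun p => a + s • p.1 - p.2) (by fun_prop) (map_dilation_prod_le hs)
    hf.stronglyMeasurable_mk.measurable)
  congr 2
  ext x
  exact convolution_eq_integral_withDensity hρ hρ0 _ _

theorem dist_dilatedMollify_le {r ε : ℝ} {z : ℝ} (hε : 0 ≤ ε)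
    (hρs : Function.support ρ ⊆ Metric.ball 0 r) (hρ0 : ∀ x, 0 ≤ ρ x) (hρ1 : ∫ x, ρ x = 1)
    (hg : Continuous g) {x : Fin n → ℝ}
    (h : ∀ y ∈ Metric.ball (a + s • x) r, dist (g y) z ≤ ε) :
    dist (dilatedMollify ρ a s g x) z ≤ ε := by
  have := dist_convolution_le (μ := volume) hε hρs hρ0 hρ1 hg.aestronglyMeasurable h
  rw [dilatedMollify, convolution_lsmul_swap]
  rw [convolution_lsmul] at this
  simpa only [smul_eq_mul, mul_comm] using this

theorem dilatedMollify_sub (hρ : Continuous ρ) (hc : HasCompactSupport ρ)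
    (hf : LocallyIntegrable f) (hg : LocallyIntegrable g) (x : Fin n → ℝ) :
    dilatedMollify ρ a s (fun x => f x - g x) x =
      dilatedMollify ρ a s f x - dilatedMollify ρ a s g x := by
  have h1 := hc.convolutionExists_right (ContinuousLinearMap.lsmul ℝ ℝ) hf hρ (a + s • x)
  have h2 := hc.convolutionExists_right (ContinuousLinearMap.lsmul ℝ ℝ) hg hρ (a + s • x)
  simp only [dilatedMollify, convolution_def]
  rw [← integral_sub h1 h2]
  simp

theorem MeasureTheory.MemLp.dilatedMollify (hρ : ContDiff ℝ ∞ ρ) (hc : HasCompactSupport ρ)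
    (hρ0 : ∀ x, 0 ≤ ρ x) (hρ1 : ∫ x, ρ x = 1) (hs : 1 / 2 ≤ s) (hf : MemLp f 2 volume) :
    MemLp (dilatedMollify ρ a s f) 2 volume := by
  refine ⟨(contDiff_dilatedMollify hρ hc
    (hf.locallyIntegrable (by norm_num))).continuous.aestronglyMeasurable, ?_⟩
  exact (eLpNorm_dilatedMollify_le hρ.continuous hρ0 hρ1 hs hf.1).trans_lt
    (ENNReal.mul_lt_top ENNReal.ofReal_lt_top hf.2)

/-- The operators are bounded on `L²` uniformly in `m`, so it is enough to treat a continuous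
compactly supported function `g`. Such a `g` is uniformly continuous, and the operator samples it
only at points within `r m + |1 - s m| (‖c‖ + |R|)` of `x`. -/
theorem tendsto_dilatedMollify {ρ : ℕ → (Fin n → ℝ) → ℝ} {c : Fin n → ℝ} {s r : ℕ → ℝ}
    (hρ : ∀ m, ContDiff ℝ ∞ (ρ m)) (hρc : ∀ m, HasCompactSupport (ρ m)) (hρ0 : ∀ m x, 0 ≤ ρ m x)
    (hρ1 : ∀ m, ∫ x, ρ m x = 1)
    (hρs : ∀ m, Function.support (ρ m) ⊆ Metric.ball 0 (r m)) (hs : ∀ m, 1 / 2 ≤ s m)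
    (hr : Tendsto r atTop (𝓝 0)) (hs1 : Tendsto s atTop (𝓝 1)) {Ω : Set (Fin n → ℝ)}
    (hΩ : Bornology.IsBounded Ω) (hΩm : MeasurableSet Ω) {f : (Fin n → ℝ) → ℝ}
    (hf : MemLp f 2 volume) :
    Tendsto (fun m => ltwo (volume.restrict Ω)
      (fun x => f x - dilatedMollify (ρ m) ((1 - s m) • c) (s m) f x)) atTop (𝓝 0) := by
  rw [Metric.tendsto_atTop']
  intro ε hε
  have h2n : (1 : ℝ) ≤ 2 ^ n := one_le_pow₀ (by norm_num)
  -- The three errors below (from `f - g`, from the image of `f - g`, and from `g` itself) are at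
  -- most `ε / 4` each. The second one carries the operator bound `2ⁿ`.
  set δ : ℝ := ε / (4 * 2 ^ n) with hδ
  have hδ0 : 0 < δ := by positivity
  obtain ⟨g, hgc, hfg, hg, hg2⟩ := hf.exists_hasCompactSupport_eLpNorm_sub_le
    (by norm_num) (ENNReal.ofReal_pos.2 hδ0).ne'
  have hle : volume.restrict Ω ≤ volume := Measure.restrict_le_self
  have hVt : volume Ω < ⊤ := hΩ.measure_lt_top
  set V : ℝ := ((volume.restrict Ω) Set.univ ^ (2 : ENNReal).toReal⁻¹).toReal with hV
  have hVne : (volume.restrict Ω) Set.univ ^ (2 : ENNReal).toReal⁻¹ ≠ ⊤ := by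
    refine (ENNReal.rpow_lt_top_of_nonneg (by positivity) ?_).ne
    simpa using hVt.ne
  have hV0 : 0 ≤ V := ENNReal.toReal_nonneg
  -- `V` is the square root of the volume of `Ω`, the cost of passing from a uniform bound to `L²`;
  -- `V + 1` avoids dividing by zero.
  set η : ℝ := ε / (4 * (V + 1)) with hη
  have hη0 : 0 < η := by positivity
  obtain ⟨d, hd0, hd⟩ := Metric.uniformContinuous_iff.1
    (hgc.uniformContinuous_of_continuous hg) η hη0
  obtain ⟨R, hR⟩ := hΩ.exists_norm_le
  have hev : ∀ᶠ m in atTop, r m + |1 - s m| * (‖c‖ + |R|) < d := by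
    have : Tendsto (fun m => r m + |1 - s m| * (‖c‖ + |R|)) atTop
        (𝓝 (0 + |1 - 1| * (‖c‖ + |R|))) :=
      hr.add ((tendsto_const_nhds.sub hs1).abs.mul_const _)
    simp only [sub_self, abs_zero, zero_mul, add_zero] at this
    exact this.eventually_lt_const hd0
  obtain ⟨N, hN⟩ := eventually_atTop.1 hev
  refine ⟨N, fun m hm => ?_⟩
  have hm := hN m hm.le
  set T := _root_.dilatedMollify (ρ m) ((1 - s m) • c) (s m) with hT
  have hTf : MemLp (T f) 2 volume := hf.dilatedMollify (hρ m) (hρc m) (hρ0 m) (hρ1 m) (hs m)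
  have hTg : MemLp (T g) 2 volume := hg2.dilatedMollify (hρ m) (hρc m) (hρ0 m) (hρ1 m) (hs m)
  have b1 : ltwo (volume.restrict Ω) (fun x => f x - g x) ≤ δ := by
    rw [ltwo, ← ENNReal.toReal_ofReal hδ0.le]
    exact ENNReal.toReal_mono ENNReal.ofReal_ne_top ((eLpNorm_mono_measure _ hle).trans hfg)
  have b2 : ltwo (volume.restrict Ω) (fun x => T g x - T f x) ≤ 2 ^ n * δ := by
    rw [ltwo_sub_comm, ltwo, ← ENNReal.toReal_ofReal (show 0 ≤ 2 ^ n * δ by positivity)]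
    refine ENNReal.toReal_mono ENNReal.ofReal_ne_top ((eLpNorm_mono_measure _ hle).trans ?_)
    have : (fun x => T f x - T g x) = T (fun x => f x - g x) := by
      ext x
      exact (dilatedMollify_sub (hρ m).continuous (hρc m) (hf.locallyIntegrable (by norm_num))
        (hg2.locallyIntegrable (by norm_num)) x).symm
    rw [this]
    refine (eLpNorm_dilatedMollify_le (hρ m).continuous (hρ0 m) (hρ1 m) (hs m)
      (hf.1.sub hg2.1)).trans ?_
    rw [ENNReal.ofReal_mul (by positivity)]
    exact mul_le_mul_right hfg _
  have b3 : ltwo (volume.restrict Ω) (fun x => g x - T g x) ≤ V * η := by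
    rw [ltwo, hV, ← ENNReal.toReal_ofReal hη0.le, ← ENNReal.toReal_mul]
    refine ENNReal.toReal_mono (ENNReal.mul_ne_top hVne ENNReal.ofReal_ne_top) ?_
    refine eLpNorm_le_of_ae_bound ?_
    refine (ae_restrict_iff' hΩm).2 (Eventually.of_forall fun x hx => ?_)
    rw [← dist_eq_norm, dist_comm]
    refine dist_dilatedMollify_le hη0.le (hρs m) (hρ0 m) (hρ1 m) hg fun y hy => (hd ?_).le
    refine lt_of_le_of_lt (dist_triangle _ ((1 - s m) • c + s m • x) _) (lt_of_le_of_lt ?_ hm)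
    refine add_le_add (le_of_lt hy) ?_
    rw [dist_eq_norm, show (1 - s m) • c + s m • x - x = (1 - s m) • (c - x) by module, norm_smul,
      Real.norm_eq_abs]
    gcongr
    exact (norm_sub_le _ _).trans (by gcongr; exact (hR x hx).trans (le_abs_self R))
  have hfr := hf.mono_measure hle
  have hgr := hg2.mono_measure hle
  have hTfr := hTf.mono_measure hle
  have hTgr := hTg.mono_measure hle
  have b4 : ltwo (volume.restrict Ω) (fun x => f x - T f x) ≤ δ + V * η + 2 ^ n * δ := by
    have e : (fun x => f x - T f x) = fun x => ((f x - g x) + (g x - T g x)) + (T g x - T f x) := by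
      ext x; ring
    rw [e]
    refine (ltwo_add_le ((hfr.sub hgr).add (hgr.sub hTgr)) (hTgr.sub hTfr)).trans ?_
    refine add_le_add ((ltwo_add_le (hfr.sub hgr) (hgr.sub hTgr)).trans (add_le_add b1 b3)) b2
  rw [Real.dist_eq, sub_zero, abs_of_nonneg (ltwo_nonneg _ _)]
  refine lt_of_le_of_lt b4 ?_
  have c1 : 2 ^ n * δ = ε / 4 := by rw [hδ]; field_simp
  have c2 : δ ≤ 2 ^ n * δ := le_mul_of_one_le_left hδ0.le h2n
  have c3 : V * η ≤ ε / 4 := by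
    have : (V + 1) * η = ε / 4 := by rw [hη]; field_simp
    nlinarith
  linarith

end Mollify

/-! ### Density of smooth functions in `H²` of a box -/

section Density

variable {n : ℕ}

theorem isOpen_boxIoo (K : BoxIntegral.Box (Fin n)) : IsOpen (BoxIntegral.Box.Ioo K) :=
  isOpen_set_pi Set.finite_univ fun _ _ => isOpen_Ioo

theorem mem_boxIoo {K : BoxIntegral.Box (Fin n)} {x : Fin n → ℝ} :
    x ∈ BoxIntegral.Box.Ioo K ↔ ∀ k, K.lower k < x k ∧ x k < K.upper k := by
  change x ∈ Set.univ.pi _ ↔ _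
  simp

theorem mem_boxIcc {K : BoxIntegral.Box (Fin n)} {x : Fin n → ℝ} :
    x ∈ BoxIntegral.Box.Icc K ↔ ∀ k, K.lower k ≤ x k ∧ x k ≤ K.upper k := by
  rw [BoxIntegral.Box.Icc_eq_pi]
  simp only [Set.mem_pi, Set.mem_univ, true_implies, Set.mem_Icc]

/-- Convergence of smooth functions in `H²`. -/
def TendstoHTwo (Ω : Set (Fin n → ℝ)) (φ : ℕ → (Fin n → ℝ) → ℝ) (u : (Fin n → ℝ) → ℝ)
    (g : Fin n → (Fin n → ℝ) → ℝ) (H : Fin n → Fin n → (Fin n → ℝ) → ℝ) : Prop :=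
  Tendsto (fun m => ltwo (volume.restrict Ω) (fun x => u x - φ m x)) atTop (𝓝 0) ∧
  (∀ i, Tendsto (fun m => ltwo (volume.restrict Ω)
    (fun x => g i x - partialDeriv i (φ m) x)) atTop (𝓝 0)) ∧
  ∀ i j, Tendsto (fun m => ltwo (volume.restrict Ω)
    (fun x => H i j x - partialDeriv j (partialDeriv i (φ m)) x)) atTop (𝓝 0)

/-- Disposes of the chain rule factors `s` and `s²` that the dilation puts in front of first and
second derivatives. -/
theorem tendsto_ltwo_sub_mul {μ : Measure (Fin n → ℝ)} {f : (Fin n → ℝ) → ℝ}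
    {F : ℕ → (Fin n → ℝ) → ℝ} (hf : MemLp f 2 μ) (hF : ∀ m, MemLp (F m) 2 μ) {s : ℕ → ℝ}
    (hs : Tendsto s atTop (𝓝 1))
    (h : Tendsto (fun m => ltwo μ (fun x => f x - F m x)) atTop (𝓝 0)) :
    Tendsto (fun m => ltwo μ (fun x => f x - s m * F m x)) atTop (𝓝 0) := by
  have h1 : Tendsto (fun m => |s m| * ltwo μ (fun x => f x - F m x) + |1 - s m| * ltwo μ f)
      atTop (𝓝 (|1| * 0 + |1 - 1| * ltwo μ f)) :=
    (hs.abs.mul h).add ((tendsto_const_nhds.sub hs).abs.mul_const _)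
  simp only [mul_zero, sub_self, abs_zero, zero_mul, add_zero] at h1
  refine squeeze_zero (fun m => ltwo_nonneg _ _) (fun m => ?_) h1
  rw [← ltwo_const_mul, ← ltwo_const_mul]
  refine le_trans (le_of_eq ?_)
    (ltwo_add_le ((hf.sub (hF m)).const_mul (s m)) (hf.const_mul (1 - s m)))
  congr 1
  ext x
  ring

/-- Mollifying directly would use values of `u` beyond the boundary. Contracting `K` towards its
centre by the factor `s` first moves every point to distance at least `(1 - s) δ` from the boundary,
where `δ` is at most half of each edge. A kernel of radius `(1 - s) δ` then stays inside the box,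
and the weak derivatives of `u` on the box alone can be mollified. -/
theorem HTwo.exists_tendstoHTwo {K : BoxIntegral.Box (Fin n)} {u : (Fin n → ℝ) → ℝ}
    {g : Fin n → (Fin n → ℝ) → ℝ} {H : Fin n → Fin n → (Fin n → ℝ) → ℝ}
    (h : HTwo (BoxIntegral.Box.Ioo K) u g H) :
    ∃ φ : ℕ → (Fin n → ℝ) → ℝ, (∀ m, ContDiff ℝ ∞ (φ m)) ∧
      TendstoHTwo (BoxIntegral.Box.Ioo K) φ u g H := by
  set Ω := BoxIntegral.Box.Ioo K with hΩdef
  have hΩ : IsOpen Ω := isOpen_boxIoo K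
  have hΩb : Bornology.IsBounded Ω := K.isBounded_Icc.subset K.Ioo_subset_Icc
  obtain ⟨δ, hδ, hδ0⟩ : ∃ δ : ℝ, (∀ k, δ ≤ (K.upper k - K.lower k) / 2) ∧ 0 < δ := by
    have h1 : ∀ᶠ δ : ℝ in 𝓝[>] 0, ∀ k, δ ≤ (K.upper k - K.lower k) / 2 := by
      refine eventually_all.2 fun k => ?_
      have : (0 : ℝ) < (K.upper k - K.lower k) / 2 := by linarith [K.lower_lt_upper k]
      exact nhdsWithin_le_nhds (eventually_le_nhds this)
    exact (h1.and self_mem_nhdsWithin).exists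
  set c : Fin n → ℝ := fun k => (K.lower k + K.upper k) / 2 with hc
  -- The shift by `2` gives `s m ≥ 1 / 2`, as the uniform `L²` bound of the mollification requires.
  set r : ℕ → ℝ := fun m => δ * (1 / ((m : ℝ) + 2)) with hr
  set s : ℕ → ℝ := fun m => 1 - 1 / ((m : ℝ) + 2) with hs
  have hm0 : ∀ m : ℕ, (0 : ℝ) < 1 / ((m : ℝ) + 2) := fun m => by positivity
  have hm1 : ∀ m : ℕ, 1 / ((m : ℝ) + 2) ≤ 1 / 2 := fun m => by
    apply one_div_le_one_div_of_le <;> norm_num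
  have hr0 : ∀ m, 0 < r m := fun m => mul_pos hδ0 (hm0 m)
  have hmt : Tendsto (fun m : ℕ => 1 / ((m : ℝ) + 2)) atTop (𝓝 0) := by
    have := (tendsto_add_atTop_iff_nat 2).2 (tendsto_one_div_atTop_nhds_zero_nat (𝕜 := ℝ))
    simpa using this
  have hrt : Tendsto r atTop (𝓝 0) := by simpa only [mul_zero] using hmt.const_mul δ
  have hst : Tendsto s atTop (𝓝 1) := by simpa only [sub_zero] using hmt.const_sub 1
  have hs2 : ∀ m, 1 / 2 ≤ s m := fun m => by simp only [hs]; linarith [hm1 m]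
  let B : ℕ → ContDiffBump (0 : Fin n → ℝ) := fun m =>
    ⟨r m / 2, r m, by linarith [hr0 m], by linarith [hr0 m]⟩
  set ρ : ℕ → (Fin n → ℝ) → ℝ := fun m => (B m).normed volume with hρdef
  have hρ : ∀ m, ContDiff ℝ ∞ (ρ m) := fun m => (B m).contDiff_normed (n := ⊤)
  have hρc : ∀ m, HasCompactSupport (ρ m) := fun m => (B m).hasCompactSupport_normed
  have hρ0 : ∀ m x, 0 ≤ ρ m x := fun m => (B m).nonneg_normed
  have hρ1 : ∀ m, ∫ x, ρ m x = 1 := fun m => (B m).integral_normed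
  have hρs : ∀ m, Function.support (ρ m) ⊆ Metric.ball 0 (r m) := fun m =>
    (B m).support_normed_eq.subset
  have hmem : ∀ m, ∀ x ∈ Ω, ∀ y ∈ tsupport (ρ m), (1 - s m) • c + s m • x - y ∈ Ω := by
    intro m x hx y hy
    have hy : ‖y‖ ≤ r m := by
      rw [hρdef, (B m).tsupport_normed_eq] at hy
      simpa using hy
    rw [hΩdef, mem_boxIoo] at hx ⊢
    intro k
    have hyk := abs_le.1 ((norm_le_pi_norm y k).trans hy)
    obtain ⟨h1, h2⟩ := hx k
    have h3 := hδ k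
    have h4 : r m = δ * (1 - s m) := by simp [hr, hs]
    have h5 : 0 < 1 - s m := by simp only [hs]; linarith [hm0 m]
    have h6 := hs2 m
    simp only [Pi.sub_apply, Pi.add_apply, Pi.smul_apply, smul_eq_mul, hc]
    rw [h4] at hyk
    constructor <;> nlinarith [mul_le_mul_of_nonneg_right h3 h5.le]
  set T : ℕ → ((Fin n → ℝ) → ℝ) → (Fin n → ℝ) → ℝ :=
    fun m => dilatedMollify (ρ m) ((1 - s m) • c) (s m) with hT
  have hind : ∀ {f : (Fin n → ℝ) → ℝ}, MemLp f 2 (volume.restrict Ω) → MemLp (Ω.indicator f) 2 volume := fun hf =>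
    (memLp_indicator_iff_restrict hΩ.measurableSet).2 hf
  have hli : ∀ {f : (Fin n → ℝ) → ℝ}, MemLp f 2 (volume.restrict Ω) → LocallyIntegrable (Ω.indicator f) := fun hf =>
    (hind hf).locallyIntegrable (by norm_num)
  have hTm : ∀ {f : (Fin n → ℝ) → ℝ}, MemLp f 2 (volume.restrict Ω) → ∀ m,
      MemLp (T m (Ω.indicator f)) 2 (volume.restrict Ω) := fun hf m =>
    ((hind hf).dilatedMollify (hρ m) (hρc m) (hρ0 m) (hρ1 m) (hs2 m)).mono_measure
      Measure.restrict_le_self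
  have hTt : ∀ {f : (Fin n → ℝ) → ℝ}, MemLp f 2 (volume.restrict Ω) →
      Tendsto (fun m => ltwo (volume.restrict Ω) (fun x => f x - T m (Ω.indicator f) x))
        atTop (𝓝 0) := by
    intro f hf
    refine (tendsto_dilatedMollify (c := c) hρ hρc hρ0 hρ1 hρs hs2 hrt hst hΩb hΩ.measurableSet
      (hind hf)).congr fun m => ltwo_congr_ae ?_
    refine (ae_restrict_iff' hΩ.measurableSet).2 (Eventually.of_forall fun x hx => ?_)
    simp only [Set.indicator_of_mem hx]
    rfl
  have hd1 : ∀ m i, ∀ x ∈ Ω, partialDeriv i (T m (Ω.indicator u)) x =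
      s m * T m (Ω.indicator (g i)) x := fun m i x hx =>
    partialDeriv_dilatedMollify hΩ (h.weak_fst i) (hli h.memLp) (hρ m) (hρc m) (hmem m x hx)
  have hd2 : ∀ m i j, ∀ x ∈ Ω, partialDeriv j (partialDeriv i (T m (Ω.indicator u))) x =
      s m * s m * T m (Ω.indicator (H i j)) x := by
    intro m i j x hx
    -- The formula for the first derivative holds on an open set, hence near `x`, and can be
    -- differentiated again.
    have e1 : partialDeriv i (T m (Ω.indicator u)) =ᶠ[𝓝 x]
        fun x => s m * T m (Ω.indicator (g i)) x :=
      eventually_of_mem (hΩ.mem_nhds hx) fun y hy => hd1 m i y hy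
    have e2 : DifferentiableAt ℝ (T m (Ω.indicator (g i))) x :=
      ((contDiff_dilatedMollify (hρ m) (hρc m) (hli (h.memLp_fst i))).differentiable
        (by simp)).differentiableAt
    have e3 := partialDeriv_dilatedMollify hΩ (h.weak_snd i j) (hli (h.memLp_fst i)) (hρ m)
      (hρc m) (hmem m x hx)
    rw [partialDeriv, e1.fderiv_eq, fderiv_const_mul e2]
    simp only [smul_apply, smul_eq_mul]
    rw [mul_assoc, ← e3]
    rfl
  refine ⟨fun m => T m (Ω.indicator u), fun m =>
    contDiff_dilatedMollify (hρ m) (hρc m) (hli h.memLp), hTt h.memLp, fun i => ?_, fun i j => ?_⟩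
  · refine (tendsto_ltwo_sub_mul (h.memLp_fst i) (hTm (h.memLp_fst i)) hst
      (hTt (h.memLp_fst i))).congr fun m => ltwo_congr_ae ?_
    refine (ae_restrict_iff' hΩ.measurableSet).2 (Eventually.of_forall fun x hx => ?_)
    simp only [hd1 m i x hx]
  · have hss : Tendsto (fun m => s m * s m) atTop (𝓝 1) := by simpa using hst.mul hst
    refine (tendsto_ltwo_sub_mul (h.memLp_snd i j) (hTm (h.memLp_snd i j)) hss
      (hTt (h.memLp_snd i j))).congr fun m => ltwo_congr_ae ?_
    refine (ae_restrict_iff' hΩ.measurableSet).2 (Eventually.of_forall fun x hx => ?_)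
    simp only [hd2 m i j x hx]

/-- Lets a single sequence, built on the union of two neighbouring cells, serve on each of them.
Finiteness of the norms on the larger set is what makes their real values monotone. -/
theorem TendstoHTwo.mono {Ω Ω' : Set (Fin n → ℝ)} {φ : ℕ → (Fin n → ℝ) → ℝ}
    {u : (Fin n → ℝ) → ℝ} {g : Fin n → (Fin n → ℝ) → ℝ} {H : Fin n → Fin n → (Fin n → ℝ) → ℝ}
    (hs : Ω' ⊆ Ω) {k : Set (Fin n → ℝ)} (hk : IsCompact k) (hΩk : Ω ⊆ k)
    (h : HTwo Ω u g H) (hφ : ∀ m, ContDiff ℝ ∞ (φ m)) (hφu : TendstoHTwo Ω φ u g H) :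
    TendstoHTwo Ω' φ u g H := by
  have key : ∀ F : ℕ → (Fin n → ℝ) → ℝ, (∀ m, MemLp (F m) 2 (volume.restrict Ω)) →
      Tendsto (fun m => ltwo (volume.restrict Ω) (F m)) atTop (𝓝 0) →
      Tendsto (fun m => ltwo (volume.restrict Ω') (F m)) atTop (𝓝 0) := by
    intro F hF hFt
    refine squeeze_zero (fun m => ltwo_nonneg _ _) (fun m => ?_) hFt
    exact ENNReal.toReal_mono (hF m).2.ne
      (eLpNorm_mono_measure _ (Measure.restrict_mono hs le_rfl))
  exact ⟨key _ (fun m => (h.sub_contDiff hk hΩk (hφ m)).memLp) hφu.1,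
    fun i => key _ (fun m => (h.sub_contDiff hk hΩk (hφ m)).memLp_fst i) (hφu.2.1 i),
    fun i j => key _ (fun m => (h.sub_contDiff hk hΩk (hφ m)).memLp_snd i j) (hφu.2.2 i j)⟩

theorem tendstoHTwo_iff {Ω : Set (Fin n → ℝ)} {φ : ℕ → (Fin n → ℝ) → ℝ}
    {u : (Fin n → ℝ) → ℝ} {g : Fin n → (Fin n → ℝ) → ℝ} {H : Fin n → Fin n → (Fin n → ℝ) → ℝ}
    (hΩ : IsOpen Ω) {k : Set (Fin n → ℝ)} (hk : IsCompact k) (hΩk : Ω ⊆ k)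
    (h : HTwo Ω u g H) (hφ : ∀ m, ContDiff ℝ ∞ (φ m)) :
    TendstoHTwo Ω φ u g H ↔
      Tendsto (fun m => sobolevNormSq Ω 2 (fun x => u x - φ m x)) atTop (𝓝 0) := by
  have hm := fun m => h.sub_contDiff hk hΩk (hφ m)
  simp only [fun m => (hm m).sobolevNormSq_eq hΩ, hTwoNormSq]
  rw [TendstoHTwo, tendsto_ltwo_iff fun m => (hm m).memLp]
  simp only [fun i => tendsto_ltwo_iff fun m => (hm m).memLp_fst i,
    fun i j => tendsto_ltwo_iff fun m => (hm m).memLp_snd i j]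
  constructor
  · rintro ⟨h1, h2, h3⟩
    have := h1.add (tendsto_finsetSum Finset.univ fun i _ =>
      (h2 i).add (tendsto_finsetSum Finset.univ fun j _ => h3 i j))
    simpa using this
  · intro ht
    have p0 : ∀ f : (Fin n → ℝ) → ℝ, 0 ≤ ∫ x in Ω, f x ^ 2 := fun f =>
      integral_nonneg fun x => sq_nonneg _
    have p1 : ∀ (f : Fin n → (Fin n → ℝ) → ℝ), 0 ≤ ∑ j, ∫ x in Ω, f j x ^ 2 :=
      fun f => Finset.sum_nonneg fun j _ => p0 _
    refine ⟨squeeze_zero (fun m => p0 _) (fun m => ?_) ht,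
      fun i => squeeze_zero (fun m => p0 _) (fun m => ?_) ht,
      fun i j => squeeze_zero (fun m => p0 _) (fun m => ?_) ht⟩
    · exact le_add_of_nonneg_right (Finset.sum_nonneg fun i _ => add_nonneg (p0 _) (p1 _))
    · refine le_trans ?_ (le_add_of_nonneg_left (p0 _))
      refine le_trans ?_ (Finset.single_le_sum (fun i _ => add_nonneg (p0 _) (p1 _))
        (Finset.mem_univ i))
      exact le_add_of_nonneg_right (p1 _)
    · refine le_trans ?_ (le_add_of_nonneg_left (p0 _))
      refine le_trans ?_ (Finset.single_le_sum (fun i _ => add_nonneg (p0 _) (p1 _))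
        (Finset.mem_univ i))
      refine le_trans ?_ (le_add_of_nonneg_left (p0 _))
      exact Finset.single_le_sum (f := fun j => ∫ x in Ω, (H i j x -
        partialDeriv j (partialDeriv i (φ m)) x) ^ 2) (fun i _ => p0 _) (Finset.mem_univ j)

end Density

/-! ### Uniform probability measures on boxes and their faces -/

section BoxMeasures

variable {n : ℕ} (K : BoxIntegral.Box (Fin n))

/-- The length of the edge of `K` in direction `k`. -/
def boxLen (k : Fin n) : ℝ := K.upper k - K.lower k

theorem boxLen_pos (k : Fin n) : 0 < boxLen K k := sub_pos.2 (K.lower_lt_upper k)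

/-- The uniform distribution on the edge of `K` in direction `k`. -/
noncomputable def edgeProb (k : Fin n) : Measure ℝ :=
  (ENNReal.ofReal (boxLen K k))⁻¹ • volume.restrict (Set.Icc (K.lower k) (K.upper k))

instance (k : Fin n) : IsProbabilityMeasure (edgeProb K k) := by
  constructor
  have h := ENNReal.ofReal_pos.2 (boxLen_pos K k)
  rw [edgeProb, Measure.smul_apply, Measure.restrict_apply_univ, Real.volume_Icc, smul_eq_mul]
  exact ENNReal.inv_mul_cancel h.ne' ENNReal.ofReal_ne_top

/-- The uniform distribution on `K`. -/
noncomputable def boxProb : Measure (Fin n → ℝ) := Measure.pi (edgeProb K)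

instance : IsProbabilityMeasure (boxProb K) := by unfold boxProb; infer_instance

/-- The uniform distribution on a face of `K`. -/
noncomputable def faceProb (S : Finset (Fin n)) (c : Fin n → Bool) : Measure (Fin n → ℝ) :=
  Measure.pi fun k => if k ∈ S then Measure.dirac (boxEnd K k (c k)) else edgeProb K k

theorem faceMeasure_eq (S : Finset (Fin n)) (c : Fin n → Bool) :
    faceMeasure K S c =
      (∏ k, if k ∈ S then 1 else ENNReal.ofReal (boxLen K k)) • faceProb K S c := by
  have h1 : ∀ k, SigmaFinite (if k ∈ S then Measure.dirac (boxEnd K k (c k)) else edgeProb K k) :=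
    fun k => by split_ifs <;> infer_instance
  have h2 : ∀ k, SigmaFinite (if k ∈ S then Measure.dirac (boxEnd K k (c k))
    else volume.restrict (Set.Icc (K.lower k) (K.upper k))) :=
    fun k => by split_ifs <;> infer_instance
  unfold faceMeasure faceProb
  refine Measure.pi_eq fun s _ => ?_
  rw [Measure.smul_apply, Measure.pi_pi, smul_eq_mul, ← Finset.prod_mul_distrib]
  refine Finset.prod_congr rfl fun k _ => ?_
  split_ifs
  · rw [one_mul]
  · have h := ENNReal.ofReal_pos.2 (boxLen_pos K k)
    rw [edgeProb, Measure.smul_apply, smul_eq_mul, ← mul_assoc,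
      ENNReal.mul_inv_cancel h.ne' ENNReal.ofReal_ne_top, one_mul]

theorem volume_restrict_boxIcc_eq : volume.restrict (BoxIntegral.Box.Icc K) =
    (∏ k, ENNReal.ofReal (boxLen K k)) • boxProb K := by
  rw [BoxIntegral.Box.Icc_eq_pi, volume_pi, Measure.restrict_pi_pi]
  have := faceMeasure_eq K ∅ (fun _ => false)
  simpa [faceMeasure, faceProb, boxProb] using this

theorem volume_restrict_boxIoo_eq : volume.restrict (BoxIntegral.Box.Ioo K) =
    (∏ k, ENNReal.ofReal (boxLen K k)) • boxProb K := by
  rw [← volume_restrict_boxIcc_eq]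
  exact Measure.restrict_congr_set K.Ioo_ae_eq_Icc

theorem prod_boxLen_ne_zero : (∏ k, ENNReal.ofReal (boxLen K k)) ≠ 0 :=
  Finset.prod_ne_zero_iff.2 fun k _ => (ENNReal.ofReal_pos.2 (boxLen_pos K k)).ne'

theorem prod_boxLen_ne_top : (∏ k, ENNReal.ofReal (boxLen K k)) ≠ ⊤ :=
  ENNReal.prod_ne_top fun _ _ => ENNReal.ofReal_ne_top

theorem boxProb_eq_smul : boxProb K =
    (∏ k, ENNReal.ofReal (boxLen K k))⁻¹ • volume.restrict (BoxIntegral.Box.Icc K) := by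
  rw [volume_restrict_boxIcc_eq, smul_smul,
    ENNReal.inv_mul_cancel (prod_boxLen_ne_zero K) (prod_boxLen_ne_top K), one_smul]

theorem boxProb_ae_mem : ∀ᵐ x ∂boxProb K, x ∈ BoxIntegral.Box.Icc K := by
  rw [boxProb_eq_smul]
  exact Measure.ae_smul_measure (ae_restrict_mem K.isCompact_Icc.measurableSet) _

/-- The local estimates compare `L²` norms over the same box, so this common factor cancels and they
may be proved for the probability measure, where averages are contractions. -/
theorem ltwo_volume_boxIoo (f : (Fin n → ℝ) → ℝ) : ltwo (volume.restrict (BoxIntegral.Box.Ioo K)) f =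
    Real.sqrt (∏ k, boxLen K k) * ltwo (boxProb K) f := by
  rw [ltwo, ltwo, volume_restrict_boxIoo_eq, eLpNorm_smul_measure_of_ne_top (by norm_num),
    smul_eq_mul, ENNReal.toReal_mul, ← ENNReal.toReal_rpow, ENNReal.toReal_prod, Real.sqrt_eq_rpow]
  simp [ENNReal.toReal_ofReal (boxLen_pos K _).le]

theorem memLp_boxProb_iff {f : (Fin n → ℝ) → ℝ} : MemLp f 2 (boxProb K) ↔
    MemLp f 2 (volume.restrict (BoxIntegral.Box.Ioo K)) := by
  constructor
  · intro h
    rw [volume_restrict_boxIoo_eq]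
    exact h.smul_measure (prod_boxLen_ne_top K)
  · intro h
    rw [boxProb_eq_smul, ← Measure.restrict_congr_set K.Ioo_ae_eq_Icc]
    exact h.smul_measure (ENNReal.inv_ne_top.2 (prod_boxLen_ne_zero K))

variable {K}

theorem Continuous.integrable_boxProb {f : (Fin n → ℝ) → ℝ} (hf : Continuous f) :
    Integrable f (boxProb K) := by
  rw [boxProb_eq_smul]
  exact (hf.continuousOn.integrableOn_compact K.isCompact_Icc).smul_measure
    (ENNReal.inv_ne_top.2 (prod_boxLen_ne_zero K))

theorem Continuous.memLp_boxProb {f : (Fin n → ℝ) → ℝ} (hf : Continuous f) :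
    MemLp f 2 (boxProb K) :=
  (memLp_two_iff_integrable_sq hf.aestronglyMeasurable).2 (hf.pow 2).integrable_boxProb

/-- The coordinates of a uniform point of a box are independent, so mixing the coordinates of two
independent uniform points gives a uniform point. Contractivity and composition of coordinate
averages both rest on this. -/
theorem measurePreserving_piecewise (S : Finset (Fin n)) :
    MeasurePreserving (fun p : (Fin n → ℝ) × (Fin n → ℝ) => S.piecewise p.2 p.1)
      ((boxProb K).prod (boxProb K)) (boxProb K) := by
  have hm : Measurable fun p : (Fin n → ℝ) × (Fin n → ℝ) => S.piecewise p.2 p.1 := by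
    refine measurable_pi_lambda _ fun k => ?_
    by_cases hk : k ∈ S <;> simp only [Finset.piecewise, hk, if_true, if_false] <;> fun_prop
  refine ⟨hm, ?_⟩
  symm
  refine Measure.pi_eq fun s hs => ?_
  rw [Measure.map_apply hm (MeasurableSet.univ_pi hs)]
  have : (fun p : (Fin n → ℝ) × (Fin n → ℝ) => S.piecewise p.2 p.1) ⁻¹' Set.univ.pi s =
      (Set.univ.pi fun k => if k ∈ S then Set.univ else s k) ×ˢ
        (Set.univ.pi fun k => if k ∈ S then s k else Set.univ) := by
    ext p
    simp only [Set.mem_preimage, Set.mem_pi, Set.mem_univ, true_implies, Set.mem_prod,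
      Finset.piecewise]
    constructor
    · intro h
      constructor <;> intro k <;> have := h k <;> by_cases hk : k ∈ S <;> simp_all
    · rintro ⟨h1, h2⟩ k
      have h1 := h1 k
      have h2 := h2 k
      by_cases hk : k ∈ S <;> simp_all
  rw [this, Measure.prod_prod, boxProb, Measure.pi_pi, Measure.pi_pi, ← Finset.prod_mul_distrib]
  refine Finset.prod_congr rfl fun k _ => ?_
  by_cases hk : k ∈ S <;> simp [hk]

/-- Freezing the coordinates in `S` of a uniform point of `K` gives a uniform point of the face.
Face integrals thereby become integrals over `K`. -/
theorem faceProb_eq_map (S : Finset (Fin n)) (c : Fin n → Bool) :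
    faceProb K S c = (boxProb K).map (fun y => S.piecewise (fun k => boxEnd K k (c k)) y) := by
  have hf : ∀ k, Measurable (fun t : ℝ => if k ∈ S then boxEnd K k (c k) else t) := fun k => by
    by_cases hk : k ∈ S <;> simp only [hk, if_true, if_false] <;> fun_prop
  have e : ∀ k, (edgeProb K k).map (fun t : ℝ => if k ∈ S then boxEnd K k (c k) else t) =
      if k ∈ S then Measure.dirac (boxEnd K k (c k)) else edgeProb K k := fun k => by
    by_cases hk : k ∈ S
    · simp [hk, Measure.map_const]
    · simp [hk]
  have i2 : ∀ k, SigmaFinite ((edgeProb K k).map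
      (fun t : ℝ => if k ∈ S then boxEnd K k (c k) else t)) := fun k => by
    rw [e]; split_ifs <;> infer_instance
  have := Measure.pi_map_pi (μ := edgeProb K)
    (f := fun k t => if k ∈ S then boxEnd K k (c k) else t) (fun k => (hf k).aemeasurable)
  simp only [e] at this
  rw [faceProb, ← this, boxProb]
  rfl

theorem continuous_piecewise_left (S : Finset (Fin n)) (x : Fin n → ℝ) :
    Continuous fun y : Fin n → ℝ => S.piecewise y x := by
  refine continuous_pi fun k => ?_
  by_cases hk : k ∈ S <;> simp only [Finset.piecewise, hk, if_true, if_false] <;> fun_prop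

theorem continuous_finset_piecewise (S : Finset (Fin n)) :
    Continuous fun p : (Fin n → ℝ) × (Fin n → ℝ) => S.piecewise p.2 p.1 := by
  refine continuous_pi fun k => ?_
  by_cases hk : k ∈ S <;> simp only [Finset.piecewise, hk, if_true, if_false] <;> fun_prop

theorem continuous_piecewise_right (S : Finset (Fin n)) (x : Fin n → ℝ) :
    Continuous fun y : Fin n → ℝ => S.piecewise x y := by
  refine continuous_pi fun k => ?_
  by_cases hk : k ∈ S <;> simp only [Finset.piecewise, hk, if_true, if_false] <;> fun_prop

instance (S : Finset (Fin n)) (c : Fin n → Bool) : IsProbabilityMeasure (faceProb K S c) := by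
  rw [faceProb_eq_map]
  exact Measure.isProbabilityMeasure_map (continuous_piecewise_right S _).aemeasurable

theorem integral_faceProb (S : Finset (Fin n)) (c : Fin n → Bool) {f : (Fin n → ℝ) → ℝ}
    (hf : Continuous f) : ∫ x, f x ∂faceProb K S c =
      ∫ y, f (S.piecewise (fun k => boxEnd K k (c k)) y) ∂boxProb K := by
  rw [faceProb_eq_map, integral_map (continuous_piecewise_right S _).aemeasurable
    hf.aestronglyMeasurable]

theorem ltwo_faceProb (S : Finset (Fin n)) (c : Fin n → Bool) {f : (Fin n → ℝ) → ℝ}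
    (hf : Continuous f) : ltwo (faceProb K S c) f =
      ltwo (boxProb K) (fun y => f (S.piecewise (fun k => boxEnd K k (c k)) y)) := by
  rw [faceProb_eq_map, ltwo, eLpNorm_map_measure hf.aestronglyMeasurable
    (continuous_piecewise_right S _).aemeasurable]
  rfl

theorem Continuous.memLp_faceProb {f : (Fin n → ℝ) → ℝ} (hf : Continuous f)
    (S : Finset (Fin n)) (c : Fin n → Bool) : MemLp f 2 (faceProb K S c) := by
  rw [faceProb_eq_map, memLp_map_measure_iff hf.aestronglyMeasurable
    (continuous_piecewise_right S _).aemeasurable]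
  exact (hf.comp (continuous_piecewise_right S _)).memLp_boxProb

end BoxMeasures

/-! ### Averages in some of the coordinates -/

section Averages

variable {n : ℕ} (K : BoxIntegral.Box (Fin n))

/-- The average of `f` over the coordinates in `S`. -/
noncomputable def coordAvg (S : Finset (Fin n)) (f : (Fin n → ℝ) → ℝ) (x : Fin n → ℝ) : ℝ :=
  ∫ y, f (S.piecewise y x) ∂boxProb K

variable {K}

theorem continuous_coordAvg {f : (Fin n → ℝ) → ℝ} (hf : Continuous f) (S : Finset (Fin n)) :
    Continuous (coordAvg K S f) := by
  -- Over the compact box, continuity of the integrand suffices for continuity in the parameter.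
  have : coordAvg K S f = fun x => (∏ k, ENNReal.ofReal (boxLen K k))⁻¹.toReal •
      ∫ y in BoxIntegral.Box.Icc K, f (S.piecewise y x) := by
    ext x
    rw [coordAvg, boxProb_eq_smul, integral_smul_measure]
  rw [this]
  simp only [smul_eq_mul]
  refine continuous_const.mul ?_
  exact continuous_parametric_integral_of_continuous (f := fun x y => f (S.piecewise y x)) (hf.comp (continuous_finset_piecewise S))
    K.isCompact_Icc

/-- Jensen's inequality for the inner average; by `measurePreserving_piecewise` the Jacobian
constant is `1`. -/
theorem ltwo_coordAvg_le {f : (Fin n → ℝ) → ℝ} (hf : Continuous f) (S : Finset (Fin n)) :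
    ltwo (boxProb K) (coordAvg K S f) ≤ ltwo (boxProb K) f := by
  have h := eLpNorm_integral_comp_le (P := boxProb K) (μ := boxProb K) (ν := boxProb K)
    (measurePreserving_piecewise (K := K) S).measurable (c := 1)
    (by rw [(measurePreserving_piecewise S).map_eq, one_smul]) hf.measurable
  rw [one_mul, ENNReal.pow_le_pow_left_iff two_ne_zero] at h
  exact ENNReal.toReal_mono hf.memLp_boxProb.2.ne h

theorem coordAvg_sub {f g : (Fin n → ℝ) → ℝ} (hf : Continuous f) (hg : Continuous g)
    (S : Finset (Fin n)) (x : Fin n → ℝ) :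
    coordAvg K S (fun x => f x - g x) x = coordAvg K S f x - coordAvg K S g x :=
  integral_sub (hf.comp (continuous_piecewise_left S x)).integrable_boxProb
    (hg.comp (continuous_piecewise_left S x)).integrable_boxProb

/-- The sample for `R ∪ S` is assembled from independent samples for `R` and `S`. Overlap does no
harm: what has been averaged over `R` no longer depends on those coordinates. -/
theorem coordAvg_coordAvg {f : (Fin n → ℝ) → ℝ} (hf : Continuous f) (S R : Finset (Fin n))
    (x : Fin n → ℝ) : coordAvg K S (coordAvg K R f) x = coordAvg K (R ∪ S) f x := by
  have e : ∀ y z, R.piecewise z (S.piecewise y x) = (R ∪ S).piecewise (R.piecewise z y) x := by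
    intro y z
    ext k
    by_cases h1 : k ∈ R <;> by_cases h2 : k ∈ S <;> simp [Finset.piecewise, h1, h2]
  have hF : Continuous fun w => f ((R ∪ S).piecewise w x) := hf.comp (continuous_piecewise_left _ x)
  simp only [coordAvg, e]
  conv_rhs => rw [← (measurePreserving_piecewise (K := K) R).map_eq]
  rw [integral_map (measurePreserving_piecewise R).aemeasurable hF.aestronglyMeasurable]
  refine (integral_prod (μ := boxProb K) (ν := boxProb K)
    (fun p => f ((R ∪ S).piecewise (R.piecewise p.2 p.1) x)) ?_).symm
  exact (measurePreserving_piecewise (K := K) R).integrable_comp_of_integrable hF.integrable_boxProb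

theorem coordAvg_singleton {f : (Fin n → ℝ) → ℝ} (hf : Continuous f) (k : Fin n)
    (x : Fin n → ℝ) : coordAvg K {k} f x = ∫ t, f (Function.update x k t) ∂edgeProb K k := by
  have h := measurePreserving_eval (edgeProb K) k
  rw [← h.map_eq, integral_map h.aemeasurable]
  · simp only [coordAvg, Finset.piecewise_singleton]
    rfl
  · exact (hf.comp (continuous_const.update k continuous_id)).aestronglyMeasurable

theorem integral_edgeProb (f : ℝ → ℝ) (k : Fin n) : ∫ t, f t ∂edgeProb K k =
    (boxLen K k)⁻¹ * ∫ t in (K.lower k)..(K.upper k), f t := by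
  rw [edgeProb, integral_smul_measure, ENNReal.toReal_inv,
    ENNReal.toReal_ofReal (boxLen_pos K k).le, intervalIntegral.integral_of_le
    (K.lower_lt_upper k).le, integral_Icc_eq_integral_Ioc, smul_eq_mul]

theorem edgeProb_ae_mem (k : Fin n) :
    ∀ᵐ t ∂edgeProb K k, t ∈ Set.Icc (K.lower k) (K.upper k) :=
  Measure.ae_smul_measure (ae_restrict_mem measurableSet_Icc) _

theorem Continuous.integrable_edgeProb {f : ℝ → ℝ} (hf : Continuous f) (k : Fin n) :
    Integrable f (edgeProb K k) :=
  (hf.continuousOn.integrableOn_compact isCompact_Icc).smul_measure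
    (ENNReal.inv_ne_top.2 (ENNReal.ofReal_pos.2 (boxLen_pos K k)).ne')

theorem coordAvg_univ (f : (Fin n → ℝ) → ℝ) (x : Fin n → ℝ) :
    coordAvg K Finset.univ f x = ∫ y, f y ∂boxProb K := by
  simp [coordAvg]

theorem integral_coordAvg {f : (Fin n → ℝ) → ℝ} (hf : Continuous f) (S : Finset (Fin n)) :
    ∫ x, coordAvg K S f x ∂boxProb K = ∫ x, f x ∂boxProb K := by
  -- The base point `K.lower` is arbitrary: a full average does not depend on it.
  rw [← coordAvg_univ _ K.lower, coordAvg_coordAvg hf, Finset.union_eq_right.2 (Finset.subset_univ S), coordAvg_univ]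

end Averages

/-! ### Oscillation along a coordinate -/

section Oscillation

variable {n : ℕ} {K : BoxIntegral.Box (Fin n)} {f : (Fin n → ℝ) → ℝ}

theorem hasDerivAt_update_line (hf : ContDiff ℝ ∞ f) (k : Fin n) (x : Fin n → ℝ) (t : ℝ) :
    HasDerivAt (fun t => f (Function.update x k t)) (partialDeriv k f (Function.update x k t)) t :=
  ((hf.differentiable (by simp)) (Function.update x k t)).hasFDerivAt.comp_hasDerivAt t
    (hasDerivAt_update x k t)

theorem partialDeriv_eq_of_hasDerivAt (hf : ContDiff ℝ ∞ f) {k : Fin n} {x : Fin n → ℝ} {d : ℝ}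
    (h : HasDerivAt (fun t => f (Function.update x k t)) d (x k)) : partialDeriv k f x = d := by
  have := hasDerivAt_update_line hf k x (x k)
  rw [Function.update_eq_self] at this
  exact this.unique h

theorem contDiff_update_const (k : Fin n) (e : ℝ) :
    ContDiff ℝ ∞ fun x : Fin n → ℝ => Function.update x k e := by
  refine contDiff_pi.2 fun j => ?_
  by_cases hj : j = k
  · subst hj
    simpa using contDiff_const
  · simpa [Function.update_of_ne hj] using contDiff_apply ℝ ℝ j

theorem partialDeriv_comp_update (hf : ContDiff ℝ ∞ f) {j k : Fin n} (hjk : j ≠ k) (e : ℝ)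
    (x : Fin n → ℝ) : partialDeriv j (fun x => f (Function.update x k e)) x =
      partialDeriv j f (Function.update x k e) := by
  refine partialDeriv_eq_of_hasDerivAt (hf.comp (contDiff_update_const k e)) ?_
  have := hasDerivAt_update_line hf j (Function.update x k e) (x j)
  have e1 : ∀ t, Function.update (Function.update x k e) j t =
      Function.update (Function.update x j t) k e := fun t => Function.update_comm hjk.symm _ _ _
  simp only [e1, Function.update_eq_self] at this
  exact this

theorem boxEnd_mem_Icc (k : Fin n) (b : Bool) :
    boxEnd K k b ∈ Set.Icc (K.lower k) (K.upper k) := by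
  have := (K.lower_lt_upper k).le
  cases b <;> simp [boxEnd, this]

variable (K) in
/-- The integral of `|g|` over the chord of `K` in direction `k` through `x`. -/
noncomputable def chordIntegral (k : Fin n) (g : (Fin n → ℝ) → ℝ) (x : Fin n → ℝ) : ℝ :=
  boxLen K k * coordAvg K {k} (fun x => |g x|) x

theorem continuous_chordIntegral {g : (Fin n → ℝ) → ℝ} (hg : Continuous g) (k : Fin n) :
    Continuous (chordIntegral K k g) :=
  continuous_const.mul (continuous_coordAvg hg.abs _)

theorem chordIntegral_nonneg (k : Fin n) (g : (Fin n → ℝ) → ℝ) (x : Fin n → ℝ) :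
    0 ≤ chordIntegral K k g x :=
  mul_nonneg (boxLen_pos K k).le (integral_nonneg fun _ => abs_nonneg _)

theorem ltwo_abs {X : Type*} [MeasurableSpace X] (μ : Measure X) (f : X → ℝ) :
    ltwo μ (fun x => |f x|) = ltwo μ f := by
  rw [ltwo, ltwo]
  exact congrArg _ (eLpNorm_norm f)

theorem ltwo_chordIntegral_le {g : (Fin n → ℝ) → ℝ} (hg : Continuous g) (k : Fin n) :
    ltwo (boxProb K) (chordIntegral K k g) ≤ boxLen K k * ltwo (boxProb K) g := by
  unfold chordIntegral
  rw [ltwo_const_mul, abs_of_pos (boxLen_pos K k)]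
  refine mul_le_mul_of_nonneg_left ?_ (boxLen_pos K k).le
  exact (ltwo_coordAvg_le hg.abs _).trans (ltwo_abs _ _).le

/-- The fundamental theorem of calculus along the chord. The bound is the same for all pairs of
points of the chord, so it covers face values, chord means and difference quotients alike. -/
theorem abs_sub_le_chordIntegral (hf : ContDiff ℝ ∞ f) {k : Fin n} (x : Fin n → ℝ) {a b : ℝ}
    (ha : a ∈ Set.Icc (K.lower k) (K.upper k)) (hb : b ∈ Set.Icc (K.lower k) (K.upper k)) :
    |f (Function.update x k b) - f (Function.update x k a)| ≤
      chordIntegral K k (partialDeriv k f) x := by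
  have hc : Continuous (partialDeriv k f) := (contDiff_partialDeriv hf k).continuous
  have hu : Continuous fun t : ℝ => Function.update x k t := continuous_const.update k continuous_id
  have hd : ∀ t ∈ Set.uIcc a b, HasDerivAt (fun t => f (Function.update x k t))
      (partialDeriv k f (Function.update x k t)) t := fun t _ => hasDerivAt_update_line hf k x t
  rw [← intervalIntegral.integral_eq_sub_of_hasDerivAt hd
    ((hc.comp hu).intervalIntegrable _ _), chordIntegral, coordAvg_singleton hc.abs,
    integral_edgeProb, mul_inv_cancel_left₀ (boxLen_pos K k).ne',
    intervalIntegral.integral_of_le (K.lower_lt_upper k).le]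
  rw [← Real.norm_eq_abs]
  refine intervalIntegral.norm_integral_le_integral_norm_uIoc.trans ?_
  refine setIntegral_mono_set ?_ ?_ ?_
  · exact ((hc.abs.comp hu).integrableOn_Icc).mono_set Set.Ioc_subset_Icc_self
  · exact Eventually.of_forall fun t => abs_nonneg _
  · refine Eventually.of_forall (Set.Ioc_subset_Ioc (le_min ha.1 hb.1) (max_le ha.2 hb.2))

theorem abs_sub_update_le_chordIntegral (hf : ContDiff ℝ ∞ f) {k : Fin n} {x : Fin n → ℝ} {a : ℝ}
    (hx : x ∈ BoxIntegral.Box.Icc K) (ha : a ∈ Set.Icc (K.lower k) (K.upper k)) :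
    |f x - f (Function.update x k a)| ≤ chordIntegral K k (partialDeriv k f) x := by
  have := abs_sub_le_chordIntegral hf x ha (mem_boxIcc.1 hx k)
  rwa [Function.update_eq_self] at this

theorem abs_sub_coordAvg_le_chordIntegral (hf : ContDiff ℝ ∞ f) {k : Fin n} {x : Fin n → ℝ}
    (hx : x ∈ BoxIntegral.Box.Icc K) :
    |f x - coordAvg K {k} f x| ≤ chordIntegral K k (partialDeriv k f) x := by
  have hu : Continuous fun t : ℝ => f (Function.update x k t) :=
    hf.continuous.comp (continuous_const.update k continuous_id)
  have e : f x - coordAvg K {k} f x = ∫ t, (f x - f (Function.update x k t)) ∂edgeProb K k := by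
    rw [integral_sub (integrable_const _) (hu.integrable_edgeProb k),
      coordAvg_singleton hf.continuous]
    simp
  rw [e, ← Real.norm_eq_abs]
  refine (norm_integral_le_of_norm_le_const (C := chordIntegral K k (partialDeriv k f) x) ?_).trans
    (by simp)
  filter_upwards [edgeProb_ae_mem k] with t ht
  exact abs_sub_update_le_chordIntegral hf hx ht

theorem ltwo_le_of_abs_le {f g : (Fin n → ℝ) → ℝ} (hg : Continuous g)
    (h : ∀ x ∈ BoxIntegral.Box.Icc K, |f x| ≤ g x) : ltwo (boxProb K) f ≤ ltwo (boxProb K) g :=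
  ltwo_le_of_ae_abs_le hg.memLp_boxProb
    ((boxProb_ae_mem K).mono fun x hx => (h x hx).trans (le_abs_self _))

/-- A Poincaré inequality, proved by averaging out one coordinate at a time. Writing `A` for the
averages, `f - A_{S ∪ k} f = A_S (f - A_k f) + (f - A_S f)`: the first term is a contraction of a
one-dimensional error, the second is the induction hypothesis. -/
theorem ltwo_sub_coordAvg_le (hf : ContDiff ℝ ∞ f) (S : Finset (Fin n)) :
    ltwo (boxProb K) (fun x => f x - coordAvg K S f x) ≤
      ∑ k ∈ S, boxLen K k * ltwo (boxProb K) (partialDeriv k f) := by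
  induction S using Finset.induction_on with
  | empty => simp [coordAvg, ltwo]
  | insert k S hk ih =>
    have hc := hf.continuous
    have hck := continuous_coordAvg (K := K) hc {k}
    rw [Finset.sum_insert hk]
    have e : (fun x => f x - coordAvg K (insert k S) f x) = fun x =>
        coordAvg K S (fun x => f x - coordAvg K {k} f x) x + (f x - coordAvg K S f x) := by
      ext x
      rw [coordAvg_sub hc hck, coordAvg_coordAvg hc]
      simp only [Finset.singleton_union]
      ring
    rw [e]
    refine (ltwo_add_le (continuous_coordAvg (hc.sub hck) S).memLp_boxProb
      (hc.sub (continuous_coordAvg hc S)).memLp_boxProb).trans (add_le_add ?_ ih)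
    refine (ltwo_coordAvg_le (hc.sub hck) S).trans ?_
    have hp := (contDiff_partialDeriv hf k).continuous
    exact (ltwo_le_of_abs_le (continuous_chordIntegral hp k) fun x hx =>
      abs_sub_coordAvg_le_chordIntegral hf hx).trans (ltwo_chordIntegral_le hp k)

/-- If `g` is `f` up to an error bounded by `G` on `K`, then the averages of `g` in the coordinates
`S` are `f` up to `G` and the oscillation of `f` in the coordinates `S`. -/
theorem ltwo_sub_coordAvg_le_add {g G : (Fin n → ℝ) → ℝ} (hf : ContDiff ℝ ∞ f) (hg : Continuous g)
    (hG : Continuous G) (h : ∀ x ∈ BoxIntegral.Box.Icc K, |f x - g x| ≤ G x)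
    (S : Finset (Fin n)) :
    ltwo (boxProb K) (fun x => f x - coordAvg K S g x) ≤
      ∑ k ∈ S, boxLen K k * ltwo (boxProb K) (partialDeriv k f) + ltwo (boxProb K) G := by
  have hc := hf.continuous
  have e : (fun x => f x - coordAvg K S g x) = fun x =>
      (f x - coordAvg K S f x) + coordAvg K S (fun x => f x - g x) x := by
    ext x
    rw [coordAvg_sub hc hg]
    ring
  rw [e]
  refine (ltwo_add_le (hc.sub (continuous_coordAvg hc S)).memLp_boxProb
    (continuous_coordAvg (hc.sub hg) S).memLp_boxProb).trans
    (add_le_add (ltwo_sub_coordAvg_le hf S) ?_)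
  exact (ltwo_coordAvg_le (hc.sub hg) S).trans (ltwo_le_of_abs_le hG h)

/-- Trace inequality on a face of codimension one. -/
theorem ltwo_comp_update_le (hf : ContDiff ℝ ∞ f) (k : Fin n) {e : ℝ}
    (he : e ∈ Set.Icc (K.lower k) (K.upper k)) :
    ltwo (boxProb K) (fun x => f (Function.update x k e)) ≤
      ltwo (boxProb K) f + boxLen K k * ltwo (boxProb K) (partialDeriv k f) := by
  have hp := (contDiff_partialDeriv hf k).continuous
  have hC := continuous_chordIntegral (K := K) hp k
  refine (ltwo_le_of_abs_le (g := fun x => |f x| + chordIntegral K k (partialDeriv k f) x)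
    (hf.continuous.abs.add hC) fun x hx => ?_).trans ?_
  · have h1 := abs_sub_update_le_chordIntegral hf hx he
    have h2 := abs_sub_abs_le_abs_sub (f (Function.update x k e)) (f x)
    rw [abs_sub_comm] at h2
    linarith
  · refine (ltwo_add_le hf.continuous.abs.memLp_boxProb hC.memLp_boxProb).trans ?_
    exact add_le_add (ltwo_abs _ _).le (ltwo_chordIntegral_le hp k)

end Oscillation

/-! ### Interpolation of smooth functions on a box -/

section SmoothInterpolation

variable {n : ℕ} {K : BoxIntegral.Box (Fin n)} {f : (Fin n → ℝ) → ℝ}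

theorem refCoord_mem {x : Fin n → ℝ} (hx : x ∈ BoxIntegral.Box.Icc K) (i : Fin n) :
    0 ≤ refCoord K i x ∧ refCoord K i x ≤ 1 := by
  have h := mem_boxIcc.1 hx i
  have h0 := boxLen_pos K i
  unfold boxLen at h0
  exact ⟨div_nonneg (by linarith) h0.le, (div_le_one h0).2 (by linarith)⟩

theorem continuous_refCoord (i : Fin n) : Continuous (refCoord K i) := by
  unfold refCoord
  fun_prop

theorem contDiff_refCoord (i : Fin n) : ContDiff ℝ ∞ (refCoord K i) :=
  ((contDiff_apply ℝ ℝ i).sub contDiff_const).div_const _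

theorem contDiff_nodalFun (b : Bool) : ContDiff ℝ ∞ (nodalFun b) := by
  cases b
  · exact contDiff_const.sub contDiff_id
  · exact contDiff_id

theorem refCoord_update_of_ne {i j : Fin n} (h : i ≠ j) (x : Fin n → ℝ) (e : ℝ) :
    refCoord K i (Function.update x j e) = refCoord K i x := by
  simp [refCoord, Function.update_of_ne h]

theorem nodalFun_nonneg {t : ℝ} (ht : 0 ≤ t ∧ t ≤ 1) (b : Bool) : 0 ≤ nodalFun b t := by
  cases b <;> simp [nodalFun, ht.1, ht.2]

theorem nodalFun_add (t : ℝ) : nodalFun true t + nodalFun false t = 1 := by simp [nodalFun]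

variable (K) in
/-- Affine interpolation of `f` in direction `i`. -/
noncomputable def affInterp (i : Fin n) (f : (Fin n → ℝ) → ℝ) (x : Fin n → ℝ) : ℝ :=
  ∑ s : Bool, nodalFun s (refCoord K i x) * f (Function.update x i (boxEnd K i s))

theorem contDiff_affInterp (hf : ContDiff ℝ ∞ f) (i : Fin n) : ContDiff ℝ ∞ (affInterp K i f) :=
  ContDiff.sum fun s _ => ((contDiff_nodalFun s).comp (contDiff_refCoord i)).mul
    (hf.comp (contDiff_update_const i _))

/-- On `K` the two nodal functions are nonnegative and add up to one, so the sum is a convex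
combination. -/
theorem abs_sum_nodalFun_mul_le {x : Fin n → ℝ} (hx : x ∈ BoxIntegral.Box.Icc K) (i : Fin n)
    {v : Bool → ℝ} {M : ℝ} (hv : ∀ s, |v s| ≤ M) :
    |∑ s : Bool, nodalFun s (refCoord K i x) * v s| ≤ M := by
  have h1 := nodalFun_nonneg (refCoord_mem hx i)
  calc _ ≤ ∑ s : Bool, |nodalFun s (refCoord K i x) * v s| := Finset.abs_sum_le_sum_abs _ _
    _ ≤ ∑ s : Bool, nodalFun s (refCoord K i x) * M := Finset.sum_le_sum fun s _ => by
        rw [abs_mul, abs_of_nonneg (h1 s)]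
        exact mul_le_mul_of_nonneg_left (hv s) (h1 s)
    _ = M := by rw [← Finset.sum_mul, Fintype.sum_bool, nodalFun_add, one_mul]

theorem abs_sub_affInterp_le (hf : ContDiff ℝ ∞ f) (i : Fin n) {x : Fin n → ℝ}
    (hx : x ∈ BoxIntegral.Box.Icc K) :
    |f x - affInterp K i f x| ≤ chordIntegral K i (partialDeriv i f) x := by
  have e : f x - affInterp K i f x = ∑ s : Bool, nodalFun s (refCoord K i x) *
      (f x - f (Function.update x i (boxEnd K i s))) := by
    have := nodalFun_add (refCoord K i x)
    simp only [affInterp, Fintype.sum_bool]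
    linear_combination (-f x) * this
  rw [e]
  exact abs_sum_nodalFun_mul_le hx i fun s =>
    abs_sub_update_le_chordIntegral hf hx (boxEnd_mem_Icc i s)

theorem partialDeriv_affInterp (hf : ContDiff ℝ ∞ f) {i j : Fin n} (hij : i ≠ j)
    (x : Fin n → ℝ) :
    partialDeriv i (affInterp K j f) x = affInterp K j (partialDeriv i f) x := by
  refine partialDeriv_eq_of_hasDerivAt (contDiff_affInterp hf j) ?_
  unfold affInterp
  refine HasDerivAt.fun_sum fun s _ => ?_
  simp only [refCoord_update_of_ne hij.symm]
  refine HasDerivAt.const_mul _ ?_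
  have h := hasDerivAt_update_line (hf.comp (contDiff_update_const j (boxEnd K j s))) i x (x i)
  rw [Function.update_eq_self] at h
  have e := partialDeriv_comp_update hf hij (boxEnd K j s) x
  rw [← e]
  exact h

theorem partialDeriv_sub {g : (Fin n → ℝ) → ℝ} (hf : ContDiff ℝ ∞ f) (hg : ContDiff ℝ ∞ g)
    (i : Fin n) (x : Fin n → ℝ) :
    partialDeriv i (fun x => f x - g x) x = partialDeriv i f x - partialDeriv i g x := by
  rw [partialDeriv, fderiv_fun_sub ((hf.differentiable (by simp)) x)
    ((hg.differentiable (by simp)) x)]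
  rfl

theorem ltwo_sub_affInterp_le (hf : ContDiff ℝ ∞ f) (i : Fin n) :
    ltwo (boxProb K) (fun x => f x - affInterp K i f x) ≤
      boxLen K i * ltwo (boxProb K) (partialDeriv i f) := by
  have hp := (contDiff_partialDeriv hf i).continuous
  exact (ltwo_le_of_abs_le (continuous_chordIntegral hp i) fun x hx =>
    abs_sub_affInterp_le hf i hx).trans (ltwo_chordIntegral_le hp i)

variable (K) in
/-- The bilinear function in `(x_i, x_j)` with given values at the four corners. -/
noncomputable def shearPoly (i j : Fin n) (A : Bool → Bool → ℝ) (x : Fin n → ℝ) : ℝ :=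
  ∑ s : Bool, ∑ t : Bool, A s t * (nodalFun s (refCoord K i x) * nodalFun t (refCoord K j x))

variable (K) in
/-- The derivative of `shearPoly` in direction `j`. -/
noncomputable def shearPolyDeriv (i j : Fin n) (A : Bool → Bool → ℝ) (x : Fin n → ℝ) : ℝ :=
  ∑ s : Bool, (A s true - A s false) / boxLen K j * nodalFun s (refCoord K i x)

variable (K) in
/-- The function quadratic in `x_i` with given end values and given mean value. -/
noncomputable def normalPoly (i : Fin n) (A : Bool → ℝ) (M : ℝ) (x : Fin n → ℝ) : ℝ :=
  -- With `t` the reference coordinate, the three quadratics are dual to (value at `0`, value at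
  -- `1`, mean over `[0, 1]`): `(1 - t)(1 - 3t)` has data `(1, 0, 0)`, `t (3t - 2)` has `(0, 1, 0)`
  -- and `6t (1 - t)` has `(0, 0, 1)`.
  A false * ((1 - refCoord K i x) * (1 - 3 * refCoord K i x)) +
    A true * (refCoord K i x * (3 * refCoord K i x - 2)) +
    M * (6 * refCoord K i x * (1 - refCoord K i x))

variable (K) in
/-- The derivative of `normalPoly` in direction `i`. -/
noncomputable def normalPolyDeriv (i : Fin n) (A : Bool → ℝ) (M : ℝ) (x : Fin n → ℝ) : ℝ :=
  (A false * (6 * refCoord K i x - 4) + A true * (6 * refCoord K i x - 2) +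
    M * (6 - 12 * refCoord K i x)) / boxLen K i

theorem continuous_nodalFun (b : Bool) : Continuous (nodalFun b) := (contDiff_nodalFun b).continuous

theorem continuous_shearPoly (i j : Fin n) (A : Bool → Bool → ℝ) :
    Continuous (shearPoly K i j A) :=
  continuous_finsetSum _ fun s _ => continuous_finsetSum _ fun t _ => continuous_const.mul
    (((continuous_nodalFun s).comp (continuous_refCoord i)).mul
      ((continuous_nodalFun t).comp (continuous_refCoord j)))

theorem continuous_shearPolyDeriv (i j : Fin n) (A : Bool → Bool → ℝ) :
    Continuous (shearPolyDeriv K i j A) :=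
  continuous_finsetSum _ fun s _ => continuous_const.mul
    ((continuous_nodalFun s).comp (continuous_refCoord i))

theorem continuous_normalPoly (i : Fin n) (A : Bool → ℝ) (M : ℝ) :
    Continuous (normalPoly K i A M) := by
  have := continuous_refCoord (K := K) i
  unfold normalPoly
  fun_prop

theorem continuous_normalPolyDeriv (i : Fin n) (A : Bool → ℝ) (M : ℝ) :
    Continuous (normalPolyDeriv K i A M) := by
  have := continuous_refCoord (K := K) i
  unfold normalPolyDeriv
  fun_prop

variable (K) in
/-- The average of a smooth function over a face of codimension two. -/
noncomputable def edgeAvg (i j : Fin n) (f : (Fin n → ℝ) → ℝ) (s t : Bool) : ℝ :=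
  ∫ x, f x ∂faceProb K {i, j} (fun k => if k = i then s else t)

variable (K) in
/-- The average of a smooth function over a face of codimension one. -/
noncomputable def sideAvg (i : Fin n) (f : (Fin n → ℝ) → ℝ) (b : Bool) : ℝ :=
  ∫ x, f x ∂faceProb K {i} (fun _ => b)

theorem piecewise_pair {i j : Fin n} (hij : i ≠ j) (s t : Bool) (y : Fin n → ℝ) :
    ({i, j} : Finset (Fin n)).piecewise
      (fun k => boxEnd K k (if k = i then s else t)) y =
      Function.update (Function.update y i (boxEnd K i s)) j (boxEnd K j t) := by
  ext k
  by_cases hki : k = i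
  · subst hki
    simp [Finset.piecewise, Function.update_of_ne hij]
  · by_cases hkj : k = j
    · subst hkj
      simp [Finset.piecewise, hij.symm]
    · simp [Finset.piecewise, hki, hkj]

theorem edgeAvg_eq {i j : Fin n} (hij : i ≠ j) (hf : Continuous f) (s t : Bool) :
    edgeAvg K i j f s t = ∫ y, f (Function.update (Function.update y i (boxEnd K i s)) j
      (boxEnd K j t)) ∂boxProb K := by
  rw [edgeAvg, integral_faceProb _ _ hf]
  simp only [piecewise_pair hij]

theorem sideAvg_eq (i : Fin n) (hf : Continuous f) (b : Bool) :
    sideAvg K i f b = ∫ y, f (Function.update y i (boxEnd K i b)) ∂boxProb K := by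
  rw [sideAvg, integral_faceProb _ _ hf]
  simp only [Finset.piecewise_singleton]

/-- The nodal functions depend on `x_i` and `x_j` only. They come out of the average over the other
coordinates, which acts on the four corner values alone and turns them into means over faces of
codimension two. -/
theorem shearPoly_edgeAvg {i j : Fin n} (hij : i ≠ j) (hf : Continuous f) (x : Fin n → ℝ) :
    shearPoly K i j (edgeAvg K i j f) x =
      coordAvg K ({i, j} : Finset (Fin n))ᶜ (affInterp K i (affInterp K j f)) x := by
  have e : ∀ y, affInterp K i (affInterp K j f) ((({i, j} : Finset (Fin n))ᶜ).piecewise y x) =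
      ∑ s : Bool, ∑ t : Bool, (nodalFun s (refCoord K i x) * nodalFun t (refCoord K j x)) *
        f (Function.update (Function.update y i (boxEnd K i s)) j (boxEnd K j t)) := by
    intro y
    simp only [affInterp, Finset.mul_sum]
    refine Finset.sum_congr rfl fun s _ => Finset.sum_congr rfl fun t _ => ?_
    have e1 : refCoord K i ((({i, j} : Finset (Fin n))ᶜ).piecewise y x) = refCoord K i x := by
      simp [refCoord, Finset.piecewise]
    have e2 : refCoord K j (Function.update ((({i, j} : Finset (Fin n))ᶜ).piecewise y x) i
        (boxEnd K i s)) = refCoord K j x := by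
      rw [refCoord_update_of_ne hij.symm]
      simp [refCoord, Finset.piecewise]
    have e3 : Function.update (Function.update ((({i, j} : Finset (Fin n))ᶜ).piecewise y x) i
        (boxEnd K i s)) j (boxEnd K j t) =
        Function.update (Function.update y i (boxEnd K i s)) j (boxEnd K j t) := by
      ext k
      by_cases hkj : k = j
      · subst hkj; simp
      · by_cases hki : k = i
        · subst hki; simp [Function.update_of_ne hij]
        · simp [Finset.piecewise, hki, hkj]
    rw [e1, e2, e3]
    ring
  have hc : ∀ s t, Continuous fun y => f (Function.update (Function.update y i (boxEnd K i s)) j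
      (boxEnd K j t)) := fun s t => hf.comp
    (((continuous_id.update i continuous_const)).update j continuous_const)
  simp only [coordAvg, e]
  rw [integral_finsetSum _ fun s _ => integrable_finsetSum _ fun t _ =>
    ((hc s t).integrable_boxProb.const_mul _)]
  refine Finset.sum_congr rfl fun s _ => ?_
  rw [integral_finsetSum _ fun t _ => ((hc s t).integrable_boxProb.const_mul _)]
  refine Finset.sum_congr rfl fun t _ => ?_
  rw [integral_const_mul, edgeAvg_eq hij hf, mul_comm]

/-- Writing `I` for affine interpolation, `f - I_i I_j f = (f - I_i f) + I_i (f - I_j f)`. The last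
term involves `g = f - I_j f` on faces perpendicular to `x_i`. There `g` is bounded by its value at
`x` and the chord integral of `∂_i g = ∂_i f - I_j ∂_i f`, an interpolation error of `∂_i f`; this
produces the mixed second derivative with two edge lengths. -/
theorem ltwo_sub_shearPoly_le {i j : Fin n} (hij : i ≠ j) (hf : ContDiff ℝ ∞ f) :
    ltwo (boxProb K) (fun x => f x - shearPoly K i j (edgeAvg K i j f) x) ≤
      ∑ k, boxLen K k * ltwo (boxProb K) (partialDeriv k f) +
        boxLen K i * (boxLen K j * ltwo (boxProb K) (partialDeriv j (partialDeriv i f))) := by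
  set g := fun x => f x - affInterp K j f x with hg
  have hgs : ContDiff ℝ ∞ g := hf.sub (contDiff_affInterp hf j)
  have hpi := contDiff_partialDeriv hf i
  have hpj := contDiff_partialDeriv hf j
  have hpg := contDiff_partialDeriv hgs i
  have c1 := continuous_chordIntegral (K := K) hpi.continuous i
  have c2 := continuous_chordIntegral (K := K) hpj.continuous j
  have c3 := continuous_chordIntegral (K := K) hpg.continuous i
  simp only [shearPoly_edgeAvg hij hf.continuous]
  refine (ltwo_sub_coordAvg_le_add hf
    (contDiff_affInterp (contDiff_affInterp hf j) i).continuous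
    (G := fun x => chordIntegral K i (partialDeriv i f) x + (chordIntegral K j (partialDeriv j f) x
      + chordIntegral K i (partialDeriv i g) x)) (c1.add (c2.add c3)) (fun x hx => ?_) _).trans ?_
  · have e : f x - affInterp K i (affInterp K j f) x = (f x - affInterp K i f x) +
        ∑ s : Bool, nodalFun s (refCoord K i x) * g (Function.update x i (boxEnd K i s)) := by
      simp only [affInterp, hg, Fintype.sum_bool]
      ring
    rw [e]
    refine (abs_add_le _ _).trans (add_le_add (abs_sub_affInterp_le hf i hx) ?_)
    refine abs_sum_nodalFun_mul_le hx i fun s => ?_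
    have h1 := abs_sub_update_le_chordIntegral hgs hx (boxEnd_mem_Icc i s)
    have h2 : |g x| ≤ _ := abs_sub_affInterp_le hf j hx
    have h3 := abs_sub_abs_le_abs_sub (g (Function.update x i (boxEnd K i s))) (g x)
    rw [abs_sub_comm (g (Function.update x i (boxEnd K i s)))] at h3
    linarith
  · have b1 := ltwo_add_le (g := fun x => chordIntegral K j (partialDeriv j f) x
      + chordIntegral K i (partialDeriv i g) x) c1.memLp_boxProb (c2.add c3).memLp_boxProb
      (μ := boxProb K)
    have b2 := ltwo_add_le c2.memLp_boxProb c3.memLp_boxProb (μ := boxProb K)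
    have b3 := ltwo_chordIntegral_le (K := K) hpi.continuous i
    have b4 := ltwo_chordIntegral_le (K := K) hpj.continuous j
    have b5 := ltwo_chordIntegral_le (K := K) hpg.continuous i
    have e1 : partialDeriv i g = fun x => partialDeriv i f x - affInterp K j (partialDeriv i f) x := by
      ext x
      rw [hg, partialDeriv_sub hf (contDiff_affInterp hf j), partialDeriv_affInterp hf hij]
    have b6 := ltwo_sub_affInterp_le (K := K) hpi j
    rw [← e1] at b6
    have b7 := mul_le_mul_of_nonneg_left b6 (boxLen_pos K i).le
    have e2 : ∑ k, boxLen K k * ltwo (boxProb K) (partialDeriv k f) =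
        ∑ k ∈ ({i, j} : Finset (Fin n)), boxLen K k * ltwo (boxProb K) (partialDeriv k f) +
        ∑ k ∈ ({i, j} : Finset (Fin n))ᶜ, boxLen K k * ltwo (boxProb K) (partialDeriv k f) :=
      (Finset.sum_add_sum_compl _ _).symm
    rw [Finset.sum_pair hij] at e2
    linarith

theorem coordAvg_partialDeriv (hf : ContDiff ℝ ∞ f) (k : Fin n) (x : Fin n → ℝ) :
    coordAvg K {k} (partialDeriv k f) x = (f (Function.update x k (boxEnd K k true)) -
      f (Function.update x k (boxEnd K k false))) / boxLen K k := by
  have hc : Continuous (partialDeriv k f) := (contDiff_partialDeriv hf k).continuous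
  have hu : Continuous fun t : ℝ => Function.update x k t := continuous_const.update k continuous_id
  rw [coordAvg_singleton hc, integral_edgeProb, intervalIntegral.integral_eq_sub_of_hasDerivAt
    (f := fun t => f (Function.update x k t)) (fun t _ => hasDerivAt_update_line hf k x t)
    ((hc.comp hu).intervalIntegrable _ _)]
  simp [boxEnd, div_eq_inv_mul]

/-- The commutation property behind the divergence estimate. A difference quotient in `x_j` of means
over two parallel faces of codimension two is the mean of `∂_j f` over the face of codimension one
between them, and these means are then interpolated in `x_i`. -/
theorem shearPolyDeriv_edgeAvg {i j : Fin n} (hij : i ≠ j) (hf : ContDiff ℝ ∞ f)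
    (x : Fin n → ℝ) : shearPolyDeriv K i j (edgeAvg K i j f) x =
      coordAvg K ({i} : Finset (Fin n))ᶜ (affInterp K i (partialDeriv j f)) x := by
  have hp := (contDiff_partialDeriv hf j).continuous
  have e : ∀ y, affInterp K i (partialDeriv j f) ((({i} : Finset (Fin n))ᶜ).piecewise y x) =
      ∑ s : Bool, nodalFun s (refCoord K i x) *
        partialDeriv j f (Function.update y i (boxEnd K i s)) := by
    intro y
    simp only [affInterp]
    refine Finset.sum_congr rfl fun s _ => ?_
    have e1 : refCoord K i ((({i} : Finset (Fin n))ᶜ).piecewise y x) = refCoord K i x := by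
      simp [refCoord, Finset.piecewise]
    have e3 : Function.update ((({i} : Finset (Fin n))ᶜ).piecewise y x) i (boxEnd K i s) =
        Function.update y i (boxEnd K i s) := by
      ext k
      by_cases hki : k = i
      · subst hki; simp
      · simp [Finset.piecewise, hki]
    rw [e1, e3]
  have hc : ∀ s, Continuous fun y => partialDeriv j f (Function.update y i (boxEnd K i s)) :=
    fun s => hp.comp (continuous_id.update i continuous_const)
  simp only [coordAvg, e]
  rw [integral_finsetSum _ fun s _ => ((hc s).integrable_boxProb.const_mul _)]
  refine Finset.sum_congr rfl fun s _ => ?_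
  rw [integral_const_mul, mul_comm]
  congr 1
  set χ := fun y => f (Function.update y i (boxEnd K i s)) with hχ
  have hχs : ContDiff ℝ ∞ χ := hf.comp (contDiff_update_const i _)
  have e4 : (fun y => partialDeriv j f (Function.update y i (boxEnd K i s))) = partialDeriv j χ := by
    ext y
    exact (partialDeriv_comp_update hf hij.symm _ y).symm
  have hcc : ∀ t, Continuous fun y => χ (Function.update y j (boxEnd K j t)) :=
    fun t => hχs.continuous.comp (continuous_id.update j continuous_const)
  -- Averaging over `x_j` first turns `∂_j χ` into a difference quotient of end values.
  rw [e4, ← integral_coordAvg (contDiff_partialDeriv hχs j).continuous {j}]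
  simp only [coordAvg_partialDeriv hχs]
  rw [integral_div, integral_sub (hcc _).integrable_boxProb (hcc _).integrable_boxProb,
    edgeAvg_eq hij hf.continuous, edgeAvg_eq hij hf.continuous]
  have e5 : ∀ t y, χ (Function.update y j (boxEnd K j t)) =
      f (Function.update (Function.update y i (boxEnd K i s)) j (boxEnd K j t)) := fun t y => by
    rw [hχ, Function.update_comm hij]
  simp only [e5]

theorem ltwo_sub_shearPolyDeriv_le {i j : Fin n} (hij : i ≠ j) (hf : ContDiff ℝ ∞ f) :
    ltwo (boxProb K) (fun x => partialDeriv j f x - shearPolyDeriv K i j (edgeAvg K i j f) x) ≤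
      ∑ k, boxLen K k * ltwo (boxProb K) (partialDeriv k (partialDeriv j f)) := by
  have hp := contDiff_partialDeriv hf j
  have hpi := (contDiff_partialDeriv hp i).continuous
  simp only [shearPolyDeriv_edgeAvg hij hf]
  refine (ltwo_sub_coordAvg_le_add hp (contDiff_affInterp hp i).continuous
    (continuous_chordIntegral hpi i) (fun x hx => abs_sub_affInterp_le hp i hx) _).trans ?_
  rw [← Finset.sum_compl_add_sum {i}, Finset.sum_singleton]
  exact add_le_add le_rfl (ltwo_chordIntegral_le hpi i)

/-- Serves the quadratic interpolant and its derivative together, with `q` the three shape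
functions. Interpolation is done on each chord from its end values and its mean; averaging over the
transversal coordinates gives face means and the mean over `K`. -/
theorem coordAvg_compl_singleton_comp {i : Fin n} (q : Fin 3 → ℝ → ℝ)
    (hf : Continuous f) (x : Fin n → ℝ) :
    coordAvg K ({i} : Finset (Fin n))ᶜ (fun x =>
        f (Function.update x i (boxEnd K i false)) * q 0 (refCoord K i x) +
        f (Function.update x i (boxEnd K i true)) * q 1 (refCoord K i x) +
        coordAvg K {i} f x * q 2 (refCoord K i x)) x =
      sideAvg K i f false * q 0 (refCoord K i x) + sideAvg K i f true * q 1 (refCoord K i x) +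
        (∫ y, f y ∂boxProb K) * q 2 (refCoord K i x) := by
  have e1 : ∀ y, refCoord K i ((({i} : Finset (Fin n))ᶜ).piecewise y x) = refCoord K i x :=
    fun y => by simp [refCoord, Finset.piecewise]
  have e3 : ∀ y s, Function.update ((({i} : Finset (Fin n))ᶜ).piecewise y x) i (boxEnd K i s) =
      Function.update y i (boxEnd K i s) := fun y s => by
    ext k
    by_cases hki : k = i
    · subst hki; simp
    · simp [Finset.piecewise, hki]
  have hc : ∀ s, Continuous fun y => f (Function.update y i (boxEnd K i s)) :=
    fun s => hf.comp (continuous_id.update i continuous_const)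
  have ha : Continuous fun y => coordAvg K {i} f ((({i} : Finset (Fin n))ᶜ).piecewise y x) :=
    (continuous_coordAvg hf {i}).comp (continuous_piecewise_left _ x)
  have e4 : ∫ y, coordAvg K {i} f ((({i} : Finset (Fin n))ᶜ).piecewise y x) ∂boxProb K =
      ∫ y, f y ∂boxProb K := by
    have := coordAvg_coordAvg (K := K) hf ({i} : Finset (Fin n))ᶜ {i} x
    rw [Finset.union_compl, coordAvg_univ] at this
    exact this
  rw [coordAvg]
  simp only [e1, e3]
  have i2 : Integrable (fun y => f (Function.update y i (boxEnd K i false)) * q 0 (refCoord K i x) +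
      f (Function.update y i (boxEnd K i true)) * q 1 (refCoord K i x)) (boxProb K) :=
    ((hc _).integrable_boxProb.mul_const _).add ((hc _).integrable_boxProb.mul_const _)
  rw [integral_add i2 (ha.integrable_boxProb.mul_const _),
    integral_add ((hc _).integrable_boxProb.mul_const _) ((hc _).integrable_boxProb.mul_const _),
    integral_mul_const, integral_mul_const, integral_mul_const, e4, sideAvg_eq i hf,
    sideAvg_eq i hf]

theorem ltwo_sub_normalPoly_le (i : Fin n) (hf : ContDiff ℝ ∞ f) :
    ltwo (boxProb K)
      (fun x => f x - normalPoly K i (sideAvg K i f) (∫ y, f y ∂boxProb K) x) ≤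
      5 * ∑ k, boxLen K k * ltwo (boxProb K) (partialDeriv k f) := by
  have hp := (contDiff_partialDeriv hf i).continuous
  have hC := continuous_chordIntegral (K := K) hp i
  have hr := continuous_refCoord (K := K) i
  have hc := fun s => hf.continuous.comp
    (continuous_id.update i (continuous_const (y := boxEnd K i s)) : Continuous
      fun x : Fin n → ℝ => Function.update x i (boxEnd K i s))
  have ha := continuous_coordAvg (K := K) hf.continuous {i}
  have e := fun x => coordAvg_compl_singleton_comp (K := K) (i := i) ![fun t => (1 - t) * (1 - 3 * t),
    fun t => t * (3 * t - 2), fun t => 6 * t * (1 - t)] hf.continuous x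
  simp only [Matrix.cons_val_zero, Matrix.cons_val_one, Matrix.cons_val] at e
  simp only [normalPoly, ← e]
  refine (ltwo_sub_coordAvg_le_add hf (G := fun x => 5 * chordIntegral K i (partialDeriv i f) x)
    ?_ (continuous_const.mul hC) (fun x hx => ?_) _).trans ?_
  · simp only [Function.comp_def] at hc
    have h1 := hc false
    have h2 := hc true
    fun_prop
  · obtain ⟨t0, t1⟩ := refCoord_mem hx i
    have h1 := abs_sub_update_le_chordIntegral hf hx (boxEnd_mem_Icc i false)
    have h2 := abs_sub_update_le_chordIntegral hf hx (boxEnd_mem_Icc i true)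
    have h3 := abs_sub_coordAvg_le_chordIntegral (k := i) hf hx
    set J := chordIntegral K i (partialDeriv i f) x
    set t := refCoord K i x
    set a := f (Function.update x i (boxEnd K i false))
    set b := f (Function.update x i (boxEnd K i true))
    set m := coordAvg K {i} f x
    have hJ : 0 ≤ J := chordIntegral_nonneg i _ x
    -- The three shape functions sum to `1`, since constants are reproduced.
    have e2 : f x - (a * ((1 - t) * (1 - 3 * t)) + b * (t * (3 * t - 2)) + m * (6 * t * (1 - t))) =
      (f x - a) * ((1 - t) * (1 - 3 * t)) + (f x - b) * (t * (3 * t - 2)) +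
        (f x - m) * (6 * t * (1 - t)) := by ring
    rw [e2]
    -- The factor `5` is the sum `1 + 1 + 3` of these rough bounds for the shape functions on `[0,
    -- 1]`.
    have q0 : |(1 - t) * (1 - 3 * t)| ≤ 1 := abs_le.2 ⟨by nlinarith, by nlinarith⟩
    have q1 : |t * (3 * t - 2)| ≤ 1 := abs_le.2 ⟨by nlinarith, by nlinarith⟩
    have q2 : |6 * t * (1 - t)| ≤ 3 := abs_le.2 ⟨by nlinarith, by nlinarith [sq_nonneg (t - 1 / 2)]⟩
    refine (abs_add_three _ _ _).trans ?_
    simp only [abs_mul (f x - _)]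
    have b0 := mul_le_mul h1 q0 (abs_nonneg _) hJ
    have b1 := mul_le_mul h2 q1 (abs_nonneg _) hJ
    have b2 := mul_le_mul h3 q2 (abs_nonneg _) hJ
    linarith
  · rw [ltwo_const_mul, ← Finset.sum_compl_add_sum {i} fun k =>
      boxLen K k * ltwo (boxProb K) (partialDeriv k f), Finset.sum_singleton]
    have b1 := ltwo_chordIntegral_le (K := K) hp i
    have b2 : 0 ≤ ∑ k ∈ ({i} : Finset (Fin n))ᶜ, boxLen K k * ltwo (boxProb K) (partialDeriv k f) :=
      Finset.sum_nonneg fun k _ => mul_nonneg (boxLen_pos K k).le (ltwo_nonneg _ _)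
    rw [abs_of_pos (by norm_num : (0 : ℝ) < 5)]
    linarith

/-- Error of the derivative of quadratic interpolation in one variable, relative to the
oscillation `J` of the derivative. -/
theorem abs_deriv_sub_quadratic_le {a b J x : ℝ} (hab : a < b) {φ ψ : ℝ → ℝ}
    (hφ : ∀ t, HasDerivAt φ (ψ t) t)
    (hJ : ∀ s ∈ Set.Icc a b, ∀ t ∈ Set.Icc a b, |ψ s - ψ t| ≤ J) (hx : x ∈ Set.Icc a b)
    {t : ℝ} (ht : t = (x - a) / (b - a)) :
    |ψ x - (φ a * (6 * t - 4) + φ b * (6 * t - 2) +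
      ((b - a)⁻¹ * ∫ s in a..b, φ s) * (6 - 12 * t)) / (b - a)| ≤ 7 * J := by
  have hh : 0 < b - a := sub_pos.2 hab
  have hφc : Continuous φ := continuous_iff_continuousAt.2 fun s => (hφ s).continuousAt
  -- The mean slope `m` is attained by `ψ` at some `ξ`, so `ψ` stays within its oscillation `J` of
  -- `m`.
  set m := (φ b - φ a) / (b - a) with hm
  obtain ⟨ξ, hξ, hξm⟩ := exists_hasDerivAt_eq_slope φ ψ hab hφc.continuousOn fun s _ => hφ s
  have hξ' : ξ ∈ Set.Icc a b := Set.Ioo_subset_Icc_self hξ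
  have hψm : ∀ s ∈ Set.Icc a b, |ψ s - m| ≤ J := fun s hs => by
    rw [hm, ← hξm]; exact hJ s hs ξ hξ'
  have hJ0 : 0 ≤ J := (abs_nonneg _).trans (hψm x hx)
  -- The mean deviation of `φ` from its secant line. The mean value theorem on `[a, s]` bounds the
  -- integrand by `J (s - a)`.
  set E := (b - a)⁻¹ * ∫ s in a..b, (φ s - φ a - m * (s - a)) with hE
  have hE1 : |E| ≤ J * (b - a) := by
    have : ‖∫ s in a..b, (φ s - φ a - m * (s - a))‖ ≤ (J * (b - a)) * |b - a| := by
      refine intervalIntegral.norm_integral_le_of_norm_le_const fun s hs => ?_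
      rw [Set.uIoc_of_le hab.le] at hs
      obtain ⟨η, hη, hηm⟩ := exists_hasDerivAt_eq_slope φ ψ hs.1 hφc.continuousOn fun s _ => hφ s
      have hs0 : 0 < s - a := sub_pos.2 hs.1
      have e1 : φ s - φ a - m * (s - a) = (ψ η - m) * (s - a) := by
        rw [hηm]; field_simp
      rw [e1, Real.norm_eq_abs, abs_mul, abs_of_pos hs0]
      exact mul_le_mul (hψm η ⟨hη.1.le, hη.2.le.trans hs.2⟩) (by linarith [hs.2]) hs0.le hJ0
    rw [hE, abs_mul, abs_of_pos (inv_pos.2 hh)]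
    rw [Real.norm_eq_abs, abs_of_pos hh] at this
    calc _ ≤ (b - a)⁻¹ * (J * (b - a) * (b - a)) :=
          mul_le_mul_of_nonneg_left this (inv_pos.2 hh).le
      _ = J * (b - a) := by field_simp
  have hE2 : (b - a)⁻¹ * ∫ s in a..b, φ s = φ a + m * (b - a) / 2 + E := by
    have i1 : IntervalIntegrable φ volume a b := hφc.intervalIntegrable _ _
    have i2 : IntervalIntegrable (fun _ : ℝ => φ a) volume a b := continuous_const.intervalIntegrable _ _
    have i3 : IntervalIntegrable (fun s : ℝ => m * (s - a)) volume a b :=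
      (by fun_prop : Continuous fun s : ℝ => m * (s - a)).intervalIntegrable _ _
    rw [hE, intervalIntegral.integral_sub (i1.sub i2) i3, intervalIntegral.integral_sub i1 i2,
      intervalIntegral.integral_const, intervalIntegral.integral_const_mul,
      intervalIntegral.integral_sub (f := fun s => s) (continuous_id.intervalIntegrable _ _)
        (continuous_const.intervalIntegrable _ _), integral_id, intervalIntegral.integral_const]
    simp only [smul_eq_mul]
    field_simp
    ring
  have hb : φ b = φ a + m * (b - a) := by rw [hm]; field_simp; ring
  -- Quadratic interpolation is exact on the secant line, whose slope is `m`. The end values of the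
  -- remainder vanish, so only its mean `E` is felt, through the derivative of `6t (1 - t)`. As `|6
  -- - 12t| ≤ 6`, the total is `J + 6J`.
  have e : ψ x - (φ a * (6 * t - 4) + φ b * (6 * t - 2) +
      ((b - a)⁻¹ * ∫ s in a..b, φ s) * (6 - 12 * t)) / (b - a) =
      (ψ x - m) - (6 - 12 * t) * (E / (b - a)) := by
    rw [hE2, hb]
    field_simp
    ring
  have t0 : 0 ≤ t := by rw [ht]; exact div_nonneg (by linarith [hx.1]) hh.le
  have t1 : t ≤ 1 := by rw [ht]; exact (div_le_one hh).2 (by linarith [hx.2])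
  have hE3 : |E / (b - a)| ≤ J := by
    rw [abs_div, abs_of_pos hh, div_le_iff₀ hh]; exact hE1
  rw [e]
  refine (abs_sub _ _).trans ?_
  rw [abs_mul]
  have := mul_le_mul (abs_le.2 ⟨by linarith, by linarith⟩ : |6 - 12 * t| ≤ 6) hE3
    (abs_nonneg _) (by norm_num)
  linarith [hψm x hx]

theorem ltwo_sub_normalPolyDeriv_le (i : Fin n) (hf : ContDiff ℝ ∞ f) :
    ltwo (boxProb K) (fun x => partialDeriv i f x -
      normalPolyDeriv K i (sideAvg K i f) (∫ y, f y ∂boxProb K) x) ≤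
      7 * ∑ k, boxLen K k * ltwo (boxProb K) (partialDeriv k (partialDeriv i f)) := by
  have hps := contDiff_partialDeriv hf i
  have hp := (contDiff_partialDeriv hps i).continuous
  have hC := continuous_chordIntegral (K := K) hp i
  have hr := continuous_refCoord (K := K) i
  have hc := fun s => hf.continuous.comp
    (continuous_id.update i (continuous_const (y := boxEnd K i s)) : Continuous
      fun x : Fin n → ℝ => Function.update x i (boxEnd K i s))
  have ha := continuous_coordAvg (K := K) hf.continuous {i}
  have e := fun x => coordAvg_compl_singleton_comp (K := K) (i := i)
    ![fun t => (6 * t - 4) / boxLen K i, fun t => (6 * t - 2) / boxLen K i,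
      fun t => (6 - 12 * t) / boxLen K i] hf.continuous x
  simp only [Matrix.cons_val_zero, Matrix.cons_val_one, Matrix.cons_val] at e
  simp only [normalPolyDeriv, add_div, mul_div_assoc, ← e]
  refine (ltwo_sub_coordAvg_le_add hps
    (G := fun x => 7 * chordIntegral K i (partialDeriv i (partialDeriv i f)) x)
    ?_ (continuous_const.mul hC) (fun x hx => ?_) _).trans ?_
  · simp only [Function.comp_def] at hc
    have h1 := hc false
    have h2 := hc true
    fun_prop
  -- On each chord the oscillation of `∂_i f` is at most the chord integral of `∂_i ∂_i f`.
  · have := abs_deriv_sub_quadratic_le (K.lower_lt_upper i)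
      (φ := fun t => f (Function.update x i t))
      (ψ := fun t => partialDeriv i f (Function.update x i t))
      (J := chordIntegral K i (partialDeriv i (partialDeriv i f)) x)
      (x := x i) (t := refCoord K i x)
      (fun t => hasDerivAt_update_line hf i x t)
      (fun s hs t ht => abs_sub_le_chordIntegral hps x ht hs) (mem_boxIcc.1 hx i) rfl
    rw [Function.update_eq_self] at this
    rw [coordAvg_singleton hf.continuous, integral_edgeProb]
    refine le_trans (le_of_eq ?_) this
    simp only [boxEnd, boxLen, if_true, if_false, Bool.false_eq_true]
    ring_nf
  · rw [ltwo_const_mul, ← Finset.sum_compl_add_sum {i} fun k =>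
      boxLen K k * ltwo (boxProb K) (partialDeriv k (partialDeriv i f)), Finset.sum_singleton]
    have b1 := ltwo_chordIntegral_le (K := K) hp i
    have b2 : 0 ≤ ∑ k ∈ ({i} : Finset (Fin n))ᶜ,
        boxLen K k * ltwo (boxProb K) (partialDeriv k (partialDeriv i f)) :=
      Finset.sum_nonneg fun k _ => mul_nonneg (boxLen_pos K k).le (ltwo_nonneg _ _)
    rw [abs_of_pos (by norm_num : (0 : ℝ) < 7)]
    linarith

/-- Trace inequality on a face of codimension two. -/
theorem ltwo_faceProb_pair_le {i j : Fin n} (hij : i ≠ j) (hf : ContDiff ℝ ∞ f) (s t : Bool) :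
    ltwo (faceProb K {i, j} (fun k => if k = i then s else t)) f ≤
      ltwo (boxProb K) f + boxLen K i * ltwo (boxProb K) (partialDeriv i f) +
      boxLen K j * (ltwo (boxProb K) (partialDeriv j f) +
        boxLen K i * ltwo (boxProb K) (partialDeriv i (partialDeriv j f))) := by
  rw [ltwo_faceProb _ _ hf.continuous]
  simp only [piecewise_pair hij]
  set χ := fun y => f (Function.update y i (boxEnd K i s)) with hχ
  have hχs : ContDiff ℝ ∞ χ := hf.comp (contDiff_update_const i _)
  have h1 := ltwo_comp_update_le (K := K) hχs j (boxEnd_mem_Icc j t)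
  have h2 := ltwo_comp_update_le (K := K) hf i (boxEnd_mem_Icc i s)
  have h3 := ltwo_comp_update_le (K := K) (contDiff_partialDeriv hf j) i (boxEnd_mem_Icc i s)
  have e : (fun y => partialDeriv j f (Function.update y i (boxEnd K i s))) = partialDeriv j χ := by
    ext y
    exact (partialDeriv_comp_update hf hij.symm _ y).symm
  rw [e] at h3
  have h4 := mul_le_mul_of_nonneg_left h3 (boxLen_pos K j).le
  have e5 : ∀ y, χ (Function.update y j (boxEnd K j t)) =
      f (Function.update (Function.update y i (boxEnd K i s)) j (boxEnd K j t)) := fun y => by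
    rw [hχ, Function.update_comm hij]
  simp only [e5] at h1
  linarith

theorem ltwo_faceProb_singleton_le (i : Fin n) (hf : ContDiff ℝ ∞ f) (b : Bool) :
    ltwo (faceProb K {i} (fun _ => b)) f ≤
      ltwo (boxProb K) f + boxLen K i * ltwo (boxProb K) (partialDeriv i f) := by
  rw [ltwo_faceProb _ _ hf.continuous]
  simp only [Finset.piecewise_singleton]
  exact ltwo_comp_update_le hf i (boxEnd_mem_Icc i b)

end SmoothInterpolation

/-! ### Traces -/

section Traces

variable {n : ℕ} {K : BoxIntegral.Box (Fin n)} {u : (Fin n → ℝ) → ℝ}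
  {g : Fin n → (Fin n → ℝ) → ℝ} {H : Fin n → Fin n → (Fin n → ℝ) → ℝ}

/-- The `H²` norm of a smooth function, as a sum of `L²` norms. -/
noncomputable def smoothNorm (μ : Measure (Fin n → ℝ)) (ψ : (Fin n → ℝ) → ℝ) : ℝ :=
  ltwo μ ψ + (∑ i, ltwo μ (partialDeriv i ψ) +
    ∑ i, ∑ j, ltwo μ (partialDeriv j (partialDeriv i ψ)))

/-- The `H²` distance of `u`, with weak derivatives `g` and `H`, from a smooth function. -/
noncomputable def smoothDist (μ : Measure (Fin n → ℝ)) (u : (Fin n → ℝ) → ℝ)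
    (g : Fin n → (Fin n → ℝ) → ℝ) (H : Fin n → Fin n → (Fin n → ℝ) → ℝ)
    (φ : (Fin n → ℝ) → ℝ) : ℝ :=
  ltwo μ (fun x => u x - φ x) + (∑ i, ltwo μ (fun x => g i x - partialDeriv i φ x) +
    ∑ i, ∑ j, ltwo μ (fun x => H i j x - partialDeriv j (partialDeriv i φ) x))

theorem ltwo_boxProb_eq (K : BoxIntegral.Box (Fin n)) (f : (Fin n → ℝ) → ℝ) : ltwo (boxProb K) f =
    (Real.sqrt (∏ k, boxLen K k))⁻¹ * ltwo (volume.restrict (BoxIntegral.Box.Ioo K)) f := by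
  rw [ltwo_volume_boxIoo, inv_mul_cancel_left₀]
  exact (Real.sqrt_pos.2 (Finset.prod_pos fun k _ => boxLen_pos K k)).ne'

theorem TendstoHTwo.tendsto_boxProb {φ : ℕ → (Fin n → ℝ) → ℝ}
    (h : TendstoHTwo (BoxIntegral.Box.Ioo K) φ u g H) :
    Tendsto (fun m => ltwo (boxProb K) (fun x => u x - φ m x)) atTop (𝓝 0) ∧
    (∀ i, Tendsto (fun m => ltwo (boxProb K)
      (fun x => g i x - partialDeriv i (φ m) x)) atTop (𝓝 0)) ∧
    ∀ i j, Tendsto (fun m => ltwo (boxProb K)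
      (fun x => H i j x - partialDeriv j (partialDeriv i (φ m)) x)) atTop (𝓝 0) := by
  simp only [ltwo_boxProb_eq K]
  refine ⟨?_, fun i => ?_, fun i j => ?_⟩
  · simpa only [mul_zero] using h.1.const_mul _
  · simpa only [mul_zero] using (h.2.1 i).const_mul _
  · simpa only [mul_zero] using (h.2.2 i j).const_mul _

theorem TendstoHTwo.tendsto_smoothDist {φ : ℕ → (Fin n → ℝ) → ℝ}
    (h : TendstoHTwo (BoxIntegral.Box.Ioo K) φ u g H) :
    Tendsto (fun m => smoothDist (boxProb K) u g H (φ m)) atTop (𝓝 0) := by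
  obtain ⟨h1, h2, h3⟩ := h.tendsto_boxProb
  have := h1.add ((tendsto_finsetSum Finset.univ fun i _ => h2 i).add
    (tendsto_finsetSum Finset.univ fun i _ => tendsto_finsetSum Finset.univ fun j _ => h3 i j))
  simpa [smoothDist] using this

theorem ltwo_sub_le_of_memLp {X : Type*} [MeasurableSpace X] {μ : Measure X} {f v w : X → ℝ}
    (hf : MemLp f 2 μ) (hv : MemLp v 2 μ) (hw : MemLp w 2 μ) :
    ltwo μ (fun x => v x - w x) ≤ ltwo μ (fun x => f x - v x) + ltwo μ (fun x => f x - w x) := by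
  rw [ltwo_sub_comm f v]
  refine le_trans (le_of_eq ?_) (ltwo_add_le (hv.sub hf) (hf.sub hw))
  congr 1
  ext x
  simp

theorem HTwo.memLp_boxProb (h : HTwo (BoxIntegral.Box.Ioo K) u g H) : MemLp u 2 (boxProb K) ∧
    (∀ i, MemLp (g i) 2 (boxProb K)) ∧ ∀ i j, MemLp (H i j) 2 (boxProb K) :=
  ⟨(memLp_boxProb_iff K).2 h.memLp, fun i => (memLp_boxProb_iff K).2 (h.memLp_fst i),
    fun i j => (memLp_boxProb_iff K).2 (h.memLp_snd i j)⟩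

theorem smoothNorm_sub_le (h : HTwo (BoxIntegral.Box.Ioo K) u g H) {φ ψ : (Fin n → ℝ) → ℝ}
    (hφ : ContDiff ℝ ∞ φ) (hψ : ContDiff ℝ ∞ ψ) :
    smoothNorm (boxProb K) (fun x => φ x - ψ x) ≤
      smoothDist (boxProb K) u g H φ + smoothDist (boxProb K) u g H ψ := by
  obtain ⟨m1, m2, m3⟩ := h.memLp_boxProb
  have d1 := fun i => contDiff_partialDeriv hφ i
  have d2 := fun i => contDiff_partialDeriv hψ i
  have e1 : ∀ i, partialDeriv i (fun x => φ x - ψ x) =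
      fun x => partialDeriv i φ x - partialDeriv i ψ x := fun i => by
    ext x; exact partialDeriv_sub hφ hψ i x
  have e2 : ∀ i j, partialDeriv j (fun x => partialDeriv i φ x - partialDeriv i ψ x) =
      fun x => partialDeriv j (partialDeriv i φ) x - partialDeriv j (partialDeriv i ψ) x :=
    fun i j => by ext x; exact partialDeriv_sub (d1 i) (d2 i) j x
  simp only [smoothNorm, smoothDist, e1, e2]
  have b1 := ltwo_sub_le_of_memLp m1 (hφ.continuous.memLp_boxProb (K := K))
    (hψ.continuous.memLp_boxProb (K := K))
  have b2 : ∑ i, ltwo (boxProb K) (fun x => partialDeriv i φ x - partialDeriv i ψ x) ≤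
      ∑ i, (ltwo (boxProb K) (fun x => g i x - partialDeriv i φ x) +
        ltwo (boxProb K) (fun x => g i x - partialDeriv i ψ x)) :=
    Finset.sum_le_sum fun i _ => ltwo_sub_le_of_memLp (m2 i) (d1 i).continuous.memLp_boxProb
      (d2 i).continuous.memLp_boxProb
  have b3 : ∑ i, ∑ j, ltwo (boxProb K)
      (fun x => partialDeriv j (partialDeriv i φ) x - partialDeriv j (partialDeriv i ψ) x) ≤
      ∑ i, ∑ j, (ltwo (boxProb K) (fun x => H i j x - partialDeriv j (partialDeriv i φ) x) +
        ltwo (boxProb K) (fun x => H i j x - partialDeriv j (partialDeriv i ψ) x)) :=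
    Finset.sum_le_sum fun i _ => Finset.sum_le_sum fun j _ => ltwo_sub_le_of_memLp (m3 i j)
      (contDiff_partialDeriv (d1 i) j).continuous.memLp_boxProb
      (contDiff_partialDeriv (d2 i) j).continuous.memLp_boxProb
  simp only [Finset.sum_add_distrib] at b2 b3
  linarith

variable (K) in
/-- The faces on which smooth functions satisfy the trace inequality. -/
def HasTraceBound (S : Finset (Fin n)) (c : Fin n → Bool) : Prop :=
  ∃ C : ℝ, 0 ≤ C ∧ ∀ ψ, ContDiff ℝ ∞ ψ → ltwo (faceProb K S c) ψ ≤ C * smoothNorm (boxProb K) ψ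

theorem ltwo_le_smoothNorm (μ : Measure (Fin n → ℝ)) (ψ : (Fin n → ℝ) → ℝ) :
    ltwo μ ψ ≤ smoothNorm μ ψ ∧ (∀ i, ltwo μ (partialDeriv i ψ) ≤ smoothNorm μ ψ) ∧
      ∀ i j, ltwo μ (partialDeriv j (partialDeriv i ψ)) ≤ smoothNorm μ ψ := by
  have p0 : ∀ f : (Fin n → ℝ) → ℝ, 0 ≤ ltwo μ f := fun f => ltwo_nonneg _ _
  have p1 : ∀ F : Fin n → (Fin n → ℝ) → ℝ, 0 ≤ ∑ i, ltwo μ (F i) :=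
    fun F => Finset.sum_nonneg fun i _ => p0 _
  have p2 : 0 ≤ ∑ i, ∑ j, ltwo μ (partialDeriv j (partialDeriv i ψ)) :=
    Finset.sum_nonneg fun i _ => p1 _
  have p3 := p1 (fun i => partialDeriv i ψ)
  have p4 := p0 ψ
  refine ⟨?_, fun i => ?_, fun i j => ?_⟩
  · unfold smoothNorm; linarith
  · have := Finset.single_le_sum (f := fun i => ltwo μ (partialDeriv i ψ)) (fun i _ => p0 _)
      (Finset.mem_univ i)
    unfold smoothNorm; linarith
  · have h1 := Finset.single_le_sum (f := fun j => ltwo μ (partialDeriv j (partialDeriv i ψ)))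
      (fun i _ => p0 _) (Finset.mem_univ j)
    have h2 := Finset.single_le_sum (f := fun i => ∑ j, ltwo μ (partialDeriv j (partialDeriv i ψ)))
      (fun i _ => p1 _) (Finset.mem_univ i)
    unfold smoothNorm; linarith

/-- The constant depends on the box. This is harmless: the bound serves only the existence of traces
and the uniqueness of their means, never the error estimates. -/
theorem hasTraceBound_pair {i j : Fin n} (hij : i ≠ j) (s t : Bool) :
    HasTraceBound K {i, j} (fun k => if k = i then s else t) := by
  have hi := boxLen_pos K i
  have hj := boxLen_pos K j
  refine ⟨1 + boxLen K i + boxLen K j + boxLen K j * boxLen K i, by positivity, fun ψ hψ => ?_⟩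
  obtain ⟨h1, h2, h3⟩ := ltwo_le_smoothNorm (boxProb K) ψ
  refine (ltwo_faceProb_pair_le hij hψ s t).trans ?_
  have b1 := mul_le_mul_of_nonneg_left (h2 i) hi.le
  have b2 := mul_le_mul_of_nonneg_left (h2 j) hj.le
  have b3 := mul_le_mul_of_nonneg_left (h3 j i) (mul_pos hj hi).le
  nlinarith [h1]

theorem hasTraceBound_singleton (i : Fin n) (b : Bool) :
    HasTraceBound K {i} (fun _ => b) := by
  have hi := boxLen_pos K i
  refine ⟨1 + boxLen K i, by positivity, fun ψ hψ => ?_⟩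
  obtain ⟨h1, h2, h3⟩ := ltwo_le_smoothNorm (boxProb K) ψ
  refine (ltwo_faceProb_singleton_le i hψ b).trans ?_
  have b1 := mul_le_mul_of_nonneg_left (h2 i) hi.le
  linarith

variable (K) in
/-- The measure of a face. -/
noncomputable def faceVol (S : Finset (Fin n)) : ENNReal :=
  ∏ k, if k ∈ S then 1 else ENNReal.ofReal (boxLen K k)

theorem faceVol_ne_zero (S : Finset (Fin n)) : faceVol K S ≠ 0 :=
  Finset.prod_ne_zero_iff.2 fun k _ => by
    split_ifs
    · exact one_ne_zero
    · exact (ENNReal.ofReal_pos.2 (boxLen_pos K k)).ne'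

theorem faceVol_ne_top (S : Finset (Fin n)) : faceVol K S ≠ ⊤ :=
  ENNReal.prod_ne_top fun k _ => by split_ifs <;> simp

theorem faceVol_toReal_pos (S : Finset (Fin n)) : 0 < (faceVol K S).toReal :=
  ENNReal.toReal_pos (faceVol_ne_zero S) (faceVol_ne_top S)

theorem integral_faceMeasure (S : Finset (Fin n)) (c : Fin n → Bool) (f : (Fin n → ℝ) → ℝ) :
    ∫ x, f x ∂faceMeasure K S c = (faceVol K S).toReal * ∫ x, f x ∂faceProb K S c := by
  rw [faceMeasure_eq, integral_smul_measure]
  rfl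

theorem average_faceMeasure (S : Finset (Fin n)) (c : Fin n → Bool) (f : (Fin n → ℝ) → ℝ) :
    ⨍ x, f x ∂faceMeasure K S c = ∫ x, f x ∂faceProb K S c := by
  rw [average_eq, integral_faceMeasure]
  have : (faceMeasure K S c).real Set.univ = (faceVol K S).toReal := by
    rw [faceMeasure_eq, measureReal_def, Measure.smul_apply, measure_univ, smul_eq_mul, mul_one]
    rfl
  rw [this, smul_eq_mul, inv_mul_cancel_left₀ (faceVol_toReal_pos S).ne']

theorem memLp_faceMeasure_iff {S : Finset (Fin n)} {c : Fin n → Bool} {f : (Fin n → ℝ) → ℝ} :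
    MemLp f 2 (faceMeasure K S c) ↔ MemLp f 2 (faceProb K S c) := by
  have h1 : faceMeasure K S c = faceVol K S • faceProb K S c := faceMeasure_eq K S c
  have h2 : faceProb K S c = (faceVol K S)⁻¹ • faceMeasure K S c := by
    rw [h1, smul_smul, ENNReal.inv_mul_cancel (faceVol_ne_zero S) (faceVol_ne_top S), one_smul]
  constructor
  · intro h
    rw [h2]
    exact h.smul_measure (ENNReal.inv_ne_top.2 (faceVol_ne_zero S))
  · intro h
    rw [h1]
    exact h.smul_measure (faceVol_ne_top S)

theorem HTwo.hasTrace_iff (h : HTwo (BoxIntegral.Box.Ioo K) u g H) {S : Finset (Fin n)}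
    {c : Fin n → Bool} {w : (Fin n → ℝ) → ℝ} : HasTrace K S c u w ↔
      MemLp w 2 (faceProb K S c) ∧ ∃ φ : ℕ → (Fin n → ℝ) → ℝ, (∀ m, ContDiff ℝ ∞ (φ m)) ∧
        TendstoHTwo (BoxIntegral.Box.Ioo K) φ u g H ∧
        Tendsto (fun m => ltwo (faceProb K S c) (fun x => w x - φ m x)) atTop (𝓝 0) := by
  have key : ∀ (_ : MemLp w 2 (faceProb K S c)) (φ : ℕ → (Fin n → ℝ) → ℝ)
      (_ : ∀ m, ContDiff ℝ ∞ (φ m)),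
      Tendsto (fun m => ∫ x, (w x - φ m x) ^ 2 ∂(faceMeasure K S c)) atTop (𝓝 0) ↔
      Tendsto (fun m => ltwo (faceProb K S c) (fun x => w x - φ m x)) atTop (𝓝 0) := by
    intro hw φ hφ
    rw [tendsto_ltwo_iff (F := fun m x => w x - φ m x) fun m => hw.sub ((hφ m).continuous.memLp_faceProb S c)]
    simp only [integral_faceMeasure]
    have hp := faceVol_toReal_pos (K := K) S
    constructor
    · intro ht
      have := ht.const_mul (faceVol K S).toReal⁻¹
      simpa only [mul_zero, inv_mul_cancel_left₀ hp.ne'] using this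
    · intro ht
      simpa only [mul_zero] using ht.const_mul (faceVol K S).toReal
  constructor
  · rintro ⟨-, h2, φ, hφ, h3, h4⟩
    rw [memLp_faceMeasure_iff] at h2
    exact ⟨h2, φ, hφ, (tendstoHTwo_iff (isOpen_boxIoo K) K.isCompact_Icc K.Ioo_subset_Icc h hφ).2 h3,
      (key h2 φ hφ).1 h4⟩
  · rintro ⟨h2, φ, hφ, h3, h4⟩
    exact ⟨memSobolev_two_iff.2 ⟨g, H, h⟩, memLp_faceMeasure_iff.2 h2, φ, hφ,
      (tendstoHTwo_iff (isOpen_boxIoo K) K.isCompact_Icc K.Ioo_subset_Icc h hφ).1 h3,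
      (key h2 φ hφ).2 h4⟩

/-- Completeness of `L²`. The hypothesis has the form in which the triangle inequality through a
common limit in `H²` delivers it. -/
theorem exists_tendsto_ltwo_of_cauchy {X : Type*} [MeasurableSpace X] {μ : Measure X}
    {F : ℕ → X → ℝ} (hF : ∀ m, MemLp (F m) 2 μ) {b : ℕ → ℝ} (hb : Tendsto b atTop (𝓝 0))
    (h : ∀ m l, ltwo μ (fun x => F m x - F l x) ≤ b m + b l) :
    ∃ w, MemLp w 2 μ ∧ Tendsto (fun m => ltwo μ (fun x => w x - F m x)) atTop (𝓝 0) := by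
  have hd : ∀ m l, dist ((hF m).toLp) ((hF l).toLp) = ltwo μ (fun x => F m x - F l x) := by
    intro m l
    rw [Lp.dist_def, ltwo]
    congr 1
    refine eLpNorm_congr_ae ?_
    filter_upwards [(hF m).coeFn_toLp, (hF l).coeFn_toLp] with x h1 h2
    simp [h1, h2]
  have hc : CauchySeq fun m => (hF m).toLp := by
    rw [Metric.cauchySeq_iff']
    intro ε hε
    have he : ∀ᶠ m in atTop, b m < ε / 2 := hb.eventually_lt_const (by positivity)
    obtain ⟨N, hN⟩ := eventually_atTop.1 he
    refine ⟨N, fun m hm => ?_⟩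
    rw [hd]
    linarith [h m N, hN m hm, hN N le_rfl]
  obtain ⟨W, hW⟩ := cauchySeq_tendsto_of_complete hc
  refine ⟨W, Lp.memLp W, ?_⟩
  rw [tendsto_iff_dist_tendsto_zero] at hW
  refine hW.congr fun m => ?_
  rw [dist_comm, Lp.dist_def, ltwo]
  congr 1
  refine eLpNorm_congr_ae ?_
  filter_upwards [(hF m).coeFn_toLp] with x h1
  simp [h1]

/-- By the trace bound, restrictions to the face of a smooth sequence converging in `H²` form a
Cauchy sequence in `L²` of the face. -/
theorem HTwo.exists_hasTrace (h : HTwo (BoxIntegral.Box.Ioo K) u g H) {S : Finset (Fin n)}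
    {c : Fin n → Bool} (hb : HasTraceBound K S c) : ∃ w, HasTrace K S c u w := by
  obtain ⟨φ, hφ, hφu⟩ := h.exists_tendstoHTwo
  obtain ⟨C, hC, hCb⟩ := hb
  have ht : Tendsto (fun m => C * smoothDist (boxProb K) u g H (φ m)) atTop (𝓝 0) := by
    simpa using hφu.tendsto_smoothDist.const_mul C
  obtain ⟨w, hw, hwt⟩ := exists_tendsto_ltwo_of_cauchy (μ := faceProb K S c)
    (fun m => (hφ m).continuous.memLp_faceProb S c) ht fun m l => by
      rw [← mul_add]
      exact (hCb _ ((hφ m).sub (hφ l))).trans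
        (mul_le_mul_of_nonneg_left (smoothNorm_sub_le h (hφ m) (hφ l)) hC)
  exact ⟨w, h.hasTrace_iff.2 ⟨hw, φ, hφ, hφu, hwt⟩⟩

theorem abs_integral_le_ltwo {X : Type*} [MeasurableSpace X] {μ : Measure X}
    [IsProbabilityMeasure μ] {f : X → ℝ} (hf : MemLp f 2 μ) : |∫ x, f x ∂μ| ≤ ltwo μ f := by
  have h := enorm_integral_sq_le hf.1
  rw [← eLpNorm_two_sq, ENNReal.pow_le_pow_left_iff two_ne_zero] at h
  rw [← Real.norm_eq_abs, ← toReal_enorm]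
  exact ENNReal.toReal_mono hf.2.ne h

theorem tendsto_integral_of_tendsto_ltwo {X : Type*} [MeasurableSpace X] {μ : Measure X}
    [IsProbabilityMeasure μ] {w : X → ℝ} {F : ℕ → X → ℝ} (hw : MemLp w 2 μ)
    (hF : ∀ m, MemLp (F m) 2 μ)
    (h : Tendsto (fun m => ltwo μ (fun x => w x - F m x)) atTop (𝓝 0)) :
    Tendsto (fun m => ∫ x, F m x ∂μ) atTop (𝓝 (∫ x, w x ∂μ)) := by
  rw [tendsto_iff_dist_tendsto_zero]
  refine squeeze_zero (fun m => dist_nonneg) (fun m => ?_) h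
  rw [dist_comm, Real.dist_eq, ← integral_sub (hw.integrable (by norm_num))
    ((hF m).integrable (by norm_num))]
  exact abs_integral_le_ltwo (hw.sub (hF m))

/-- The sequence that defines the trace may be replaced by any other one: two smooth sequences with
the same limit in `H²` come together on the face, by the trace bound. This freedom allows one
sequence to be used for all faces and for two cells at once. -/
theorem HTwo.tendsto_integral_faceProb (h : HTwo (BoxIntegral.Box.Ioo K) u g H)
    {S : Finset (Fin n)} {c : Fin n → Bool} (hb : HasTraceBound K S c) {w : (Fin n → ℝ) → ℝ}
    (hw : HasTrace K S c u w) {φ : ℕ → (Fin n → ℝ) → ℝ} (hφ : ∀ m, ContDiff ℝ ∞ (φ m))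
    (hφu : TendstoHTwo (BoxIntegral.Box.Ioo K) φ u g H) :
    Tendsto (fun m => ∫ x, φ m x ∂faceProb K S c) atTop (𝓝 (∫ x, w x ∂faceProb K S c)) := by
  obtain ⟨hw2, φ', hφ', hφu', hwt⟩ := h.hasTrace_iff.1 hw
  obtain ⟨C, hC, hCb⟩ := hb
  have mm := fun m => (hφ m).continuous.memLp_faceProb (K := K) S c
  have mm' := fun m => (hφ' m).continuous.memLp_faceProb (K := K) S c
  refine tendsto_integral_of_tendsto_ltwo hw2 mm ?_
  have ht : Tendsto (fun m => ltwo (faceProb K S c) (fun x => w x - φ' m x) +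
      C * (smoothDist (boxProb K) u g H (φ' m) + smoothDist (boxProb K) u g H (φ m)))
      atTop (𝓝 0) := by
    simpa using hwt.add ((hφu'.tendsto_smoothDist.add hφu.tendsto_smoothDist).const_mul C)
  refine squeeze_zero (fun m => ltwo_nonneg _ _) (fun m => ?_) ht
  have e : (fun x => w x - φ m x) = fun x => (w x - φ' m x) + (φ' m x - φ m x) := by ext x; ring
  rw [e]
  refine (ltwo_add_le (hw2.sub (mm' m)) ((mm' m).sub (mm m))).trans (add_le_add le_rfl ?_)
  exact (hCb _ ((hφ' m).sub (hφ m))).trans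
        (mul_le_mul_of_nonneg_left (smoothNorm_sub_le h (hφ' m) (hφ m)) hC)

open Classical in
variable (K) in
/-- The average of the trace of `u` over a face (`0` if there is no trace). -/
noncomputable def traceMean (S : Finset (Fin n)) (c : Fin n → Bool) (u : (Fin n → ℝ) → ℝ) : ℝ :=
  if h : ∃ w, HasTrace K S c u w then ∫ x, h.choose x ∂faceProb K S c else 0

theorem HTwo.tendsto_traceMean (h : HTwo (BoxIntegral.Box.Ioo K) u g H)
    {S : Finset (Fin n)} {c : Fin n → Bool} (hb : HasTraceBound K S c)
    {φ : ℕ → (Fin n → ℝ) → ℝ} (hφ : ∀ m, ContDiff ℝ ∞ (φ m))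
    (hφu : TendstoHTwo (BoxIntegral.Box.Ioo K) φ u g H) :
    Tendsto (fun m => ∫ x, φ m x ∂faceProb K S c) atTop (𝓝 (traceMean K S c u)) := by
  have he := h.exists_hasTrace hb
  rw [traceMean, dif_pos he]
  exact h.tendsto_integral_faceProb hb he.choose_spec hφ hφu

/-- Consequently the choice of a trace in `IsNormalInterp` and `IsShearInterp` does not affect the
interpolation conditions. -/
theorem HTwo.integral_trace_eq (h : HTwo (BoxIntegral.Box.Ioo K) u g H)
    {S : Finset (Fin n)} {c : Fin n → Bool} (hb : HasTraceBound K S c) {w : (Fin n → ℝ) → ℝ}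
    (hw : HasTrace K S c u w) : ∫ x, w x ∂faceProb K S c = traceMean K S c u := by
  obtain ⟨φ, hφ, hφu⟩ := h.exists_tendstoHTwo
  exact tendsto_nhds_unique (h.tendsto_integral_faceProb hb hw hφ hφu)
    (h.tendsto_traceMean hb hφ hφu)

end Traces

/-! ### Interpolation of `H²` functions on a box -/

section LocalInterpolation

variable {n : ℕ} {K : BoxIntegral.Box (Fin n)} {u : (Fin n → ℝ) → ℝ}
  {g : Fin n → (Fin n → ℝ) → ℝ} {H : Fin n → Fin n → (Fin n → ℝ) → ℝ}

/-- Uniform stability in the coefficients: as face means of smooth approximations converge, so do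
their interpolants. The three lemmas after it play the same role. -/
theorem abs_shearPoly_sub_le (i j : Fin n) (A B : Bool → Bool → ℝ) {x : Fin n → ℝ}
    (hx : x ∈ BoxIntegral.Box.Icc K) :
    |shearPoly K i j A x - shearPoly K i j B x| ≤ ∑ s, ∑ t, |A s t - B s t| := by
  simp only [shearPoly, ← Finset.sum_sub_distrib, ← sub_mul]
  refine (Finset.abs_sum_le_sum_abs _ _).trans (Finset.sum_le_sum fun s _ => ?_)
  refine (Finset.abs_sum_le_sum_abs _ _).trans (Finset.sum_le_sum fun t _ => ?_)
  have h0 : ∀ (k : Fin n) b, 0 ≤ nodalFun b (refCoord K k x) ∧ nodalFun b (refCoord K k x) ≤ 1 := by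
    intro k b
    refine ⟨nodalFun_nonneg (refCoord_mem hx k) b, ?_⟩
    have := refCoord_mem hx k
    cases b <;> simp [nodalFun, this.1, this.2]
  rw [abs_mul, abs_of_nonneg (mul_nonneg (h0 i s).1 (h0 j t).1)]
  exact mul_le_of_le_one_right (abs_nonneg _) (mul_le_one₀ (h0 i s).2 (h0 j t).1 (h0 j t).2)

theorem abs_shearPolyDeriv_sub_le (i j : Fin n) (A B : Bool → Bool → ℝ) {x : Fin n → ℝ}
    (hx : x ∈ BoxIntegral.Box.Icc K) :
    |shearPolyDeriv K i j A x - shearPolyDeriv K i j B x| ≤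
      ∑ s, |(A s true - A s false) / boxLen K j - (B s true - B s false) / boxLen K j| := by
  simp only [shearPolyDeriv, ← Finset.sum_sub_distrib, ← sub_mul]
  refine (Finset.abs_sum_le_sum_abs _ _).trans (Finset.sum_le_sum fun s _ => ?_)
  have h0 := nodalFun_nonneg (refCoord_mem hx i) s
  have h1 : nodalFun s (refCoord K i x) ≤ 1 := by
    have := refCoord_mem hx i
    cases s <;> simp [nodalFun, this.1, this.2]
  rw [abs_mul, abs_of_nonneg h0]
  exact mul_le_of_le_one_right (abs_nonneg _) h1

theorem abs_normalPoly_sub_le (i : Fin n) (A B : Bool → ℝ) (M N : ℝ) {x : Fin n → ℝ}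
    (hx : x ∈ BoxIntegral.Box.Icc K) :
    |normalPoly K i A M x - normalPoly K i B N x| ≤
      |A false - B false| + |A true - B true| + |M - N| * 3 := by
  obtain ⟨t0, t1⟩ := refCoord_mem hx i
  unfold normalPoly
  set t := refCoord K i x
  have q0 : |(1 - t) * (1 - 3 * t)| ≤ 1 := abs_le.2 ⟨by nlinarith, by nlinarith⟩
  have q1 : |t * (3 * t - 2)| ≤ 1 := abs_le.2 ⟨by nlinarith, by nlinarith⟩
  have q2 : |6 * t * (1 - t)| ≤ 3 := abs_le.2 ⟨by nlinarith, by nlinarith [sq_nonneg (t - 1 / 2)]⟩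
  have e : A false * ((1 - t) * (1 - 3 * t)) + A true * (t * (3 * t - 2)) + M * (6 * t * (1 - t)) -
      (B false * ((1 - t) * (1 - 3 * t)) + B true * (t * (3 * t - 2)) + N * (6 * t * (1 - t))) =
      (A false - B false) * ((1 - t) * (1 - 3 * t)) + (A true - B true) * (t * (3 * t - 2)) +
      (M - N) * (6 * t * (1 - t)) := by ring
  rw [e]
  refine (abs_add_three _ _ _).trans ?_
  rw [abs_mul (A false - _), abs_mul (A true - _), abs_mul (M - N)]
  exact add_le_add (add_le_add (mul_le_of_le_one_right (abs_nonneg _) q0)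
    (mul_le_of_le_one_right (abs_nonneg _) q1)) (mul_le_mul_of_nonneg_left q2 (abs_nonneg _))

theorem abs_normalPolyDeriv_sub_le (i : Fin n) (A B : Bool → ℝ) (M N : ℝ) {x : Fin n → ℝ}
    (hx : x ∈ BoxIntegral.Box.Icc K) :
    |normalPolyDeriv K i A M x - normalPolyDeriv K i B N x| ≤
      (|A false - B false| * 6 + |A true - B true| * 6 + |M - N| * 6) / boxLen K i := by
  obtain ⟨t0, t1⟩ := refCoord_mem hx i
  unfold normalPolyDeriv
  set t := refCoord K i x
  rw [← sub_div, abs_div, abs_of_pos (boxLen_pos K i)]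
  refine div_le_div_of_nonneg_right ?_ (boxLen_pos K i).le
  have e : A false * (6 * t - 4) + A true * (6 * t - 2) + M * (6 - 12 * t) -
      (B false * (6 * t - 4) + B true * (6 * t - 2) + N * (6 - 12 * t)) =
      (A false - B false) * (6 * t - 4) + (A true - B true) * (6 * t - 2) +
      (M - N) * (6 - 12 * t) := by ring
  rw [e]
  refine (abs_add_three _ _ _).trans ?_
  rw [abs_mul (A false - _), abs_mul (A true - _), abs_mul (M - N)]
  gcongr <;> exact abs_le.2 ⟨by linarith, by linarith⟩

/-- Passage to the limit in an interpolation estimate. -/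
theorem ltwo_sub_le_of_tendsto {v p : (Fin n → ℝ) → ℝ} {ψ q : ℕ → (Fin n → ℝ) → ℝ}
    {e R : ℕ → ℝ} {R' : ℝ} (hv : MemLp v 2 (boxProb K)) (hp : Continuous p)
    (hψ : ∀ m, Continuous (ψ m)) (hq : ∀ m, Continuous (q m))
    (h1 : Tendsto (fun m => ltwo (boxProb K) (fun x => v x - ψ m x)) atTop (𝓝 0))
    (h2 : ∀ m, ltwo (boxProb K) (fun x => ψ m x - q m x) ≤ R m) (hR : Tendsto R atTop (𝓝 R'))
    (h3 : ∀ m, ∀ x ∈ BoxIntegral.Box.Icc K, |q m x - p x| ≤ e m) (he : Tendsto e atTop (𝓝 0)) :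
    ltwo (boxProb K) (fun x => v x - p x) ≤ R' := by
  have ht : Tendsto (fun m => ltwo (boxProb K) (fun x => v x - ψ m x) + R m + |e m|) atTop
      (𝓝 (0 + R' + |0|)) := (h1.add hR).add he.abs
  rw [zero_add, abs_zero, add_zero] at ht
  refine ge_of_tendsto' ht fun m => ?_
  have hψm := (hψ m).memLp_boxProb (K := K)
  have hqm := (hq m).memLp_boxProb (K := K)
  have hpm := hp.memLp_boxProb (K := K)
  have e1 : (fun x => v x - p x) = fun x => ((v x - ψ m x) + (ψ m x - q m x)) + (q m x - p x) := by
    ext x; ring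
  have b3 : ltwo (boxProb K) (fun x => q m x - p x) ≤ |e m| := by
    refine (ltwo_le_of_abs_le (g := fun _ => e m) continuous_const (h3 m)).trans (le_of_eq ?_)
    rw [ltwo, eLpNorm_const _ (by norm_num) (IsProbabilityMeasure.ne_zero _)]
    simp
  rw [e1]
  refine (ltwo_add_le ((hv.sub hψm).add (hψm.sub hqm)) (hqm.sub hpm)).trans (add_le_add ?_ b3)
  exact (ltwo_add_le (hv.sub hψm) (hψm.sub hqm)).trans (add_le_add le_rfl (h2 m))

theorem tendsto_ltwo_of_tendsto_sub {v : (Fin n → ℝ) → ℝ} {ψ : ℕ → (Fin n → ℝ) → ℝ}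
    (hv : MemLp v 2 (boxProb K)) (hψ : ∀ m, Continuous (ψ m))
    (h : Tendsto (fun m => ltwo (boxProb K) (fun x => v x - ψ m x)) atTop (𝓝 0)) :
    Tendsto (fun m => ltwo (boxProb K) (ψ m)) atTop (𝓝 (ltwo (boxProb K) v)) := by
  rw [tendsto_iff_dist_tendsto_zero]
  refine squeeze_zero (fun m => dist_nonneg) (fun m => ?_) h
  have hψm := (hψ m).memLp_boxProb (K := K)
  have h1 := ltwo_add_le hψm (hv.sub hψm)
  have h2 := ltwo_sub_le hv (hv.sub hψm)
  simp only [Pi.sub_apply, add_sub_cancel, sub_sub_cancel] at h1 h2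
  rw [Real.dist_eq]
  refine abs_le.2 ⟨?_, ?_⟩
  · change ltwo (boxProb K) (fun x => v x) ≤ _ at h1
    have h1 : ltwo (boxProb K) v ≤ ltwo (boxProb K) (ψ m) +
      ltwo (boxProb K) (fun x => v x - ψ m x) := h1
    linarith
  · have h2 : ltwo (boxProb K) (ψ m) ≤ ltwo (boxProb K) v +
      ltwo (boxProb K) (fun x => v x - ψ m x) := h2
    linarith

variable (K) in
/-- The averages of the traces of `u` on the faces perpendicular to the axes `i` and `j`. -/
noncomputable def edgeTrace (i j : Fin n) (u : (Fin n → ℝ) → ℝ) (s t : Bool) : ℝ :=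
  traceMean K {i, j} (fun k => if k = i then s else t) u

variable (K) in
/-- The averages of the traces of `u` on the faces perpendicular to the axis `i`. -/
noncomputable def sideTrace (i : Fin n) (u : (Fin n → ℝ) → ℝ) (b : Bool) : ℝ :=
  traceMean K {i} (fun _ => b) u

theorem tendsto_sum_abs_sub {ι : Type*} [Fintype ι] {a : ℕ → ι → ℝ} {b : ι → ℝ}
    (h : ∀ k, Tendsto (fun m => a m k) atTop (𝓝 (b k))) :
    Tendsto (fun m => ∑ k, |a m k - b k|) atTop (𝓝 0) := by
  have := tendsto_finsetSum Finset.univ fun k _ => ((h k).sub_const (b k)).abs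
  simpa using this

theorem HTwo.ltwo_sub_shearPoly_le (h : HTwo (BoxIntegral.Box.Ioo K) u g H) {i j : Fin n}
    (hij : i ≠ j) :
    ltwo (boxProb K) (fun x => u x - shearPoly K i j (edgeTrace K i j u) x) ≤
      ∑ k, boxLen K k * ltwo (boxProb K) (g k) +
        boxLen K i * (boxLen K j * ltwo (boxProb K) (H i j)) := by
  obtain ⟨φ, hφ, hφu⟩ := h.exists_tendstoHTwo
  obtain ⟨m1, m2, m3⟩ := h.memLp_boxProb
  obtain ⟨t1, t2, t3⟩ := hφu.tendsto_boxProb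
  have hA : ∀ s t, Tendsto (fun m => edgeAvg K i j (φ m) s t) atTop (𝓝 (edgeTrace K i j u s t)) :=
    fun s t => h.tendsto_traceMean (hasTraceBound_pair hij s t) hφ hφu
  refine ltwo_sub_le_of_tendsto m1 (continuous_shearPoly i j _) (fun m => (hφ m).continuous)
    (fun m => continuous_shearPoly i j (edgeAvg K i j (φ m))) t1
    (fun m => _root_.ltwo_sub_shearPoly_le hij (hφ m)) ?_
    (fun m x hx => abs_shearPoly_sub_le i j _ _ hx) ?_
  · refine (tendsto_finsetSum _ fun k _ => (tendsto_ltwo_of_tendsto_sub (m2 k)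
      (fun m => (contDiff_partialDeriv (hφ m) k).continuous) (t2 k)).const_mul _).add
      (((tendsto_ltwo_of_tendsto_sub (m3 i j) (fun m => (contDiff_partialDeriv
        (contDiff_partialDeriv (hφ m) i) j).continuous) (t3 i j)).const_mul _).const_mul _)
  · have := tendsto_finsetSum (Finset.univ : Finset Bool) fun s _ =>
      tendsto_sum_abs_sub (hA s)
    simpa using this

theorem HTwo.ltwo_sub_shearPolyDeriv_le (h : HTwo (BoxIntegral.Box.Ioo K) u g H) {i j : Fin n}
    (hij : i ≠ j) :
    ltwo (boxProb K) (fun x => g j x - shearPolyDeriv K i j (edgeTrace K i j u) x) ≤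
      ∑ k, boxLen K k * ltwo (boxProb K) (H j k) := by
  obtain ⟨φ, hφ, hφu⟩ := h.exists_tendstoHTwo
  obtain ⟨m1, m2, m3⟩ := h.memLp_boxProb
  obtain ⟨t1, t2, t3⟩ := hφu.tendsto_boxProb
  have hA : ∀ s t, Tendsto (fun m => edgeAvg K i j (φ m) s t) atTop (𝓝 (edgeTrace K i j u s t)) :=
    fun s t => h.tendsto_traceMean (hasTraceBound_pair hij s t) hφ hφu
  refine ltwo_sub_le_of_tendsto (m2 j) (continuous_shearPolyDeriv i j _)
    (fun m => (contDiff_partialDeriv (hφ m) j).continuous)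
    (fun m => continuous_shearPolyDeriv i j (edgeAvg K i j (φ m))) (t2 j)
    (fun m => _root_.ltwo_sub_shearPolyDeriv_le hij (hφ m)) ?_
    (fun m x hx => abs_shearPolyDeriv_sub_le i j _ _ hx) ?_
  · exact tendsto_finsetSum _ fun k _ => (tendsto_ltwo_of_tendsto_sub (m3 j k)
      (fun m => (contDiff_partialDeriv (contDiff_partialDeriv (hφ m) j) k).continuous)
      (t3 j k)).const_mul _
  · exact tendsto_sum_abs_sub fun s => ((hA s true).sub (hA s false)).div_const _

theorem HTwo.ltwo_sub_normalPoly_le (h : HTwo (BoxIntegral.Box.Ioo K) u g H) (i : Fin n) :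
    ltwo (boxProb K)
      (fun x => u x - normalPoly K i (sideTrace K i u) (∫ y, u y ∂boxProb K) x) ≤
      5 * ∑ k, boxLen K k * ltwo (boxProb K) (g k) := by
  obtain ⟨φ, hφ, hφu⟩ := h.exists_tendstoHTwo
  obtain ⟨m1, m2, m3⟩ := h.memLp_boxProb
  obtain ⟨t1, t2, t3⟩ := hφu.tendsto_boxProb
  have hA : ∀ b, Tendsto (fun m => sideAvg K i (φ m) b) atTop (𝓝 (sideTrace K i u b)) :=
    fun b => h.tendsto_traceMean (hasTraceBound_singleton i b) hφ hφu
  have hM := tendsto_integral_of_tendsto_ltwo m1 (fun m => (hφ m).continuous.memLp_boxProb) t1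
  refine ltwo_sub_le_of_tendsto m1 (continuous_normalPoly i _ _) (fun m => (hφ m).continuous)
    (fun m => continuous_normalPoly i (sideAvg K i (φ m)) (∫ y, φ m y ∂boxProb K)) t1
    (fun m => _root_.ltwo_sub_normalPoly_le i (hφ m)) ?_
    (fun m x hx => abs_normalPoly_sub_le i _ _ _ _ hx) ?_
  · exact (tendsto_finsetSum _ fun k _ => (tendsto_ltwo_of_tendsto_sub (m2 k)
      (fun m => (contDiff_partialDeriv (hφ m) k).continuous) (t2 k)).const_mul _).const_mul _
  · have := (((hA false).sub_const (sideTrace K i u false)).abs.add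
      ((hA true).sub_const (sideTrace K i u true)).abs).add
      ((hM.sub_const (∫ y, u y ∂boxProb K)).abs.mul_const 3)
    simpa using this

theorem HTwo.ltwo_sub_normalPolyDeriv_le (h : HTwo (BoxIntegral.Box.Ioo K) u g H) (i : Fin n) :
    ltwo (boxProb K)
      (fun x => g i x - normalPolyDeriv K i (sideTrace K i u) (∫ y, u y ∂boxProb K) x) ≤
      7 * ∑ k, boxLen K k * ltwo (boxProb K) (H i k) := by
  obtain ⟨φ, hφ, hφu⟩ := h.exists_tendstoHTwo
  obtain ⟨m1, m2, m3⟩ := h.memLp_boxProb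
  obtain ⟨t1, t2, t3⟩ := hφu.tendsto_boxProb
  have hA : ∀ b, Tendsto (fun m => sideAvg K i (φ m) b) atTop (𝓝 (sideTrace K i u b)) :=
    fun b => h.tendsto_traceMean (hasTraceBound_singleton i b) hφ hφu
  have hM := tendsto_integral_of_tendsto_ltwo m1 (fun m => (hφ m).continuous.memLp_boxProb) t1
  refine ltwo_sub_le_of_tendsto (m2 i) (continuous_normalPolyDeriv i _ _)
    (fun m => (contDiff_partialDeriv (hφ m) i).continuous)
    (fun m => continuous_normalPolyDeriv i (sideAvg K i (φ m)) (∫ y, φ m y ∂boxProb K)) (t2 i)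
    (fun m => _root_.ltwo_sub_normalPolyDeriv_le i (hφ m)) ?_
    (fun m x hx => abs_normalPolyDeriv_sub_le i _ _ _ _ hx) ?_
  · exact (tendsto_finsetSum _ fun k _ => (tendsto_ltwo_of_tendsto_sub (m3 i k)
      (fun m => (contDiff_partialDeriv (contDiff_partialDeriv (hφ m) i) k).continuous)
      (t3 i k)).const_mul _).const_mul _
  · have := (((((hA false).sub_const (sideTrace K i u false)).abs.mul_const 6).add
      (((hA true).sub_const (sideTrace K i u true)).abs.mul_const 6)).add
      ((hM.sub_const (∫ y, u y ∂boxProb K)).abs.mul_const 6)).div_const (boxLen K i)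
    simpa using this

end LocalInterpolation

/-! ### The local interpolation operator -/

section LocalStress

variable {n : ℕ} {K : BoxIntegral.Box (Fin n)} {u : (Fin n → ℝ) → ℝ}
  {g : Fin n → (Fin n → ℝ) → ℝ} {H : Fin n → Fin n → (Fin n → ℝ) → ℝ}

theorem integral_quadratic_refCoord (i : Fin n) (b₀ b₁ b₂ : ℝ) :
    ∫ x, (b₀ + b₁ * refCoord K i x + b₂ * refCoord K i x ^ 2) ∂boxProb K =
      b₀ + b₁ / 2 + b₂ / 3 := by
  have hl := boxLen_pos K i
  set F : ℝ → ℝ := fun t => b₀ + b₁ * ((t - K.lower i) / boxLen K i) +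
    b₂ * ((t - K.lower i) / boxLen K i) ^ 2 with hF
  have hFc : Continuous F := by fun_prop
  have h := measurePreserving_eval (edgeProb K) i
  have e1 : ∫ x, (b₀ + b₁ * refCoord K i x + b₂ * refCoord K i x ^ 2) ∂boxProb K =
      ∫ t, F t ∂edgeProb K i := by
    rw [← h.map_eq, integral_map h.aemeasurable hFc.aestronglyMeasurable]
    rfl
  set G : ℝ → ℝ := fun t => b₀ * (t - K.lower i) + b₁ * ((t - K.lower i) ^ 2 / (2 * boxLen K i)) +
    b₂ * ((t - K.lower i) ^ 3 / (3 * boxLen K i ^ 2)) with hG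
  have hd : ∀ t, HasDerivAt G (F t) t := by
    intro t
    have h1 : HasDerivAt (fun t => t - K.lower i) 1 t := (hasDerivAt_id t).sub_const _
    have := ((h1.const_mul b₀).add (((h1.pow 2).div_const (2 * boxLen K i)).const_mul b₁)).add
      (((h1.pow 3).div_const (3 * boxLen K i ^ 2)).const_mul b₂)
    refine this.congr_deriv ?_
    simp only [hF]
    field_simp
    ring
  rw [e1, integral_edgeProb, intervalIntegral.integral_eq_sub_of_hasDerivAt (fun t _ => hd t)
    (hFc.intervalIntegrable _ _)]
  have e2 : K.upper i - K.lower i = boxLen K i := rfl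
  simp only [hG, e2, sub_self]
  field_simp
  ring

theorem refCoord_update_boxEnd (i : Fin n) (x : Fin n → ℝ) (b : Bool) :
    refCoord K i (Function.update x i (boxEnd K i b)) = if b then 1 else 0 := by
  have hl := boxLen_pos K i
  unfold boxLen at hl
  cases b
  · simp [refCoord, boxEnd]
  · simp [refCoord, boxEnd, div_self hl.ne']

theorem integral_quadratic_refCoord_face (i : Fin n) (b₀ b₁ b₂ : ℝ) (b : Bool) :
    ∫ x, (b₀ + b₁ * refCoord K i x + b₂ * refCoord K i x ^ 2) ∂faceProb K {i} (fun _ => b) =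
      if b then b₀ + b₁ + b₂ else b₀ := by
  have hr := continuous_refCoord (K := K) i
  rw [integral_faceProb _ _ (by fun_prop)]
  simp only [Finset.piecewise_singleton, refCoord_update_boxEnd]
  cases b <;> simp

theorem normalPoly_eq_quadratic (i : Fin n) (A : Bool → ℝ) (M : ℝ) (x : Fin n → ℝ) :
    normalPoly K i A M x = A false + (-4 * A false - 2 * A true + 6 * M) * refCoord K i x +
      (3 * A false + 3 * A true - 6 * M) * refCoord K i x ^ 2 := by
  unfold normalPoly
  ring

theorem exists_quadratic_refCoord {i : Fin n} {q : (Fin n → ℝ) → ℝ}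
    (hq : ∃ a₀ a₁ a₂ : ℝ, ∀ x, q x = a₀ + a₁ * x i + a₂ * x i ^ 2) :
    ∃ b₀ b₁ b₂ : ℝ, ∀ x, q x = b₀ + b₁ * refCoord K i x + b₂ * refCoord K i x ^ 2 := by
  obtain ⟨a₀, a₁, a₂, h⟩ := hq
  have hl := boxLen_pos K i
  refine ⟨a₀ + a₁ * K.lower i + a₂ * K.lower i ^ 2, (a₁ + 2 * a₂ * K.lower i) * boxLen K i,
    a₂ * boxLen K i ^ 2, fun x => ?_⟩
  have e : refCoord K i x = (x i - K.lower i) / boxLen K i := rfl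
  rw [h, e]
  field_simp
  ring

/-- Both sides amount to the same three linear conditions on the coefficients of `q` in the
reference coordinate: the end values `b₀` and `b₀ + b₁ + b₂` and the mean `b₀ + b₁ / 2 + b₂ / 3` are
prescribed. These determine the quadratic. -/
theorem HTwo.isNormalInterp_iff (h : HTwo (BoxIntegral.Box.Ioo K) u g H) {i : Fin n}
    {q : (Fin n → ℝ) → ℝ} (hq : ∃ a₀ a₁ a₂ : ℝ, ∀ x, q x = a₀ + a₁ * x i + a₂ * x i ^ 2) :
    IsNormalInterp K i u q ↔
      ∀ x, q x = normalPoly K i (sideTrace K i u) (∫ y, u y ∂boxProb K) x := by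
  obtain ⟨b₀, b₁, b₂, hb⟩ := exists_quadratic_refCoord (K := K) hq
  have hv : (∏ k, ENNReal.ofReal (boxLen K k)).toReal ≠ 0 :=
    (ENNReal.toReal_pos (prod_boxLen_ne_zero K) (prod_boxLen_ne_top K)).ne'
  have hqb : ∫ x, q x ∂boxProb K = b₀ + b₁ / 2 + b₂ / 3 := by
    simp only [hb]
    exact integral_quadratic_refCoord i b₀ b₁ b₂
  have hqf : ∀ b, ∫ x, q x ∂faceProb K {i} (fun _ => b) = if b then b₀ + b₁ + b₂ else b₀ := by
    intro b
    simp only [hb]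
    exact integral_quadratic_refCoord_face i b₀ b₁ b₂ b
  have hvol : (∫ x in BoxIntegral.Box.Icc K, q x = ∫ x in BoxIntegral.Box.Icc K, u x) ↔
      b₀ + b₁ / 2 + b₂ / 3 = ∫ y, u y ∂boxProb K := by
    rw [volume_restrict_boxIcc_eq, integral_smul_measure, integral_smul_measure, hqb]
    simp only [smul_eq_mul]
    exact mul_right_inj' hv
  have hface : ∀ (b : Bool) (w : (Fin n → ℝ) → ℝ), (∫ x, q x ∂(faceMeasure K {i} fun _ => b) =
      ∫ x, w x ∂(faceMeasure K {i} fun _ => b)) ↔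
      (if b then b₀ + b₁ + b₂ else b₀) = ∫ x, w x ∂faceProb K {i} (fun _ => b) := by
    intro b w
    rw [integral_faceMeasure, integral_faceMeasure, hqf]
    exact mul_right_inj' (faceVol_toReal_pos _).ne'
  have hn : (∀ x, q x = normalPoly K i (sideTrace K i u) (∫ y, u y ∂boxProb K) x) ↔
      b₀ = sideTrace K i u false ∧ b₀ + b₁ + b₂ = sideTrace K i u true ∧
        b₀ + b₁ / 2 + b₂ / 3 = ∫ y, u y ∂boxProb K := by
    constructor
    · intro hx
      have e0 := hqf false
      have e1 := hqf true
      have e2 := hqb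
      simp only [hx, normalPoly_eq_quadratic] at e0 e1 e2
      rw [integral_quadratic_refCoord_face] at e0 e1
      rw [integral_quadratic_refCoord] at e2
      simp only [if_true, Bool.false_eq_true, if_false] at e0 e1
      refine ⟨e0.symm, by linarith, by linarith⟩
    · rintro ⟨e0, e1, e2⟩ x
      rw [hb, normalPoly_eq_quadratic, ← e0, ← e1, ← e2]
      ring
  rw [hn, IsNormalInterp, hvol]
  constructor
  · rintro ⟨h1, h2⟩
    obtain ⟨w0, hw0, e0⟩ := h1 false
    obtain ⟨w1, hw1, e1⟩ := h1 true
    rw [hface, h.integral_trace_eq (hasTraceBound_singleton i _) hw0] at e0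
    rw [hface, h.integral_trace_eq (hasTraceBound_singleton i _) hw1] at e1
    exact ⟨e0, e1, h2⟩
  · rintro ⟨e0, e1, e2⟩
    refine ⟨fun b => ?_, e2⟩
    obtain ⟨w, hw⟩ := h.exists_hasTrace (hasTraceBound_singleton (K := K) i b)
    refine ⟨w, hw, ?_⟩
    rw [hface, h.integral_trace_eq (hasTraceBound_singleton i _) hw]
    cases b
    · exact e0
    · exact e1

theorem HTwo.isShearInterp_iff (h : HTwo (BoxIntegral.Box.Ioo K) u g H) {i j : Fin n}
    (hij : i ≠ j) {q : (Fin n → ℝ) → ℝ} :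
    IsShearInterp K i j u q ↔ ∀ x, q x = shearPoly K i j (edgeTrace K i j u) x := by
  constructor
  · rintro ⟨w, hw, hq⟩ x
    rw [hq, shearPoly]
    refine Finset.sum_congr rfl fun s _ => Finset.sum_congr rfl fun t _ => ?_
    rw [average_faceMeasure, h.integral_trace_eq (hasTraceBound_pair hij s t) (hw s t)]
    rfl
  · intro hq
    choose w hw using fun s t => h.exists_hasTrace (hasTraceBound_pair (K := K) hij s t)
    refine ⟨w, hw, fun x => ?_⟩
    rw [hq, shearPoly]
    refine Finset.sum_congr rfl fun s _ => Finset.sum_congr rfl fun t _ => ?_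
    rw [average_faceMeasure, h.integral_trace_eq (hasTraceBound_pair hij s t) (hw s t)]
    rfl

theorem HTwo.congr {Ω : Set (Fin n → ℝ)} (hΩ : IsOpen Ω) (h : HTwo Ω u g H)
    {u' : (Fin n → ℝ) → ℝ} (huu' : u =ᵐ[volume.restrict Ω] u') : HTwo Ω u' g H where
  memLp := h.memLp.ae_eq huu'
  memLp_fst := h.memLp_fst
  memLp_snd := h.memLp_snd
  weak_fst i := (h.weak_fst i).congr hΩ huu' (EventuallyEq.refl _ _)
  weak_snd := h.weak_snd

theorem TendstoHTwo.congr {Ω : Set (Fin n → ℝ)} {φ : ℕ → (Fin n → ℝ) → ℝ}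
    (h : TendstoHTwo Ω φ u g H)
    {u' : (Fin n → ℝ) → ℝ} (huu' : u =ᵐ[volume.restrict Ω] u') : TendstoHTwo Ω φ u' g H := by
  refine ⟨h.1.congr fun m => ltwo_congr_ae (huu'.mono fun x hx => by simp only [hx]), h.2⟩

/-- The integrals over the common face of one and the same smooth sequence converge to both means.
The functions may differ too, which also covers the two symmetric entries of a field. -/
theorem HTwo.traceMean_eq {K' : BoxIntegral.Box (Fin n)} {u' : (Fin n → ℝ) → ℝ}
    {g' : Fin n → (Fin n → ℝ) → ℝ} {H' : Fin n → Fin n → (Fin n → ℝ) → ℝ}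
    (h : HTwo (BoxIntegral.Box.Ioo K) u g H) (h' : HTwo (BoxIntegral.Box.Ioo K') u' g' H')
    {φ : ℕ → (Fin n → ℝ) → ℝ} (hφ : ∀ m, ContDiff ℝ ∞ (φ m))
    (hφu : TendstoHTwo (BoxIntegral.Box.Ioo K) φ u g H)
    (hφu' : TendstoHTwo (BoxIntegral.Box.Ioo K') φ u' g' H') {S S' : Finset (Fin n)}
    {c c' : Fin n → Bool} (hb : HasTraceBound K S c) (hb' : HasTraceBound K' S' c')
    (he : faceProb K S c = faceProb K' S' c') :
    traceMean K S c u = traceMean K' S' c' u' := by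
  have h1 := h.tendsto_traceMean hb hφ hφu
  rw [he] at h1
  exact tendsto_nhds_unique h1 (h'.tendsto_traceMean hb' hφ hφu')

variable (K) in
/-- The interpolation of a matrix field on the box `K`. -/
noncomputable def localStress (σ : (Fin n → ℝ) → Matrix (Fin n) (Fin n) ℝ) (x : Fin n → ℝ) :
    Matrix (Fin n) (Fin n) ℝ := fun i j =>
  if i = j then normalPoly K i (sideTrace K i fun x => σ x i i) (∫ y, σ y i i ∂boxProb K) x
  else shearPoly K i j (edgeTrace K i j fun x => σ x i j) x

variable (K) in
/-- The derivative of the entry `(i, j)` of `localStress` in direction `j`. -/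
noncomputable def localStressDeriv (σ : (Fin n → ℝ) → Matrix (Fin n) (Fin n) ℝ) (i j : Fin n)
    (x : Fin n → ℝ) : ℝ :=
  if i = j then normalPolyDeriv K i (sideTrace K i fun x => σ x i i) (∫ y, σ y i i ∂boxProb K) x
  else shearPolyDeriv K i j (edgeTrace K i j fun x => σ x i j) x

theorem hasDerivAt_refCoord (i : Fin n) (x : Fin n → ℝ) (t : ℝ) :
    HasDerivAt (fun t => refCoord K i (Function.update x i t)) (boxLen K i)⁻¹ t := by
  unfold refCoord
  simp only [Function.update_self]
  have := ((hasDerivAt_id t).sub_const (K.lower i)).div_const (K.upper i - K.lower i)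
  simpa [boxLen] using this

theorem hasDerivAt_nodalFun (b : Bool) (t : ℝ) :
    HasDerivAt (nodalFun b) (if b then 1 else -1) t := by
  cases b
  · exact (hasDerivAt_id t).const_sub 1
  · exact hasDerivAt_id t

theorem hasDerivAt_localStress (σ : (Fin n → ℝ) → Matrix (Fin n) (Fin n) ℝ) (i j : Fin n)
    (x : Fin n → ℝ) (t : ℝ) :
    HasDerivAt (fun t => localStress K σ (Function.update x j t) i j)
      (localStressDeriv K σ i j (Function.update x j t)) t := by
  have hl := (boxLen_pos K j).ne'
  have hr := hasDerivAt_refCoord (K := K) j x t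
  by_cases hij : i = j
  · subst hij
    simp only [localStress, localStressDeriv, if_true, normalPoly_eq_quadratic]
    have := ((hr.const_mul (-4 * sideTrace K i (fun x => σ x i i) false -
      2 * sideTrace K i (fun x => σ x i i) true + 6 * ∫ y, σ y i i ∂boxProb K)).const_add
      (sideTrace K i (fun x => σ x i i) false)).add ((hr.pow 2).const_mul
      (3 * sideTrace K i (fun x => σ x i i) false + 3 * sideTrace K i (fun x => σ x i i) true -
        6 * ∫ y, σ y i i ∂boxProb K))
    refine this.congr_deriv ?_
    unfold normalPolyDeriv
    field_simp
    ring
  · simp only [localStress, localStressDeriv, if_neg hij, shearPoly, shearPolyDeriv,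
      refCoord_update_of_ne hij]
    refine HasDerivAt.fun_sum fun s _ => ?_
    simp only [Fintype.sum_bool]
    have h1 := (((hasDerivAt_nodalFun true _).comp t hr).const_mul
      (nodalFun s (refCoord K i x))).const_mul (edgeTrace K i j (fun x => σ x i j) s true)
    have h2 := (((hasDerivAt_nodalFun false _).comp t hr).const_mul
      (nodalFun s (refCoord K i x))).const_mul (edgeTrace K i j (fun x => σ x i j) s false)
    refine (h1.add h2).congr_deriv ?_
    simp only [if_true, Bool.false_eq_true, if_false]
    field_simp
    ring

theorem faceProb_pair_comm {i j : Fin n} (hij : i ≠ j) (s t : Bool) :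
    faceProb K {i, j} (fun k => if k = i then s else t) =
      faceProb K {j, i} (fun k => if k = j then t else s) := by
  unfold faceProb
  congr 1
  ext1 k
  by_cases hki : k = i
  · subst hki; simp [hij]
  · by_cases hkj : k = j
    · subst hkj; simp [hki]
    · simp [hki, hkj]

/-- A matrix field that is symmetric almost everywhere and has entries in `H²`. -/
structure HTwoSym (Ω : Set (Fin n → ℝ)) (σ : (Fin n → ℝ) → Matrix (Fin n) (Fin n) ℝ)
    (g : Fin n → Fin n → Fin n → (Fin n → ℝ) → ℝ)
    (H : Fin n → Fin n → Fin n → Fin n → (Fin n → ℝ) → ℝ) : Prop where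
  symm : ∀ᵐ x ∂volume.restrict Ω, (σ x).IsSymm
  hTwo : ∀ i j, HTwo Ω (fun x => σ x i j) (g i j) (H i j)

theorem HTwoSym.mono {Ω Ω' : Set (Fin n → ℝ)} {σ : (Fin n → ℝ) → Matrix (Fin n) (Fin n) ℝ}
    {g : Fin n → Fin n → Fin n → (Fin n → ℝ) → ℝ}
    {H : Fin n → Fin n → Fin n → Fin n → (Fin n → ℝ) → ℝ} (h : HTwoSym Ω σ g H) (hs : Ω' ⊆ Ω) :
    HTwoSym Ω' σ g H :=
  ⟨ae_restrict_of_ae_restrict_of_subset hs h.symm, fun i j => (h.hTwo i j).mono hs⟩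

section

variable {σ : (Fin n → ℝ) → Matrix (Fin n) (Fin n) ℝ}
  {g : Fin n → Fin n → Fin n → (Fin n → ℝ) → ℝ}
  {H : Fin n → Fin n → Fin n → Fin n → (Fin n → ℝ) → ℝ}

/-- The entries agree only almost everywhere, which says nothing directly about a null set such as a
face; but a sequence approximating one in `H²` approximates the other. -/
theorem HTwoSym.edgeTrace_comm (h : HTwoSym (BoxIntegral.Box.Ioo K) σ g H) {i j : Fin n}
    (hij : i ≠ j) (s t : Bool) :
    edgeTrace K i j (fun x => σ x i j) s t = edgeTrace K j i (fun x => σ x j i) t s := by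
  obtain ⟨φ, hφ, hφu⟩ := (h.hTwo i j).exists_tendstoHTwo
  have hae : (fun x => σ x i j) =ᵐ[volume.restrict (BoxIntegral.Box.Ioo K)] fun x => σ x j i :=
    h.symm.mono fun x hx => (hx.apply i j).symm
  exact (h.hTwo i j).traceMean_eq ((h.hTwo i j).congr (isOpen_boxIoo K) hae) hφ hφu
    (hφu.congr hae) (hasTraceBound_pair hij s t) (hasTraceBound_pair hij.symm t s)
    (faceProb_pair_comm hij s t)

theorem exists_quadratic_normalPoly (i : Fin n) (A : Bool → ℝ) (M : ℝ) :
    ∃ a₀ a₁ a₂ : ℝ, ∀ x, normalPoly K i A M x = a₀ + a₁ * x i + a₂ * x i ^ 2 := by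
  have hl := boxLen_pos K i
  set b₁ := -4 * A false - 2 * A true + 6 * M with hb₁
  set b₂ := 3 * A false + 3 * A true - 6 * M with hb₂
  refine ⟨A false - b₁ * K.lower i / boxLen K i + b₂ * K.lower i ^ 2 / boxLen K i ^ 2,
    b₁ / boxLen K i - 2 * b₂ * K.lower i / boxLen K i ^ 2, b₂ / boxLen K i ^ 2, fun x => ?_⟩
  have e : refCoord K i x = (x i - K.lower i) / boxLen K i := rfl
  rw [normalPoly_eq_quadratic, ← hb₁, ← hb₂, e]
  field_simp
  ring

theorem exists_bilinear_shearPoly (i j : Fin n) (A : Bool → Bool → ℝ) :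
    ∃ a₀ a₁ a₂ a₃ : ℝ, ∀ x, shearPoly K i j A x =
      a₀ + a₁ * x i + a₂ * x j + a₃ * (x i * x j) := by
  have hi := boxLen_pos K i
  have hj := boxLen_pos K j
  set b₀ := A false false
  set b₁ := A true false - A false false
  set b₂ := A false true - A false false
  set b₃ := A true true - A true false - A false true + A false false
  refine ⟨b₀ - b₁ * K.lower i / boxLen K i - b₂ * K.lower j / boxLen K j +
    b₃ * K.lower i * K.lower j / (boxLen K i * boxLen K j),
    b₁ / boxLen K i - b₃ * K.lower j / (boxLen K i * boxLen K j),
    b₂ / boxLen K j - b₃ * K.lower i / (boxLen K i * boxLen K j),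
    b₃ / (boxLen K i * boxLen K j), fun x => ?_⟩
  have ei : refCoord K i x = (x i - K.lower i) / boxLen K i := rfl
  have ej : refCoord K j x = (x j - K.lower j) / boxLen K j := rfl
  have e : shearPoly K i j A x = b₀ + b₁ * refCoord K i x + b₂ * refCoord K j x +
      b₃ * (refCoord K i x * refCoord K j x) := by
    simp only [shearPoly, Fintype.sum_bool, nodalFun, if_true, Bool.false_eq_true, if_false, b₀, b₁,
      b₂, b₃]
    ring
  rw [e, ei, ej]
  field_simp
  ring

theorem HTwoSym.memLocalStress (h : HTwoSym (BoxIntegral.Box.Ioo K) σ g H) :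
    MemLocalStress (localStress K σ) := by
  refine ⟨fun x => ?_, fun i => ?_, fun i j hij => ?_⟩
  · ext i j
    rw [Matrix.transpose_apply]
    by_cases hij : i = j
    · rw [hij]
    · simp only [localStress, if_neg hij, if_neg (Ne.symm hij), shearPoly]
      rw [Finset.sum_comm]
      refine Finset.sum_congr rfl fun s _ => Finset.sum_congr rfl fun t _ => ?_
      rw [h.edgeTrace_comm hij]
      ring
  · simp only [localStress, if_true]
    exact exists_quadratic_normalPoly i _ _
  · simp only [localStress, if_neg hij]
    exact exists_bilinear_shearPoly i j _

/-- The interpolation conditions on `K` determine the interpolating field. -/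
theorem HTwoSym.interp_iff (h : HTwoSym (BoxIntegral.Box.Ioo K) σ g H)
    {p : (Fin n → ℝ) → Matrix (Fin n) (Fin n) ℝ} (hp : MemLocalStress p) :
    ((∀ i, IsNormalInterp K i (fun x => σ x i i) (fun x => p x i i)) ∧
      ∀ i j, i ≠ j → IsShearInterp K i j (fun x => σ x i j) (fun x => p x i j)) ↔
      p = localStress K σ := by
  constructor
  · rintro ⟨h1, h2⟩
    ext x i j
    by_cases hij : i = j
    · subst hij
      rw [((h.hTwo i i).isNormalInterp_iff (hp.2.1 i)).1 (h1 i) x]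
      simp [localStress]
    · rw [((h.hTwo i j).isShearInterp_iff hij).1 (h2 i j hij) x]
      simp [localStress, hij]
  · rintro rfl
    refine ⟨fun i => ((h.hTwo i i).isNormalInterp_iff (hp.2.1 i)).2 fun x => ?_,
      fun i j hij => ((h.hTwo i j).isShearInterp_iff hij).2 fun x => ?_⟩
    · simp [localStress]
    · simp [localStress, hij]

end

/-! ### Error bounds on one cell -/

/-- From `(x + y)² ≤ 2x² + 2y²` come `98 = 2 · 7²` and `2 D²`, and Cauchy–Schwarz for the sum over
`k` gives a factor `n`. The constant `100 (n + 1) (1 + D²)` dominates `98 n + 2 D²`. -/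
theorem sq_le_of_le_sum {X h D b : ℝ} {a : Fin n → ℝ} (hX : 0 ≤ X) (ha : ∀ k, 0 ≤ a k) (hle : X ≤ 7 * (h * ∑ k, a k) + h * (D * b)) {N : ℝ}
    (hN : ∑ k, a k ^ 2 ≤ N) (hN' : b ^ 2 ≤ N) :
    X ^ 2 ≤ 100 * ((n : ℝ) + 1) * (1 + D ^ 2) * h ^ 2 * N := by
  have h1 : (∑ k, a k) ^ 2 ≤ n * ∑ k, a k ^ 2 := by
    simpa using sq_sum_le_card_mul_sum_sq (s := Finset.univ) (f := a)
  have hS : 0 ≤ ∑ k, a k := Finset.sum_nonneg fun k _ => ha k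
  set S := ∑ k, a k
  have h2 : X ^ 2 ≤ (7 * (h * S) + h * (D * b)) ^ 2 := pow_le_pow_left₀ hX hle 2
  have h3 : (7 * (h * S) + h * (D * b)) ^ 2 ≤ h ^ 2 * (98 * S ^ 2 + 2 * D ^ 2 * b ^ 2) := by
    nlinarith [sq_nonneg (7 * (h * S) - h * (D * b))]
  have hN0 : 0 ≤ N := (sq_nonneg b).trans hN'
  have hn : (0 : ℝ) ≤ n := Nat.cast_nonneg n
  have h4 : S ^ 2 ≤ n * N := h1.trans (mul_le_mul_of_nonneg_left hN hn)
  have h5 : D ^ 2 * b ^ 2 ≤ D ^ 2 * N := mul_le_mul_of_nonneg_left hN' (sq_nonneg D)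
  have h6 : 98 * S ^ 2 + 2 * D ^ 2 * b ^ 2 ≤ 100 * ((n : ℝ) + 1) * (1 + D ^ 2) * N := by
    have e1 : 0 ≤ D ^ 2 * N := mul_nonneg (sq_nonneg D) hN0
    have e2 : 0 ≤ n * (D ^ 2 * N) := mul_nonneg hn e1
    have e3 : 0 ≤ n * N := mul_nonneg hn hN0
    nlinarith
  calc X ^ 2 ≤ h ^ 2 * (98 * S ^ 2 + 2 * D ^ 2 * b ^ 2) := h2.trans h3
    _ ≤ h ^ 2 * (100 * ((n : ℝ) + 1) * (1 + D ^ 2) * N) :=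
        mul_le_mul_of_nonneg_left h6 (sq_nonneg h)
    _ = _ := by ring

theorem integral_sq_le_of_ltwo_le {f b : (Fin n → ℝ) → ℝ} {a : Fin n → (Fin n → ℝ) → ℝ}
    {h D : ℝ} (hlen : ∀ k, boxLen K k ≤ h)
    (hf : MemLp f 2 (volume.restrict (BoxIntegral.Box.Ioo K)))
    (ha : ∀ k, MemLp (a k) 2 (volume.restrict (BoxIntegral.Box.Ioo K)))
    (hb : MemLp b 2 (volume.restrict (BoxIntegral.Box.Ioo K)))
    (hle : ltwo (boxProb K) f ≤ 7 * ∑ k, boxLen K k * ltwo (boxProb K) (a k) +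
      h * (D * ltwo (boxProb K) b)) {N : ℝ}
    (hN : ∑ k, ∫ x in BoxIntegral.Box.Ioo K, a k x ^ 2 ≤ N)
    (hN' : ∫ x in BoxIntegral.Box.Ioo K, b x ^ 2 ≤ N) :
    ∫ x in BoxIntegral.Box.Ioo K, f x ^ 2 ≤
      100 * ((n : ℝ) + 1) * (1 + D ^ 2) * h ^ 2 * N := by
  rw [← ltwo_sq hf]
  simp only [← fun k => ltwo_sq (ha k)] at hN
  rw [← ltwo_sq hb] at hN'
  refine sq_le_of_le_sum (ltwo_nonneg _ _) (fun k => ltwo_nonneg _ _)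
    ?_ hN hN'
  have hs := Real.sqrt_nonneg (∏ k, boxLen K k)
  simp only [ltwo_volume_boxIoo]
  rw [← Finset.mul_sum]
  have h1 : ∑ k, boxLen K k * ltwo (boxProb K) (a k) ≤ h * ∑ k, ltwo (boxProb K) (a k) := by
    rw [Finset.mul_sum]
    exact Finset.sum_le_sum fun k _ => mul_le_mul_of_nonneg_right (hlen k) (ltwo_nonneg _ _)
  have h2 := mul_le_mul_of_nonneg_left hle hs
  have h3 := mul_le_mul_of_nonneg_left h1 hs
  linarith

theorem hTwoNormSq_bounds (Ω : Set (Fin n → ℝ)) (u : (Fin n → ℝ) → ℝ)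
    (g : Fin n → (Fin n → ℝ) → ℝ) (H : Fin n → Fin n → (Fin n → ℝ) → ℝ) :
    0 ≤ hTwoNormSq Ω u g H ∧ ∑ k, ∫ x in Ω, g k x ^ 2 ≤ hTwoNormSq Ω u g H ∧
      (∀ i, ∑ k, ∫ x in Ω, H i k x ^ 2 ≤ hTwoNormSq Ω u g H) ∧
      ∀ i j, ∫ x in Ω, H i j x ^ 2 ≤ hTwoNormSq Ω u g H := by
  have p0 : ∀ f : (Fin n → ℝ) → ℝ, 0 ≤ ∫ x in Ω, f x ^ 2 := fun f =>
    integral_nonneg fun x => sq_nonneg _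
  have p1 : ∀ f : Fin n → (Fin n → ℝ) → ℝ, 0 ≤ ∑ j, ∫ x in Ω, f j x ^ 2 :=
    fun f => Finset.sum_nonneg fun j _ => p0 _
  have e : hTwoNormSq Ω u g H = (∫ x in Ω, u x ^ 2) + ((∑ k, ∫ x in Ω, g k x ^ 2) +
      ∑ i, ∑ j, ∫ x in Ω, H i j x ^ 2) := by
    rw [hTwoNormSq, Finset.sum_add_distrib]
  have q0 := p0 u
  have q1 := p1 g
  have q2 : 0 ≤ ∑ i, ∑ j, ∫ x in Ω, H i j x ^ 2 := Finset.sum_nonneg fun i _ => p1 _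
  have q3 : ∀ i, ∑ k, ∫ x in Ω, H i k x ^ 2 ≤ ∑ i, ∑ j, ∫ x in Ω, H i j x ^ 2 := fun i =>
    Finset.single_le_sum (f := fun i => ∑ j, ∫ x in Ω, H i j x ^ 2) (fun i _ => p1 _)
      (Finset.mem_univ i)
  have q4 : ∀ i j, ∫ x in Ω, H i j x ^ 2 ≤ ∑ k, ∫ x in Ω, H i k x ^ 2 := fun i j =>
    Finset.single_le_sum (f := fun k => ∫ x in Ω, H i k x ^ 2) (fun i _ => p0 _)
      (Finset.mem_univ j)
  rw [e]
  refine ⟨by linarith, by linarith, fun i => ?_, fun i j => ?_⟩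
  · linarith [q3 i]
  · linarith [q3 i, q4 i j]

theorem continuous_localStress (σ : (Fin n → ℝ) → Matrix (Fin n) (Fin n) ℝ) (i j : Fin n) :
    Continuous fun x => localStress K σ x i j := by
  unfold localStress
  by_cases hij : i = j
  · simp only [hij, if_true]; exact continuous_normalPoly j _ _
  · simp only [hij, if_false]; exact continuous_shearPoly i j _

theorem continuous_localStressDeriv (σ : (Fin n → ℝ) → Matrix (Fin n) (Fin n) ℝ) (i j : Fin n) :
    Continuous (localStressDeriv K σ i j) := by
  unfold localStressDeriv
  by_cases hij : i = j
  · simp only [hij, if_true]; exact continuous_normalPolyDeriv j _ _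
  · simp only [hij, if_false]; exact continuous_shearPolyDeriv i j _

theorem HTwoSym.cell_bounds {σ : (Fin n → ℝ) → Matrix (Fin n) (Fin n) ℝ}
    {g : Fin n → Fin n → Fin n → (Fin n → ℝ) → ℝ}
    {H : Fin n → Fin n → Fin n → Fin n → (Fin n → ℝ) → ℝ}
    (hσ : HTwoSym (BoxIntegral.Box.Ioo K) σ g H) {h D : ℝ} (hlen : ∀ k, boxLen K k ≤ h)
    (hh : 0 ≤ h) (hD : h ≤ D) (i j : Fin n) :
    ∫ x in BoxIntegral.Box.Ioo K, (σ x i j - localStress K σ x i j) ^ 2 ≤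
      100 * ((n : ℝ) + 1) * (1 + D ^ 2) * h ^ 2 *
        hTwoNormSq (BoxIntegral.Box.Ioo K) (fun x => σ x i j) (g i j) (H i j) ∧
    ∫ x in BoxIntegral.Box.Ioo K, (g i j j x - localStressDeriv K σ i j x) ^ 2 ≤
      100 * ((n : ℝ) + 1) * (1 + D ^ 2) * h ^ 2 *
        hTwoNormSq (BoxIntegral.Box.Ioo K) (fun x => σ x i j) (g i j) (H i j) := by
  obtain ⟨-, n1, n2, n3⟩ := hTwoNormSq_bounds (BoxIntegral.Box.Ioo K) (fun x => σ x i j) (g i j)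
    (H i j)
  have hs := hσ.hTwo i j
  have hm : ∀ {f : (Fin n → ℝ) → ℝ}, Continuous f →
      MemLp f 2 (volume.restrict (BoxIntegral.Box.Ioo K)) := fun hf =>
    hf.memLp_two_of_subset_compact K.isCompact_Icc K.Ioo_subset_Icc
  have hD0 : 0 ≤ D := hh.trans hD
  have hS1 : 0 ≤ ∑ k, boxLen K k * ltwo (boxProb K) (g i j k) :=
    Finset.sum_nonneg fun k _ => mul_nonneg (boxLen_pos K k).le (ltwo_nonneg _ _)
  have hS2 : 0 ≤ ∑ k, boxLen K k * ltwo (boxProb K) (H i j j k) :=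
    Finset.sum_nonneg fun k _ => mul_nonneg (boxLen_pos K k).le (ltwo_nonneg _ _)
  have hp : 0 ≤ h * (D * ltwo (boxProb K) (H i j i j)) :=
    mul_nonneg hh (mul_nonneg hD0 (ltwo_nonneg _ _))
  constructor
  · refine integral_sq_le_of_ltwo_le (f := fun x => σ x i j - localStress K σ x i j) hlen
      (hs.memLp.sub (hm (continuous_localStress σ i j)))
      hs.memLp_fst (hs.memLp_snd i j) ?_ n1 (n3 i j)
    by_cases hij : i = j
    · subst hij
      have := hs.ltwo_sub_normalPoly_le i
      simp only [localStress, if_true]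
      linarith
    · have := hs.ltwo_sub_shearPoly_le hij
      -- Of the two edge lengths at the mixed derivative, one is kept as `h` and the other absorbed
      -- into `D`.
      have h2 : boxLen K i * (boxLen K j * ltwo (boxProb K) (H i j i j)) ≤
          h * (D * ltwo (boxProb K) (H i j i j)) :=
        mul_le_mul (hlen i) (mul_le_mul_of_nonneg_right ((hlen j).trans hD) (ltwo_nonneg _ _))
          (mul_nonneg (boxLen_pos K j).le (ltwo_nonneg _ _)) hh
      simp only [localStress, if_neg hij]
      linarith
  · refine integral_sq_le_of_ltwo_le (f := fun x => g i j j x - localStressDeriv K σ i j x) hlen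
      ((hs.memLp_fst j).sub (hm (continuous_localStressDeriv σ i j)))
      (hs.memLp_snd j) (hs.memLp_snd i j) ?_ (n2 j) (n3 i j)
    by_cases hij : i = j
    · subst hij
      have := hs.ltwo_sub_normalPolyDeriv_le i
      simp only [localStressDeriv, if_true]
      linarith
    · have := hs.ltwo_sub_shearPolyDeriv_le hij
      simp only [localStressDeriv, if_neg hij]
      linarith

end LocalStress

/-! ### Rectangular grids -/

section Grid

variable {n : ℕ} {Ω : Set (Fin n → ℝ)} {T : RectGrid n} {K K' : BoxIntegral.Box (Fin n)}

theorem RectGrid.Subdivides.Icc_subset (hT : T.Subdivides Ω) (hK : K ∈ T.cells) :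
    BoxIntegral.Box.Icc K ⊆ closure Ω := by
  rw [hT]
  exact Set.subset_biUnion_of_mem (u := fun K => BoxIntegral.Box.Icc K) hK

theorem RectGrid.Subdivides.Ioo_subset (hT : T.Subdivides Ω) (hΩ : interior (closure Ω) = Ω)
    (hK : K ∈ T.cells) : BoxIntegral.Box.Ioo K ⊆ Ω := by
  rw [← hΩ]
  exact interior_maximal (K.Ioo_subset_Icc.trans (hT.Icc_subset hK)) (isOpen_boxIoo K)

theorem RectGrid.Subdivides.exists_mem (hT : T.Subdivides Ω) {x : Fin n → ℝ} (hx : x ∈ Ω) :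
    ∃ K ∈ T.cells, x ∈ BoxIntegral.Box.Icc K := by
  have h := subset_closure hx
  rw [hT] at h
  simpa using h

theorem Icc_subset_closure_Ioo (K : BoxIntegral.Box (Fin n)) :
    BoxIntegral.Box.Icc K ⊆ closure (BoxIntegral.Box.Ioo K) := by
  intro x hx
  have e : BoxIntegral.Box.Ioo K = Set.univ.pi fun k => Set.Ioo (K.lower k) (K.upper k) := rfl
  rw [e, closure_pi_set]
  intro k _
  beta_reduce
  rw [closure_Ioo (K.lower_lt_upper k).ne]
  exact mem_boxIcc.1 hx k

/-- A point in the interior of a cell lies in no other cell. -/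
theorem RectGrid.eq_of_mem_Ioo (hK : K ∈ T.cells) (hK' : K' ∈ T.cells) {x : Fin n → ℝ}
    (hx : x ∈ BoxIntegral.Box.Ioo K) (hx' : x ∈ BoxIntegral.Box.Icc K') : K' = K := by
  by_contra hne
  obtain ⟨y, hy, hy'⟩ := mem_closure_iff.1 (Icc_subset_closure_Ioo K' hx') _ (isOpen_boxIoo K) hx
  exact Set.disjoint_left.1 (T.disjoint K hK K' hK' (Ne.symm hne)) hy hy'

/-- The coordinates of the vertices of the cells. -/
def RectGrid.ticks (T : RectGrid n) : Set ℝ :=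
  ⋃ K ∈ T.cells, Set.range K.lower ∪ Set.range K.upper

theorem RectGrid.finite_ticks (T : RectGrid n) : T.ticks.Finite :=
  T.cells.finite_toSet.biUnion fun K _ => (Set.finite_range K.lower).union (Set.finite_range K.upper)

theorem RectGrid.mem_Ioo_of_notMem_ticks (hK : K ∈ T.cells) {x : Fin n → ℝ}
    (hx : x ∈ BoxIntegral.Box.Icc K) {k : Fin n} (hk : x k ∉ T.ticks) :
    K.lower k < x k ∧ x k < K.upper k := by
  obtain ⟨h1, h2⟩ := mem_boxIcc.1 hx k
  have hl : K.lower k ∈ T.ticks := Set.mem_biUnion hK (Or.inl ⟨k, rfl⟩)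
  have hu : K.upper k ∈ T.ticks := Set.mem_biUnion hK (Or.inr ⟨k, rfl⟩)
  exact ⟨lt_of_le_of_ne h1 fun h => hk (h ▸ hl), lt_of_le_of_ne h2 fun h => hk (h ▸ hu)⟩

/-- A common point with `x_k` strictly inside the edge of `K` shows that direction `k` is not frozen
on the common face. The face then contains the whole edge in that direction, and it lies in `K'`. By
symmetry, cells meeting at a generic point have equal extents in all generic directions. -/
theorem lower_le_lower_of_boxFace_eq {S S' : Finset (Fin n)} {c c' : Fin n → Bool}
    (h : boxFace K S c = boxFace K' S' c') {x : Fin n → ℝ} (hx : x ∈ boxFace K S c) {k : Fin n}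
    (hk : K.lower k < x k ∧ x k < K.upper k) :
    K'.lower k ≤ K.lower k ∧ K.upper k ≤ K'.upper k := by
  have hkS : k ∉ S := by
    intro hkS
    have := hx.2 k hkS
    unfold boxEnd at this
    split_ifs at this <;> linarith
  have key : ∀ t, K.lower k ≤ t → t ≤ K.upper k → K'.lower k ≤ t ∧ t ≤ K'.upper k := by
    intro t h1 h2
    have hm : Function.update x k t ∈ boxFace K S c := by
      refine ⟨mem_boxIcc.2 fun l => ?_, fun l hl => ?_⟩
      · by_cases hlk : l = k
        · subst hlk; simpa using ⟨h1, h2⟩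
        · simpa [hlk] using mem_boxIcc.1 hx.1 l
      · have hlk : l ≠ k := fun e => hkS (e ▸ hl)
        simpa [hlk] using hx.2 l hl
    rw [h] at hm
    simpa using mem_boxIcc.1 hm.1 k
  exact ⟨(key _ le_rfl (K.lower_lt_upper k).le).1, (key _ (K.lower_lt_upper k).le le_rfl).2⟩

/-- Two boxes that share a face perpendicular to the axis `j`, with `K` below `K'`. -/
structure IsBelow (K K' : BoxIntegral.Box (Fin n)) (j : Fin n) : Prop where
  lower_eq : ∀ k, k ≠ j → K.lower k = K'.lower k
  upper_eq : ∀ k, k ≠ j → K.upper k = K'.upper k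
  upper_eq_lower : K.upper j = K'.lower j

/-- Two cells that meet in a generic point of a line in direction `j` share a face perpendicular
to that line. -/
theorem RectGrid.isBelow_or_isBelow (hK : K ∈ T.cells) (hK' : K' ∈ T.cells) (hne : K ≠ K')
    {x : Fin n → ℝ} (hx : x ∈ BoxIntegral.Box.Icc K) (hx' : x ∈ BoxIntegral.Box.Icc K')
    {j : Fin n} (hj : ∀ k, k ≠ j → x k ∉ T.ticks) : IsBelow K K' j ∨ IsBelow K' K j := by
  have h1 := fun k hk => RectGrid.mem_Ioo_of_notMem_ticks hK hx (hj k hk)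
  have h1' := fun k hk => RectGrid.mem_Ioo_of_notMem_ticks hK' hx' (hj k hk)
  obtain h0 | ⟨S, c, S', c', e, e'⟩ := T.conforming K hK K' hK'
  · exact absurd (Set.mem_inter hx hx') (h0 ▸ Set.notMem_empty x)
  have hm : x ∈ boxFace K S c := e ▸ ⟨hx, hx'⟩
  have hm' : x ∈ boxFace K' S' c' := e' ▸ ⟨hx, hx'⟩
  have b := fun k hk => lower_le_lower_of_boxFace_eq (e.symm.trans e') hm (h1 k hk)
  have b' := fun k hk => lower_le_lower_of_boxFace_eq (e'.symm.trans e) hm' (h1' k hk)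
  have hl : ∀ k, k ≠ j → K.lower k = K'.lower k := fun k hk => le_antisymm (b' k hk).1 (b k hk).1
  have hu : ∀ k, k ≠ j → K.upper k = K'.upper k := fun k hk => le_antisymm (b k hk).2 (b' k hk).2
  have hxj := mem_boxIcc.1 hx j
  have hxj' := mem_boxIcc.1 hx' j
  by_cases c1 : K.upper j ≤ K'.lower j
  · exact Or.inl ⟨hl, hu, by linarith⟩
  by_cases c2 : K'.upper j ≤ K.lower j
  · exact Or.inr ⟨fun k hk => (hl k hk).symm, fun k hk => (hu k hk).symm, by linarith⟩
  exfalso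
  -- If the extents in direction `j` overlapped, moving `x_j` into the overlap would give a point in
  -- the interior of both cells.
  obtain ⟨t, ht1, ht2⟩ := exists_between (show max (K.lower j) (K'.lower j) <
      min (K.upper j) (K'.upper j) from max_lt (lt_min (K.lower_lt_upper j) (not_le.1 c2))
        (lt_min (not_le.1 c1) (K'.lower_lt_upper j)))
  rw [max_lt_iff] at ht1
  rw [lt_min_iff] at ht2
  have hm1 : Function.update x j t ∈ BoxIntegral.Box.Ioo K := mem_boxIoo.2 fun k => by
    by_cases hk : k = j
    · subst hk; simpa using ⟨ht1.1, ht2.1⟩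
    · simpa [hk] using h1 k hk
  have hm2 : Function.update x j t ∈ BoxIntegral.Box.Ioo K' := mem_boxIoo.2 fun k => by
    by_cases hk : k = j
    · subst hk; simpa using ⟨ht1.2, ht2.2⟩
    · simpa [hk] using h1' k hk
  exact Set.disjoint_left.1 (T.disjoint K hK K' hK' hne) hm1 hm2

/-! ### Continuity of the normal components across faces -/

theorem IsBelow.exists_union {j : Fin n} (h : IsBelow K K' j) :
    ∃ B : BoxIntegral.Box (Fin n), BoxIntegral.Box.Ioo K ⊆ BoxIntegral.Box.Ioo B ∧
      BoxIntegral.Box.Ioo K' ⊆ BoxIntegral.Box.Ioo B ∧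
      BoxIntegral.Box.Icc B ⊆ BoxIntegral.Box.Icc K ∪ BoxIntegral.Box.Icc K' := by
  have hj := K.lower_lt_upper j
  have hj' := K'.lower_lt_upper j
  have he := h.upper_eq_lower
  -- The union is itself a box, reaching from the bottom of `K` to the top of `K'` in direction `j`.
  refine ⟨⟨K.lower, Function.update K.upper j (K'.upper j), fun k => ?_⟩, ?_, ?_, ?_⟩
  · by_cases hk : k = j
    · subst hk; simp only [Function.update_self]; linarith
    · simp [hk]
  · intro x hx
    refine mem_boxIoo.2 fun k => ?_
    have := mem_boxIoo.1 hx k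
    by_cases hk : k = j
    · subst hk; simp only [Function.update_self]; exact ⟨this.1, by linarith [this.2]⟩
    · simpa [hk] using this
  · intro x hx
    refine mem_boxIoo.2 fun k => ?_
    have := mem_boxIoo.1 hx k
    by_cases hk : k = j
    · subst hk; simp only [Function.update_self]; exact ⟨by linarith [this.1], this.2⟩
    · simpa [hk, h.lower_eq k hk, h.upper_eq k hk] using this
  · intro x hx
    have hb := mem_boxIcc.1 hx
    have hbj := hb j
    simp only [Function.update_self] at hbj
    rcases le_total (x j) (K.upper j) with hc | hc
    · refine Or.inl (mem_boxIcc.2 fun k => ?_)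
      by_cases hk : k = j
      · subst hk; exact ⟨hbj.1, hc⟩
      · simpa [hk] using hb k
    · refine Or.inr (mem_boxIcc.2 fun k => ?_)
      by_cases hk : k = j
      · subst hk; exact ⟨by linarith, hbj.2⟩
      · simpa [hk, h.lower_eq k hk, h.upper_eq k hk] using hb k

theorem IsBelow.faceProb_eq {j : Fin n} (h : IsBelow K K' j) {S : Finset (Fin n)} (hS : j ∈ S)
    {c c' : Fin n → Bool} (hc : c j = true) (hc' : c' j = false)
    (hcc : ∀ k ∈ S, k ≠ j → c k = c' k) : faceProb K S c = faceProb K' S c' := by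
  unfold faceProb
  congr 1
  ext1 k
  by_cases hk : k = j
  · subst hk
    simp [hS, hc, hc', boxEnd, h.upper_eq_lower]
  · by_cases hkS : k ∈ S
    · simp [hkS, boxEnd, hcc k hkS hk, h.lower_eq k hk, h.upper_eq k hk]
    · simp [hkS, edgeProb, boxLen, h.lower_eq k hk, h.upper_eq k hk]

/-- The closed union of the two cells lies in the closure of `Ω`, so its interior lies in `Ω`
because `Ω` is the interior of its closure: there is no slit along the common face. Hence `u` is in
`H²` of the union, and one smooth sequence approximates it on both cells. -/
theorem IsBelow.traceMean_eq (hT : T.Subdivides Ω) (hΩ : interior (closure Ω) = Ω)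
    (hK : K ∈ T.cells) (hK' : K' ∈ T.cells) {j : Fin n} (h : IsBelow K K' j)
    {u : (Fin n → ℝ) → ℝ} {g : Fin n → (Fin n → ℝ) → ℝ} {H : Fin n → Fin n → (Fin n → ℝ) → ℝ}
    (hu : HTwo Ω u g H) {S : Finset (Fin n)} (hS : j ∈ S) {c c' : Fin n → Bool}
    (hc : c j = true) (hc' : c' j = false) (hcc : ∀ k ∈ S, k ≠ j → c k = c' k)
    (hb : HasTraceBound K S c) (hb' : HasTraceBound K' S c') :
    traceMean K S c u = traceMean K' S c' u := by
  obtain ⟨B, h1, h2, h3⟩ := h.exists_union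
  have hB : BoxIntegral.Box.Ioo B ⊆ Ω := by
    rw [← hΩ]
    exact interior_maximal (B.Ioo_subset_Icc.trans (h3.trans (Set.union_subset
      (hT.Icc_subset hK) (hT.Icc_subset hK')))) (isOpen_boxIoo B)
  have huB := hu.mono hB
  obtain ⟨φ, hφ, hφu⟩ := huB.exists_tendstoHTwo
  exact (huB.mono h1).traceMean_eq (huB.mono h2) hφ
    (hφu.mono h1 B.isCompact_Icc B.Ioo_subset_Icc huB hφ)
    (hφu.mono h2 B.isCompact_Icc B.Ioo_subset_Icc huB hφ) hb hb'
    (h.faceProb_eq hS hc hc' hcc)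

/-- On the common face the reference coordinate in direction `j` is `1` seen from `K` and `0` seen
from `K'`. The diagonal entry reduces there to the mean over that face; a shear entry reduces to the
affine function of `x_i` through two means over faces of codimension two in it. Both are shared by
the cells. -/
theorem IsBelow.localStress_eq (hT : T.Subdivides Ω) (hΩ : interior (closure Ω) = Ω)
    (hK : K ∈ T.cells) (hK' : K' ∈ T.cells) {j : Fin n} (h : IsBelow K K' j)
    {σ : (Fin n → ℝ) → Matrix (Fin n) (Fin n) ℝ} {g : Fin n → Fin n → Fin n → (Fin n → ℝ) → ℝ}
    {H : Fin n → Fin n → Fin n → Fin n → (Fin n → ℝ) → ℝ} (hσ : HTwoSym Ω σ g H)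
    {x : Fin n → ℝ} (hx : x ∈ BoxIntegral.Box.Icc K) (hx' : x ∈ BoxIntegral.Box.Icc K')
    (i : Fin n) : localStress K σ x i j = localStress K' σ x i j := by
  have hxj : x j = K.upper j := le_antisymm (mem_boxIcc.1 hx j).2
    (h.upper_eq_lower ▸ (mem_boxIcc.1 hx' j).1)
  have r1 : refCoord K j x = 1 := by
    have := boxLen_pos K j
    unfold boxLen at this
    rw [refCoord, hxj, div_self this.ne']
  have r0 : refCoord K' j x = 0 := by
    rw [refCoord, hxj, h.upper_eq_lower, sub_self, zero_div]
  by_cases hij : i = j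
  · subst hij
    have e : sideTrace K i (fun x => σ x i i) true = sideTrace K' i (fun x => σ x i i) false :=
      h.traceMean_eq hT hΩ hK hK' (hσ.hTwo i i) (Finset.mem_singleton_self i) rfl rfl
        (fun k hk hki => absurd (Finset.mem_singleton.1 hk) hki)
        (hasTraceBound_singleton i _) (hasTraceBound_singleton i _)
    simp only [localStress, if_true, normalPoly, r0, r1, e]
    ring
  · have e : ∀ s, edgeTrace K i j (fun x => σ x i j) s true =
        edgeTrace K' i j (fun x => σ x i j) s false := fun s =>
      h.traceMean_eq hT hΩ hK hK' (hσ.hTwo i j)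
        (Finset.mem_insert_of_mem (Finset.mem_singleton_self j))
        (by simp [Ne.symm hij]) (by simp [Ne.symm hij])
        (fun k hk hkj => by
          have : k = i := by simpa [hkj] using hk
          simp [this])
        (hasTraceBound_pair hij _ _) (hasTraceBound_pair hij _ _)
    have r : refCoord K i x = refCoord K' i x := by
      rw [refCoord, refCoord, h.lower_eq i hij, h.upper_eq i hij]
    simp only [localStress, if_neg hij, shearPoly, r0, r1, r, Fintype.sum_bool, nodalFun, e,
      if_true, Bool.false_eq_true, if_false]
    ring

theorem HTwoSym.localStress_eq (hT : T.Subdivides Ω) (hΩ : interior (closure Ω) = Ω)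
    {σ : (Fin n → ℝ) → Matrix (Fin n) (Fin n) ℝ} {g : Fin n → Fin n → Fin n → (Fin n → ℝ) → ℝ}
    {H : Fin n → Fin n → Fin n → Fin n → (Fin n → ℝ) → ℝ} (hσ : HTwoSym Ω σ g H)
    (hK : K ∈ T.cells) (hK' : K' ∈ T.cells)
    {x : Fin n → ℝ} (hx : x ∈ BoxIntegral.Box.Icc K) (hx' : x ∈ BoxIntegral.Box.Icc K')
    {j : Fin n} (hj : ∀ k, k ≠ j → x k ∉ T.ticks) (i : Fin n) :
    localStress K σ x i j = localStress K' σ x i j := by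
  by_cases hne : K = K'
  · rw [hne]
  · obtain h | h := RectGrid.isBelow_or_isBelow hK hK' hne hx hx' hj
    · exact h.localStress_eq hT hΩ hK hK' hσ hx hx' i
    · exact (h.localStress_eq hT hΩ hK' hK hσ hx' hx i).symm

end Grid

/-! ### Weak derivatives of piecewise smooth functions -/

section Glue

variable {n : ℕ} {Ω : Set (Fin n → ℝ)} {T : RectGrid n} {K : BoxIntegral.Box (Fin n)}

/-- A function vanishes in the mean if its integrals over generic lines in direction `j` vanish. -/
theorem integral_eq_zero_of_lines {N : Set ℝ} (hN : N.Countable) (j : Fin n)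
    {f : (Fin n → ℝ) → ℝ} (hf : Integrable f)
    (h : ∀ x : Fin n → ℝ, (∀ k, k ≠ j → x k ∉ N) →
      Integrable (fun t => f (Function.update x j t)) → ∫ t, f (Function.update x j t) = 0) :
    ∫ x, f x = 0 := by
  cases n with
  | zero => exact j.elim0
  | succ m =>
    have hp := (volume_preserving_piFinSuccAbove (fun _ : Fin (m + 1) => ℝ) j).symm
    have hupd : ∀ (t : ℝ) (y : Fin m → ℝ),
        (MeasurableEquiv.piFinSuccAbove (fun _ : Fin (m + 1) => ℝ) j).symm (t, y) =
          Function.update (j.insertNth (α := fun _ => ℝ) 0 y) j t := by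
      intro t y
      rw [Fin.update_insertNth]
      rfl
    have hi := (hp.integrable_comp_emb (MeasurableEquiv.measurableEmbedding _)).2 hf
    simp only [Function.comp_def] at hi
    rw [← hp.integral_comp (MeasurableEquiv.measurableEmbedding _), Measure.volume_eq_prod,
      integral_prod_symm _ hi]
    -- A countable set is null, so almost every line in direction `j` avoids `N` in all its fixed
    -- coordinates.
    have hae : ∀ᵐ y : Fin m → ℝ, ∀ k, y k ∉ N := by
      refine ae_all_iff.2 fun k => ?_
      have h0 : ∀ᵐ t : ℝ, t ∉ N := hN.ae_notMem volume
      exact (Measure.quasiMeasurePreserving_eval (fun _ : Fin m => (volume : Measure ℝ)) k).ae h0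
    have hz := hi.prod_left_ae
    refine integral_eq_zero_of_ae ?_
    filter_upwards [hae, hz] with y hy hy'
    simp only [hupd] at hy' ⊢
    refine h _ (fun k hk => ?_) hy'
    obtain ⟨l, rfl⟩ := Fin.exists_succAbove_eq hk
    simpa using hy l

open Classical in
/-- The function equal to `F K` on the cell `K`, and to `0` outside all cells. -/
noncomputable def RectGrid.glue (T : RectGrid n)
    (F : BoxIntegral.Box (Fin n) → (Fin n → ℝ) → ℝ) (x : Fin n → ℝ) : ℝ :=
  if h : ∃ K ∈ T.cells, x ∈ BoxIntegral.Box.Icc K then F h.choose x else 0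

/-- On cell boundaries the choice of a cell is arbitrary, so the value there is known only if all
cells containing the point agree. -/
theorem RectGrid.glue_eq (F : BoxIntegral.Box (Fin n) → (Fin n → ℝ) → ℝ) (hK : K ∈ T.cells)
    {x : Fin n → ℝ} (hx : x ∈ BoxIntegral.Box.Icc K)
    (h : ∀ K' ∈ T.cells, x ∈ BoxIntegral.Box.Icc K' → F K' x = F K x) : T.glue F x = F K x := by
  have he : ∃ K ∈ T.cells, x ∈ BoxIntegral.Box.Icc K := ⟨K, hK, hx⟩
  rw [RectGrid.glue, dif_pos he]
  exact h _ he.choose_spec.1 he.choose_spec.2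

theorem RectGrid.glue_eq_of_mem_Ioo (F : BoxIntegral.Box (Fin n) → (Fin n → ℝ) → ℝ)
    (hK : K ∈ T.cells) {x : Fin n → ℝ} (hx : x ∈ BoxIntegral.Box.Ioo K) : T.glue F x = F K x :=
  RectGrid.glue_eq F hK (K.Ioo_subset_Icc hx) fun K' hK' hx' => by
    rw [RectGrid.eq_of_mem_Ioo hK hK' hx hx']

theorem RectGrid.Subdivides.restrict_eq (hT : T.Subdivides Ω) (hΩ : interior (closure Ω) = Ω) :
    volume.restrict Ω = volume.restrict (⋃ K ∈ T.cells, BoxIntegral.Box.Ioo K) := by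
  refine Measure.restrict_congr_set ?_
  have hsub : (⋃ K ∈ T.cells, BoxIntegral.Box.Ioo K) ⊆ Ω :=
    Set.iUnion₂_subset fun K hK => hT.Ioo_subset hΩ hK
  refine EventuallyLE.antisymm ?_ hsub.eventuallyLE
  have h1 : Ω ⊆ ⋃ K ∈ T.cells, BoxIntegral.Box.Icc K := by
    intro x hx
    simpa using hT.exists_mem hx
  have h2 : (⋃ K ∈ T.cells, BoxIntegral.Box.Icc K) =ᵐ[volume]
      (⋃ K ∈ T.cells, BoxIntegral.Box.Ioo K : Set (Fin n → ℝ)) :=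
    Filter.EventuallyEq.countable_bUnion T.cells.countable_toSet fun K _ =>
      (BoxIntegral.Box.Ioo_ae_eq_Icc K).symm
  exact h1.eventuallyLE.trans h2.le

theorem RectGrid.Subdivides.ae_iff (hT : T.Subdivides Ω) (hΩ : interior (closure Ω) = Ω)
    {p : (Fin n → ℝ) → Prop} : (∀ᵐ x ∂volume.restrict Ω, p x) ↔
      ∀ K ∈ T.cells, ∀ᵐ x ∂volume.restrict (BoxIntegral.Box.Ioo K), p x := by
  rw [hT.restrict_eq hΩ, ae_restrict_biUnion_finset_iff]

theorem RectGrid.Subdivides.integral_eq (hT : T.Subdivides Ω) (hΩ : interior (closure Ω) = Ω)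
    {f : (Fin n → ℝ) → ℝ} (hf : IntegrableOn f Ω) :
    ∫ x in Ω, f x = ∑ K ∈ T.cells, ∫ x in BoxIntegral.Box.Ioo K, f x := by
  rw [hT.restrict_eq hΩ]
  refine integral_biUnion_finset _ (fun K _ => (isOpen_boxIoo K).measurableSet)
    (fun K hK K' hK' h => T.disjoint K hK K' hK' h) fun K hK => hf.mono_set (hT.Ioo_subset hΩ hK)

theorem RectGrid.Subdivides.memLp_two (hT : T.Subdivides Ω) (hΩ : interior (closure Ω) = Ω)
    {f : (Fin n → ℝ) → ℝ}
    (hf : ∀ K ∈ T.cells, MemLp f 2 (volume.restrict (BoxIntegral.Box.Ioo K))) :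
    MemLp f 2 (volume.restrict Ω) := by
  have hd : ∀ x, (⋃ K ∈ T.cells, BoxIntegral.Box.Ioo K).indicator f x =
      ∑ K ∈ T.cells, (BoxIntegral.Box.Ioo K).indicator f x := by
    intro x
    refine Finset.indicator_biUnion_apply _ _ ?_ x
    exact fun K hK K' hK' h => T.disjoint K hK K' hK' h
  have hm : MeasurableSet (⋃ K ∈ T.cells, BoxIntegral.Box.Ioo K) :=
    Finset.measurableSet_biUnion _ fun K _ => (isOpen_boxIoo K).measurableSet
  rw [hT.restrict_eq hΩ, ← memLp_indicator_iff_restrict hm]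
  rw [show (⋃ K ∈ T.cells, BoxIntegral.Box.Ioo K).indicator f =
    fun x => ∑ K ∈ T.cells, (BoxIntegral.Box.Ioo K).indicator f x from funext hd]
  exact memLp_finsetSum _ fun K hK =>
    (memLp_indicator_iff_restrict (isOpen_boxIoo K).measurableSet).2 (hf K hK)

theorem RectGrid.Subdivides.memLp_glue (hT : T.Subdivides Ω) (hΩ : interior (closure Ω) = Ω)
    {F : BoxIntegral.Box (Fin n) → (Fin n → ℝ) → ℝ} (hF : ∀ K ∈ T.cells, Continuous (F K)) :
    MemLp (T.glue F) 2 (volume.restrict Ω) := by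
  refine hT.memLp_two hΩ fun K hK => ?_
  refine ((hF K hK).memLp_two_of_subset_compact K.isCompact_Icc K.Ioo_subset_Icc).ae_eq ?_
  refine (ae_restrict_iff' (isOpen_boxIoo K).measurableSet).2 (Eventually.of_forall fun x hx => ?_)
  exact (RectGrid.glue_eq_of_mem_Ioo F hK hx).symm

/-- If the pieces fit together along generic lines in direction `j`, then the glued function has
the glued derivative as weak derivative in direction `j`. -/
theorem RectGrid.Subdivides.hasWeakPartial_glue (hT : T.Subdivides Ω) (hΩo : IsOpen Ω)
    (hΩ : interior (closure Ω) = Ω) {j : Fin n}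
    {F F' : BoxIntegral.Box (Fin n) → (Fin n → ℝ) → ℝ} (hF : ∀ K ∈ T.cells, Continuous (F K))
    (hF' : ∀ K ∈ T.cells, Continuous (F' K))
    (hd : ∀ K ∈ T.cells, ∀ x t, HasDerivAt (fun t => F K (Function.update x j t))
      (F' K (Function.update x j t)) t)
    (hfit : ∀ K ∈ T.cells, ∀ K' ∈ T.cells, ∀ x ∈ BoxIntegral.Box.Icc K,
      x ∈ BoxIntegral.Box.Icc K' → (∀ k, k ≠ j → x k ∉ T.ticks) → F K' x = F K x) :
    HasWeakPartial Ω j (T.glue F) (T.glue F') := by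
  have l1 : LocallyIntegrableOn (T.glue F) Ω := (hT.memLp_glue hΩ hF).locallyIntegrableOn_two
  have l2 : LocallyIntegrableOn (T.glue F') Ω := (hT.memLp_glue hΩ hF').locallyIntegrableOn_two
  refine ⟨l1, l2, fun φ hφ => ?_⟩
  rw [hφ.setIntegral_mul_eq, (hφ.partialDeriv j).setIntegral_mul_eq, eq_neg_iff_add_eq_zero]
  have i1 := LocallyIntegrableOn.integrable_mul_test l1 (hφ.partialDeriv j)
  have i2 := LocallyIntegrableOn.integrable_mul_test l2 hφ
  rw [← integral_add i1 i2]
  -- The integrand is the derivative of `glue F · φ` in direction `j`, except at ticks. It remains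
  -- to see that its integral over each generic line is zero.
  refine integral_eq_zero_of_lines T.finite_ticks.countable j (i1.add i2) fun x hx hxi => ?_
  have hgen : ∀ t k, k ≠ j → Function.update x j t k ∉ T.ticks := fun t k hk => by
    rw [Function.update_of_ne hk]; exact hx k hk
  have hcu : Continuous fun t : ℝ => Function.update x j t :=
    continuous_const.update j continuous_id
  set f : ℝ → ℝ := fun t => T.glue F (Function.update x j t) with hf
  set p : ℝ → ℝ := fun t => φ (Function.update x j t) with hp
  have hpd : ∀ t, HasDerivAt p (partialDeriv j φ (Function.update x j t)) t :=
    fun t => hasDerivAt_update_line hφ.1 j x t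
  have hfK : ∀ K ∈ T.cells, ∀ t, Function.update x j t ∈ BoxIntegral.Box.Icc K →
      f t = F K (Function.update x j t) := fun K hK t ht =>
    RectGrid.glue_eq F hK ht fun K' hK' ht' => hfit K hK K' hK' _ ht ht' (hgen t)
  -- The cells cut the line in finitely many closed sets, on each of which `f` is a continuous
  -- piece, and near a point of `Ω` these sets cover the line.
  have hfc : ∀ t, Function.update x j t ∈ Ω → ContinuousAt f t := by
    have hcl := (locallyFinite_of_finite fun K : {K // K ∈ T.cells} =>
      {t | Function.update x j t ∈ BoxIntegral.Box.Icc K.1}).continuousOn_iUnion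
      (g := f) (fun K => K.1.isCompact_Icc.isClosed.preimage hcu)
      (fun K => (((hF K.1 K.2).comp hcu).continuousOn).congr fun t ht => hfK K.1 K.2 t ht)
    intro t ht
    refine hcl.continuousAt (mem_of_superset ((hΩo.preimage hcu).mem_nhds ht) fun s hs => ?_)
    obtain ⟨K, hK, hKs⟩ := hT.exists_mem hs
    exact Set.mem_iUnion.2 ⟨⟨K, hK⟩, hKs⟩
  have hp0 : ∀ t, Function.update x j t ∉ tsupport φ → ∀ᶠ s in 𝓝 t, f s * p s = 0 := by
    intro t ht
    filter_upwards [((isClosed_tsupport φ).isOpen_compl.preimage hcu).mem_nhds ht] with s hs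
    have : p s = 0 := image_eq_zero_of_notMem_tsupport (f := φ) hs
    rw [this, mul_zero]
  -- Outside `Ω` the glued function may jump, but `φ` vanishes near such points.
  have hcont : Continuous fun t => f t * p t := by
    refine continuous_iff_continuousAt.2 fun t => ?_
    by_cases ht : Function.update x j t ∈ tsupport φ
    · exact (hfc t (hφ.2.2 ht)).mul (hpd t).continuousAt
    · exact (continuousAt_const (y := (0 : ℝ))).congr ((hp0 t ht).mono fun s hs => hs.symm)
  have hder : ∀ t, t ∉ T.ticks → HasDerivAt (fun t => f t * p t)
      (T.glue F (Function.update x j t) * partialDeriv j φ (Function.update x j t) +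
        T.glue F' (Function.update x j t) * φ (Function.update x j t)) t := by
    intro t ht
    by_cases hts : Function.update x j t ∈ tsupport φ
    · obtain ⟨K, hK, hKt⟩ := hT.exists_mem (hφ.2.2 hts)
      have hKo : Function.update x j t ∈ BoxIntegral.Box.Ioo K := mem_boxIoo.2 fun k =>
        RectGrid.mem_Ioo_of_notMem_ticks hK hKt (by
          by_cases hk : k = j
          · subst hk; simpa using ht
          · exact hgen t k hk)
      have hfd : HasDerivAt f (F' K (Function.update x j t)) t := by
        refine (hd K hK x t).congr_of_eventuallyEq ?_
        filter_upwards [((isOpen_boxIoo K).preimage hcu).mem_nhds hKo] with s hs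
        exact hfK K hK s (K.Ioo_subset_Icc hs)
      refine (hfd.mul (hpd t)).congr_deriv ?_
      rw [RectGrid.glue_eq_of_mem_Ioo F' hK hKo, add_comm]
    · have e1 : φ (Function.update x j t) = 0 := image_eq_zero_of_notMem_tsupport hts
      have e2 : partialDeriv j φ (Function.update x j t) = 0 :=
        image_eq_zero_of_notMem_tsupport fun h => hts (tsupport_partialDeriv_subset φ j h)
      rw [e1, e2, mul_zero, mul_zero, add_zero]
      exact (hasDerivAt_const t (0 : ℝ)).congr_of_eventuallyEq (hp0 t hts)
  obtain ⟨R, hR⟩ := hφ.2.1.isBounded.subset_closedBall (0 : Fin n → ℝ)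
  have hout : ∀ t, R < |t| → Function.update x j t ∉ tsupport φ := by
    intro t ht hts
    have h1 : ‖Function.update x j t‖ ≤ R := by simpa using hR hts
    have h2 := norm_le_pi_norm (Function.update x j t) j
    rw [Function.update_self, Real.norm_eq_abs] at h2
    linarith
  -- Both ends of `[-b, b]` lie beyond the support of `φ`, so the boundary terms vanish and the
  -- integral over the line reduces to this interval.
  set b : ℝ := |R| + 1 with hb
  have hb0 : 0 < b := by positivity
  have hRb : R < b := (le_abs_self R).trans_lt (lt_add_one _)
  have hsupp : ∀ t, R < |t| → T.glue F (Function.update x j t) *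
      partialDeriv j φ (Function.update x j t) +
        T.glue F' (Function.update x j t) * φ (Function.update x j t) = 0 := by
    intro t ht
    have e1 : φ (Function.update x j t) = 0 := image_eq_zero_of_notMem_tsupport (hout t ht)
    have e2 : partialDeriv j φ (Function.update x j t) = 0 :=
      image_eq_zero_of_notMem_tsupport fun h => hout t ht (tsupport_partialDeriv_subset φ j h)
    rw [e1, e2, mul_zero, mul_zero, add_zero]
  -- Continuity everywhere and differentiability off the finite set of ticks suffice; integrability
  -- along the line is supplied by Fubini.
  have hFTC := integral_eq_of_hasDerivAt_off_countable_of_le (fun t => f t * p t)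
    (fun t => T.glue F (Function.update x j t) * partialDeriv j φ (Function.update x j t) +
        T.glue F' (Function.update x j t) * φ (Function.update x j t))
    (neg_le_self hb0.le) T.finite_ticks.countable hcont.continuousOn
    (fun t ht => hder t ht.2) hxi.intervalIntegrable
  have pb : p b = 0 := image_eq_zero_of_notMem_tsupport (f := φ) (hout b (by rwa [abs_of_pos hb0]))
  have pb' : p (-b) = 0 :=
    image_eq_zero_of_notMem_tsupport (f := φ) (hout (-b) (by rwa [abs_neg, abs_of_pos hb0]))
  rw [pb, pb', mul_zero, mul_zero, sub_zero] at hFTC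
  rw [← hFTC, intervalIntegral.integral_eq_integral_of_support_subset]
  intro t ht
  by_contra hc
  refine ht (hsupp t ?_)
  rw [Set.mem_Ioc, not_and_or, not_lt, not_le] at hc
  rcases hc with hc | hc
  · exact hRb.trans_le (by rw [abs_of_nonpos (by linarith)]; linarith)
  · exact hRb.trans (hc.trans_le (le_abs_self t))

end Glue

/-! ### The global interpolation operator -/

section Global

variable {n : ℕ} {Ω : Set (Fin n → ℝ)} {T : RectGrid n}
  {σ : (Fin n → ℝ) → Matrix (Fin n) (Fin n) ℝ} {g : Fin n → Fin n → Fin n → (Fin n → ℝ) → ℝ}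
  {H : Fin n → Fin n → Fin n → Fin n → (Fin n → ℝ) → ℝ}

theorem MemSobolevSym.exists_hTwoSym (h : MemSobolevSym Ω 2 σ) : ∃ g H, HTwoSym Ω σ g H := by
  choose g H hgH using fun i j => memSobolev_two_iff.1 (h.2 i j)
  exact ⟨g, H, h.1, hgH⟩

/-- The interpolation of a matrix field on the grid. -/
noncomputable def RectGrid.interp (T : RectGrid n) (σ : (Fin n → ℝ) → Matrix (Fin n) (Fin n) ℝ)
    (x : Fin n → ℝ) : Matrix (Fin n) (Fin n) ℝ :=
  fun i j => T.glue (fun K x => localStress K σ x i j) x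

/-- The derivative of the entry `(i, j)` of the interpolation in direction `j`, cell by cell. -/
noncomputable def RectGrid.interpDeriv (T : RectGrid n)
    (σ : (Fin n → ℝ) → Matrix (Fin n) (Fin n) ℝ) (i j : Fin n) : (Fin n → ℝ) → ℝ :=
  T.glue fun K => localStressDeriv K σ i j

theorem RectGrid.interp_eq (σ : (Fin n → ℝ) → Matrix (Fin n) (Fin n) ℝ)
    {K : BoxIntegral.Box (Fin n)} (hK : K ∈ T.cells) {x : Fin n → ℝ}
    (hx : x ∈ BoxIntegral.Box.Ioo K) : T.interp σ x = localStress K σ x := by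
  ext i j
  exact RectGrid.glue_eq_of_mem_Ioo (fun K x => localStress K σ x i j) hK hx

theorem RectGrid.ae_interp_eq (σ : (Fin n → ℝ) → Matrix (Fin n) (Fin n) ℝ)
    {K : BoxIntegral.Box (Fin n)} (hK : K ∈ T.cells) :
    ∀ᵐ x ∂volume.restrict (BoxIntegral.Box.Ioo K), T.interp σ x = localStress K σ x :=
  (ae_restrict_iff' (isOpen_boxIoo K).measurableSet).2
    (Eventually.of_forall fun _ hx => RectGrid.interp_eq σ hK hx)

theorem ae_restrict_Icc_iff (K : BoxIntegral.Box (Fin n)) {p : (Fin n → ℝ) → Prop} :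
    (∀ᵐ x ∂volume.restrict (BoxIntegral.Box.Icc K), p x) ↔
      ∀ᵐ x ∂volume.restrict (BoxIntegral.Box.Ioo K), p x := by
  rw [Measure.restrict_congr_set (BoxIntegral.Box.Ioo_ae_eq_Icc K)]

theorem RectGrid.Subdivides.memLp_interp (hT : T.Subdivides Ω) (hΩ : interior (closure Ω) = Ω) (i j : Fin n) :
    MemLp (fun x => T.interp σ x i j) 2 (volume.restrict Ω) :=
  hT.memLp_glue hΩ fun _ _ => continuous_localStress σ i j

theorem RectGrid.Subdivides.memLp_interpDeriv (hT : T.Subdivides Ω) (hΩ : interior (closure Ω) = Ω)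
    (i j : Fin n) : MemLp (T.interpDeriv σ i j) 2 (volume.restrict Ω) :=
  hT.memLp_glue hΩ fun _ _ => continuous_localStressDeriv σ i j

theorem HTwoSym.hasWeakPartial_interp (hσ : HTwoSym Ω σ g H) (hT : T.Subdivides Ω)
    (hΩo : IsOpen Ω) (hΩ : interior (closure Ω) = Ω) (i j : Fin n) :
    HasWeakPartial Ω j (fun x => T.interp σ x i j) (T.interpDeriv σ i j) :=
  hT.hasWeakPartial_glue hΩo hΩ (fun _ _ => continuous_localStress σ i j)
    (fun _ _ => continuous_localStressDeriv σ i j)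
    (fun _ _ x t => hasDerivAt_localStress σ i j x t)
    fun _ hK _ hK' _ hx hx' hgen => hσ.localStress_eq hT hΩ hK' hK hx' hx hgen i

/-- Membership in `H(div)` is obtained entry by entry, each `(i, j)` being weakly differentiable in
direction `j`. The cellwise conditions hold by construction. -/
theorem HTwoSym.isInterpolant_interp (hσ : HTwoSym Ω σ g H) (hT : T.Subdivides Ω)
    (hΩo : IsOpen Ω) (hΩ : interior (closure Ω) = Ω) : IsInterpolant Ω T σ (T.interp σ) := by
  have hloc : ∀ K ∈ T.cells, HTwoSym (BoxIntegral.Box.Ioo K) σ g H := fun K hK =>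
    hσ.mono (hT.Ioo_subset hΩ hK)
  have hsymm : ∀ᵐ x ∂volume.restrict Ω, (T.interp σ x).IsSymm := by
    refine (hT.ae_iff hΩ).2 fun K hK => (RectGrid.ae_interp_eq σ hK).mono fun x hx => ?_
    rw [hx]
    exact (hloc K hK).memLocalStress.1 x
  refine ⟨⟨⟨hsymm, hT.memLp_interp hΩ, fun i =>
    ⟨fun x => ∑ j, T.interpDeriv σ i j x, ?_, ?_⟩⟩, fun K hK => ?_⟩, fun K hK => ?_⟩
  · exact hasWeakDiv_of_hasWeakPartial hΩo fun j => hσ.hasWeakPartial_interp hT hΩo hΩ i j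
  · exact memLp_finsetSum _ fun j _ => hT.memLp_interpDeriv hΩ i j
  · exact ⟨localStress K σ, (hloc K hK).memLocalStress,
      (ae_restrict_Icc_iff K).2 (RectGrid.ae_interp_eq σ hK)⟩
  · exact ⟨localStress K σ, (hloc K hK).memLocalStress,
      (ae_restrict_Icc_iff K).2 (RectGrid.ae_interp_eq σ hK),
      ((hloc K hK).interp_iff (hloc K hK).memLocalStress).2 rfl⟩

/-- Uniqueness is local: on each cell the conditions fix the polynomial representative, and the cell
boundaries are null. Every bound for `T.interp σ` therefore applies to an arbitrary interpolant. -/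
theorem HTwoSym.ae_eq_interp (hσ : HTwoSym Ω σ g H) (hT : T.Subdivides Ω)
    (hΩ : interior (closure Ω) = Ω) {τ : (Fin n → ℝ) → Matrix (Fin n) (Fin n) ℝ}
    (hτ : IsInterpolant Ω T σ τ) : ∀ᵐ x ∂volume.restrict Ω, τ x = T.interp σ x := by
  refine (hT.ae_iff hΩ).2 fun K hK => ?_
  obtain ⟨p, hp, hτp, h1, h2⟩ := hτ.2 K hK
  have hpe := ((hσ.mono (hT.Ioo_subset hΩ hK)).interp_iff hp).1 ⟨h1, h2⟩
  filter_upwards [(ae_restrict_Icc_iff K).1 hτp, RectGrid.ae_interp_eq (T := T) σ hK] with x hx hx'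
  rw [hx, hx', hpe]

theorem RectGrid.Subdivides.sum_hTwoNormSq (hT : T.Subdivides Ω) (hΩ : interior (closure Ω) = Ω)
    {u : (Fin n → ℝ) → ℝ} {g : Fin n → (Fin n → ℝ) → ℝ} {H : Fin n → Fin n → (Fin n → ℝ) → ℝ}
    (h : HTwo Ω u g H) :
    ∑ K ∈ T.cells, hTwoNormSq (BoxIntegral.Box.Ioo K) u g H = hTwoNormSq Ω u g H := by
  simp only [hTwoNormSq, Finset.sum_add_distrib]
  rw [hT.integral_eq hΩ h.memLp.integrable_sq, Finset.sum_comm]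
  congr 2
  · exact Finset.sum_congr rfl fun i _ => (hT.integral_eq hΩ (h.memLp_fst i).integrable_sq).symm
  · rw [Finset.sum_comm]
    refine Finset.sum_congr rfl fun i _ => ?_
    rw [Finset.sum_comm]
    exact Finset.sum_congr rfl fun j _ => (hT.integral_eq hΩ (h.memLp_snd i j).integrable_sq).symm

/-- The factor in the squared error bounds, for grids with edges of length at most `D`. -/
noncomputable def errorConst (n : ℕ) (D : ℝ) : ℝ := 100 * ((n : ℝ) + 1) * (1 + D ^ 2)

theorem HTwoSym.interp_bounds (hσ : HTwoSym Ω σ g H) (hT : T.Subdivides Ω)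
    (hΩ : interior (closure Ω) = Ω) {h D : ℝ} (hlen : ∀ K ∈ T.cells, ∀ k, boxLen K k ≤ h)
    (hh : 0 ≤ h) (hD : h ≤ D) (i j : Fin n) :
    ∫ x in Ω, (σ x i j - T.interp σ x i j) ^ 2 ≤
      errorConst n D * h ^ 2 * hTwoNormSq Ω (fun x => σ x i j) (g i j) (H i j) ∧
    ∫ x in Ω, (g i j j x - T.interpDeriv σ i j x) ^ 2 ≤
      errorConst n D * h ^ 2 * hTwoNormSq Ω (fun x => σ x i j) (g i j) (H i j) := by
  have hs := hσ.hTwo i j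
  have hb := fun K (hK : K ∈ T.cells) =>
    (hσ.mono (hT.Ioo_subset hΩ hK)).cell_bounds (hlen K hK) hh hD i j
  have e1 := hT.integral_eq hΩ (f := fun x => (σ x i j - T.interp σ x i j) ^ 2)
    (hs.memLp.sub (hT.memLp_interp hΩ i j)).integrable_sq
  have e2 := hT.integral_eq hΩ (f := fun x => (g i j j x - T.interpDeriv σ i j x) ^ 2)
    ((hs.memLp_fst j).sub (hT.memLp_interpDeriv hΩ i j)).integrable_sq
  rw [e1, e2, ← hT.sum_hTwoNormSq hΩ hs, Finset.mul_sum]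
  refine ⟨Finset.sum_le_sum fun K hK => ?_, Finset.sum_le_sum fun K hK => ?_⟩
  · refine le_trans (le_of_eq ?_) (hb K hK).1
    refine setIntegral_congr_fun (isOpen_boxIoo K).measurableSet fun x hx => ?_
    simp only [RectGrid.interp_eq σ hK hx]
  · refine le_trans (le_of_eq ?_) (hb K hK).2
    refine setIntegral_congr_fun (isOpen_boxIoo K).measurableSet fun x hx => ?_
    simp only [RectGrid.interpDeriv, RectGrid.glue_eq_of_mem_Ioo _ hK hx]

theorem integral_sq_sum_le {X : Type*} [MeasurableSpace X] {μ : Measure X} {d : Fin n → X → ℝ}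
    (hd : ∀ j, MemLp (d j) 2 μ) :
    ∫ x, (∑ j, d j x) ^ 2 ∂μ ≤ n * ∑ j, ∫ x, d j x ^ 2 ∂μ := by
  rw [← integral_finsetSum _ fun j _ => (hd j).integrable_sq, ← integral_const_mul]
  refine integral_mono (memLp_finsetSum _ fun j _ => hd j).integrable_sq
    ((integrable_finsetSum _ fun j _ => (hd j).integrable_sq).const_mul _) fun x => ?_
  simpa using sq_sum_le_card_mul_sum_sq (s := Finset.univ) (f := fun j => d j x)

theorem RectGrid.size_nonneg (T : RectGrid n) : 0 ≤ T.size :=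
  Real.iSup_nonneg fun p => (boxLen_pos p.1.1 p.2).le

theorem RectGrid.boxLen_le_size {K : BoxIntegral.Box (Fin n)} (hK : K ∈ T.cells) (k : Fin n) :
    boxLen K k ≤ T.size :=
  le_ciSup (f := fun p : {K // K ∈ T.cells} × Fin n => p.1.1.upper p.2 - p.1.1.lower p.2)
    (Set.finite_range _).bddAbove (⟨K, hK⟩, k)

/-- The edge lengths of a cell are bounded by the sup-norm distance of its opposite corners. This
frees the constant from the grid. -/
theorem RectGrid.Subdivides.size_le (hT : T.Subdivides Ω) (hΩ : Bornology.IsBounded Ω) :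
    T.size ≤ Metric.diam (closure Ω) := by
  refine Real.iSup_le (fun p => ?_) Metric.diam_nonneg
  have hs := hT.Icc_subset p.1.2
  calc p.1.1.upper p.2 - p.1.1.lower p.2 ≤ dist (p.1.1.upper p.2) (p.1.1.lower p.2) :=
        le_abs_self _
    _ ≤ dist p.1.1.upper p.1.1.lower := dist_le_pi_dist _ _ _
    _ ≤ _ := Metric.dist_le_diam_of_mem hΩ.closure (hs p.1.1.upper_mem_Icc) (hs p.1.1.lower_mem_Icc)

theorem IsRectPolyhedron.isBounded (hΩ : IsRectPolyhedron Ω) : Bornology.IsBounded Ω := by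
  obtain ⟨-, -, -, s, hs⟩ := hΩ
  refine Bornology.IsBounded.subset ?_ subset_closure
  rw [hs]
  exact (Bornology.isBounded_biUnion_finset s).2 fun K _ => K.isBounded_Icc

theorem sqrt_le_mul_sqrt {X N C h : ℝ} (hC : 0 ≤ C) (hh : 0 ≤ h)
    (hX : X ≤ C ^ 2 * h ^ 2 * N) : √X ≤ C * h * √N := by
  refine (Real.sqrt_le_sqrt hX).trans (le_of_eq ?_)
  rw [← mul_pow, Real.sqrt_mul (sq_nonneg _), Real.sqrt_sq (mul_nonneg hC hh)]

theorem HTwoSym.norm_bounds (hσ : HTwoSym Ω σ g H) (hT : T.Subdivides Ω) (hΩo : IsOpen Ω)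
    (hΩ : interior (closure Ω) = Ω) {D C : ℝ} (hD : T.size ≤ D) (hC0 : 0 ≤ C)
    (hC : C ^ 2 = ((n : ℝ) + 1) * errorConst n D)
    {τ : (Fin n → ℝ) → Matrix (Fin n) (Fin n) ℝ} (hτ : IsInterpolant Ω T σ τ) :
    matSobolevNorm Ω 0 (fun x => σ x - τ x) ≤ C * T.size * matSobolevNorm Ω 2 σ ∧
      divNorm Ω (fun x => σ x - τ x) ≤ C * T.size * matSobolevNorm Ω 2 σ := by
  have hh := T.size_nonneg
  have hb := hσ.interp_bounds hT hΩ (fun K hK k => RectGrid.boxLen_le_size hK k) hh hD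
  have hae := hσ.ae_eq_interp hT hΩ hτ
  have hE : 0 ≤ errorConst n D := by unfold errorConst; positivity
  have hn : (0 : ℝ) ≤ n := Nat.cast_nonneg n
  set N := fun i j => hTwoNormSq Ω (fun x => σ x i j) (g i j) (H i j) with hN
  have hN0 : ∀ i j, 0 ≤ N i j := fun i j => (hTwoNormSq_bounds Ω _ _ _).1
  have hS : 0 ≤ ∑ i, ∑ j, N i j := Finset.sum_nonneg fun i _ => Finset.sum_nonneg fun j _ => hN0 i j
  have hnorm : matSobolevNorm Ω 2 σ = √(∑ i, ∑ j, N i j) := by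
    simp only [matSobolevNorm, hN, fun i j => (hσ.hTwo i j).sobolevNormSq_eq hΩo]
  have hP : 0 ≤ errorConst n D * T.size ^ 2 * ∑ i, ∑ j, N i j := by positivity
  rw [hnorm]
  constructor
  · refine sqrt_le_mul_sqrt hC0 hh ?_
    calc ∑ i, ∑ j, sobolevNormSq Ω 0 (fun x => (σ x - τ x) i j)
        ≤ ∑ i, ∑ j, errorConst n D * T.size ^ 2 * N i j := by
          refine Finset.sum_le_sum fun i _ => Finset.sum_le_sum fun j _ => ?_
          refine le_trans (le_of_eq ?_) (hb i j).1
          exact integral_congr_ae (hae.mono fun x hx => by simp [hx])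
      _ = errorConst n D * T.size ^ 2 * ∑ i, ∑ j, N i j := by simp only [Finset.mul_sum]
      _ ≤ _ := by
          rw [hC]
          nlinarith
  · refine sqrt_le_mul_sqrt hC0 hh ?_
    -- `divNorm` uses a divergence defined by choice, so an explicit representative is exhibited.
    have hdiv : ∀ i, HasWeakDiv Ω (fun x => (σ x - τ x) i)
        (fun x => ∑ j, (g i j j x - T.interpDeriv σ i j x)) := fun i => by
      refine hasWeakDiv_of_hasWeakPartial hΩo fun j => ?_
      refine (((hσ.hTwo i j).weak_fst j).sub (hσ.hasWeakPartial_interp hT hΩo hΩ i j)).congr hΩo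
        ?_ (EventuallyEq.refl _ _)
      exact hae.mono fun x hx => by simp [hx]
    calc ∑ i, ∫ x in Ω, weakDiv Ω (fun x => (σ x - τ x) i) x ^ 2
        ≤ ∑ i, n * ∑ j, errorConst n D * T.size ^ 2 * N i j := by
          refine Finset.sum_le_sum fun i _ => ?_
          rw [integral_congr_ae (((hdiv i).weakDiv_ae_eq hΩo).mono fun x hx =>
            show _ = (∑ j, (g i j j x - T.interpDeriv σ i j x)) ^ 2 by rw [hx])]
          refine (integral_sq_sum_le fun j => ((hσ.hTwo i j).memLp_fst j).sub
            (hT.memLp_interpDeriv hΩ i j)).trans ?_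
          exact mul_le_mul_of_nonneg_left (Finset.sum_le_sum fun j _ => (hb i j).2) hn
      _ = n * (errorConst n D * T.size ^ 2 * ∑ i, ∑ j, N i j) := by simp only [Finset.mul_sum]
      _ ≤ _ := by
          rw [hC]
          nlinarith

end Global

/-! ### The interpolation theorem -/

theorem mainTheorem4 (n : ℕ) (Ω : Set (Fin n → ℝ)) (hΩ : IsRectPolyhedron Ω) :
    ∃ C : ℝ, 0 < C ∧ ∀ T : RectGrid n, T.Subdivides Ω →
      ∀ σ : (Fin n → ℝ) → Matrix (Fin n) (Fin n) ℝ, MemSobolevSym Ω 2 σ →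
        (∃ τ, IsInterpolant Ω T σ τ) ∧
        (∀ τ τ', IsInterpolant Ω T σ τ → IsInterpolant Ω T σ τ' →
          ∀ᵐ x ∂volume.restrict Ω, τ x = τ' x) ∧
        ∀ τ, IsInterpolant Ω T σ τ →
          matSobolevNorm Ω 0 (fun x => σ x - τ x) ≤ C * T.size * matSobolevNorm Ω 2 σ ∧
          divNorm Ω (fun x => σ x - τ x) ≤ C * T.size * matSobolevNorm Ω 2 σ := by
  have hb := hΩ.isBounded
  obtain ⟨hΩo, -, hΩi, -⟩ := hΩ
  set D := Metric.diam (closure Ω)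
  have hpos : 0 < ((n : ℝ) + 1) * errorConst n D := by unfold errorConst; positivity
  -- The squared divergence error costs a factor `n` by Cauchy–Schwarz, the squared `L²` error a
  -- factor `1`; `n + 1` covers both and stays positive for `n = 0`.
  refine ⟨√(((n : ℝ) + 1) * errorConst n D), Real.sqrt_pos.2 hpos, fun T hT σ hσ => ?_⟩
  obtain ⟨g, H, h⟩ := hσ.exists_hTwoSym
  refine ⟨⟨T.interp σ, h.isInterpolant_interp hT hΩo hΩi⟩, fun τ τ' hτ hτ' => ?_, fun τ hτ => ?_⟩
  · filter_upwards [h.ae_eq_interp hT hΩi hτ, h.ae_eq_interp hT hΩi hτ'] with x hx hx'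
    rw [hx, hx']
  · exact h.norm_bounds hT hΩo hΩi (hT.size_le hb) (Real.sqrt_nonneg _) (Real.sq_sqrt hpos.le) hτ
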